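/- Let $\mathbb{O}$ be the octonions and let $$\mathbb{OP}^2=\{P\in \mathrm{Mat}_3(\mathbb{O}) : P^*=P,\ P^2=P,\ \operatorname{tr}P=1\}$$ be the octonionic projective plane with the Fubini--Study metric, whose geodesic distance (up to scale) is $d(P,Q)=\arccos\sqrt{\operatorname{Re}\operatorname{tr}(PQ)}$. Let $\mathrm{Isom}(\mathbb{OP}^2)$ be its isometry group. The standard $\mathbb{CP}^2\subset\mathbb{OP}^2$ is the image of $\mathbb{CP}^2=\{P\in \mathrm{Mat}_3(\mathbb{C}) : P^*=P,\ P^2=P,\ \operatorname{tr}P=1\}$ under the embedding induced by the inclusion $\mathbb{C}\subset\mathbb{O}$. Let $G_{351}=\mathbb{F}_{27}\rtimes(\mathbb{F}_{27}^{\times})^2\cong \mathrm{C}_3^3\rtimes\mathrm{C}_{13}$ be the group of all affine maps $x\mapsto ax+b$ of $\mathbb{F}_{27}$ with $a$ a nonzero square. **Proposition.** (1) Let $G\subset\mathrm{Isom}(\mathbb{OP}^2)$ be any subgroup isomorphic to $G_{351}$ (in particular, the one obtained from Alekseevskii's non-toral subgroup $\mathrm{C}_3^3$ and a subgroup $\mathrm{C}_{13}$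 of its normalizer), and let $H\subset G$ be any subgroup of order $3$. Then the fixed point set $(\mathbb{OP}^2)^{H}$ is a standardly embedded $\mathbb{CP}^2$: there is $g\in\mathrm{Isom}(\mathbb{OP}^2)$ such that $g\bigl((\mathbb{OP}^2)^{H}\bigr)$ is the standard $\mathbb{CP}^2\subset\mathbb{OP}^2$. (2) Subgroups $\mathrm{C}_3\cong H\subset G\subset\mathrm{Isom}(\mathbb{OP}^2)$ with $G\cong G_{351}$ can be chosen so that $(\mathbb{OP}^2)^{H}$ coincides with the standard $\mathbb{CP}^2\subset\mathbb{OP}^2$. -/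

import Mathlib

/-! ### Octonions -/

/-- The octonions `𝕆`, obtained from the quaternions by the Cayley-Dickson construction. -/
@[ext]
structure Octonion where
  fst : Quaternion ℝ
  snd : Quaternion ℝ

namespace Octonion

noncomputable section

instance : Zero Octonion := ⟨⟨0, 0⟩⟩
instance : One Octonion := ⟨⟨1, 0⟩⟩
instance : Add Octonion := ⟨fun x y => ⟨x.fst + y.fst, x.snd + y.snd⟩⟩
instance : Neg Octonion := ⟨fun x => ⟨-x.fst, -x.snd⟩⟩
instance : SMul ℝ Octonion := ⟨fun r x => ⟨r • x.fst, r • x.snd⟩⟩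

/-- `(a, b) (c, d) = (a c - d̄ b, d a + b c̄)`. -/
instance : Mul Octonion :=
  ⟨fun x y => ⟨x.fst * y.fst - star y.snd * x.snd, y.snd * x.fst + x.snd * star y.fst⟩⟩

/-- Octonionic conjugation: the conjugate of `(a, b)` is `(ā, -b)`. -/
instance : Star Octonion := ⟨fun x => ⟨star x.fst, -x.snd⟩⟩

@[simp] theorem fst_zero : (0 : Octonion).fst = 0 := rfl
@[simp] theorem snd_zero : (0 : Octonion).snd = 0 := rfl
@[simp] theorem fst_one : (1 : Octonion).fst = 1 := rfl
@[simp] theorem snd_one : (1 : Octonion).snd = 0 := rfl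
@[simp] theorem fst_add (x y : Octonion) : (x + y).fst = x.fst + y.fst := rfl
@[simp] theorem snd_add (x y : Octonion) : (x + y).snd = x.snd + y.snd := rfl
@[simp] theorem fst_neg (x : Octonion) : (-x).fst = -x.fst := rfl
@[simp] theorem snd_neg (x : Octonion) : (-x).snd = -x.snd := rfl
@[simp] theorem fst_smul (r : ℝ) (x : Octonion) : (r • x).fst = r • x.fst := rfl
@[simp] theorem snd_smul (r : ℝ) (x : Octonion) : (r • x).snd = r • x.snd := rfl
@[simp] theorem fst_mul (x y : Octonion) :
    (x * y).fst = x.fst * y.fst - star y.snd * x.snd := rfl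
@[simp] theorem snd_mul (x y : Octonion) :
    (x * y).snd = y.snd * x.fst + x.snd * star y.fst := rfl
@[simp] theorem fst_star (x : Octonion) : (star x).fst = star x.fst := rfl
@[simp] theorem snd_star (x : Octonion) : (star x).snd = -x.snd := rfl

instance : AddCommGroup Octonion where
  add_assoc x y z := by ext1 <;> simp [add_assoc]
  zero_add x := by ext1 <;> simp
  add_zero x := by ext1 <;> simp
  neg_add_cancel x := by ext1 <;> simp
  add_comm x y := by ext1 <;> simp [add_comm]
  nsmul := nsmulRec
  zsmul := zsmulRec

instance : NonAssocRing Octonion where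
  zero_mul x := by ext1 <;> simp
  mul_zero x := by ext1 <;> simp
  left_distrib x y z := by
    ext1 <;> simp only [fst_mul, snd_mul, fst_add, snd_add, star_add] <;> noncomm_ring
  right_distrib x y z := by
    ext1 <;> simp only [fst_mul, snd_mul, fst_add, snd_add] <;> noncomm_ring
  one_mul x := by ext1 <;> simp
  mul_one x := by ext1 <;> simp

instance : Module ℝ Octonion where
  one_smul x := by ext1 <;> simp
  mul_smul r s x := by ext1 <;> simp [mul_smul]
  smul_zero r := by ext1 <;> simp
  smul_add r x y := by ext1 <;> simp
  add_smul r s x := by ext1 <;> simp [add_smul]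
  zero_smul x := by ext1 <;> simp

/-- The real part of an octonion. -/
def re (x : Octonion) : ℝ := x.fst.re

/-- The standard inclusion `ℂ ⊂ 𝕆`, `z ↦ (z, 0)`. -/
def ofComplex (z : ℂ) : Octonion := ⟨Quaternion.coeComplex z, 0⟩

theorem ofComplex_one : ofComplex 1 = 1 := by
  ext1 <;> simp [ofComplex]

theorem ofComplex_add (z w : ℂ) : ofComplex (z + w) = ofComplex z + ofComplex w := by
  ext1 <;> simp [ofComplex]

theorem ofComplex_mul (z w : ℂ) : ofComplex (z * w) = ofComplex z * ofComplex w := by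
  ext1 <;> simp [ofComplex]

theorem ofComplex_star (z : ℂ) : ofComplex (star z) = star (ofComplex z) := by
  ext1
  · ext <;> simp [ofComplex]
  · simp [ofComplex]

end

end Octonion

/-! ### Projective planes -/

/-- The projective plane over `K` (here `K = ℂ` or `𝕆`): the set of Hermitian `3 × 3` matrices
`P` over `K` with `P² = P` and `tr P = 1`. -/
def projPlane (K : Type) [NonAssocSemiring K] [Star K] : Set (Matrix (Fin 3) (Fin 3) K) :=
  {P | P.IsHermitian ∧ P * P = P ∧ P.trace = 1}

/-- The complex projective plane; a line in `ℂ³` is represented by the orthogonal projection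
onto it. -/
abbrev CP2 : Type := projPlane ℂ

/-- The octonionic projective plane. -/
abbrev OP2 : Type := projPlane Octonion

/-- The standard embedding `ℂP² → 𝕆P²` induced by the inclusion `ℂ ⊂ 𝕆`. -/
noncomputable def CP2.toOP2 (P : CP2) : OP2 :=
  ⟨P.1.map Octonion.ofComplex, by
    obtain ⟨P, h1, h2, h3⟩ := P
    refine ⟨?_, ?_, ?_⟩
    · ext1 i j
      have := congrArg Octonion.ofComplex (congrFun (congrFun h1 i) j)
      rw [Matrix.conjTranspose_apply, Octonion.ofComplex_star] at this
      exact this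
    · ext1 i j
      have := congrArg Octonion.ofComplex (congrFun (congrFun h2 i) j)
      simpa [Matrix.mul_apply, Fin.sum_univ_three, Octonion.ofComplex_add,
        Octonion.ofComplex_mul] using this
    · have := congrArg Octonion.ofComplex h3
      simpa [Matrix.trace, Fin.sum_univ_three, Octonion.ofComplex_add,
        Octonion.ofComplex_one] using this⟩

/-- The standard `ℂP² ⊂ 𝕆P²`. -/
def standardCP2 : Set OP2 := Set.range CP2.toOP2

/-- The geodesic distance of the Fubini-Study metric on `𝕆P²`, normalised so that the diameter
is `π / 2`: `cos² d(P, Q) = Re tr (P Q)`. -/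
noncomputable def fubiniStudyDist (P Q : OP2) : ℝ :=
  Real.arccos (Real.sqrt (Octonion.re (P.1 * Q.1).trace))

/-- The isometry group of `𝕆P²` with the Fubini-Study metric. -/
def IsomOP2 : Subgroup (Equiv.Perm OP2) where
  carrier := {f | ∀ P Q, fubiniStudyDist (f P) (f Q) = fubiniStudyDist P Q}
  mul_mem' := by
    intro f g hf hg P Q
    simp only [Equiv.Perm.mul_apply]
    rw [hf, hg]
  one_mem' := fun _ _ => rfl
  inv_mem' := by
    intro f hf P Q
    have := hf (f⁻¹ P) (f⁻¹ Q)
    simpa using this.symm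

/-! ### The group of order 351 -/

/-- The group `G₃₅₁ = 𝔽₂₇ ⋊ (𝔽₂₇ˣ)²` of all affine transformations `x ↦ a x + b` of the field
`𝔽₂₇` such that `a` is a nonzero square. -/
def G351 : Subgroup (Equiv.Perm (GaloisField 3 3)) where
  carrier := {σ | ∃ a b : GaloisField 3 3, a ≠ 0 ∧ IsSquare a ∧ ∀ x, σ x = a * x + b}
  mul_mem' := by
    rintro σ τ ⟨a, b, ha, hs, h⟩ ⟨c, d, hc, ht, k⟩
    refine ⟨a * c, a * d + b, mul_ne_zero ha hc, hs.mul ht, fun x => ?_⟩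
    rw [Equiv.Perm.mul_apply, k, h]
    ring
  one_mem' := ⟨1, 0, one_ne_zero, IsSquare.one, fun x => by simp⟩
  inv_mem' := by
    rintro σ ⟨a, b, ha, hs, h⟩
    refine ⟨a⁻¹, -(a⁻¹ * b), inv_ne_zero ha, hs.inv, fun x => ?_⟩
    rw [Equiv.Perm.inv_eq_iff_eq, h]
    field_simp
    ring

/-!
Hermitian octonionic `3 × 3` matrices are treated in coordinates, as the 27-dimensional real space
`Albert`, and points of the projective plane as the elements of trace `1` with vanishing adjoint
`sharp`. The distance of two points determines their inner product `Re tr (P Q)`, and points span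
the space, so isometries are the same as linear automorphisms preserving points and inner products
(`exists_aut_of_isom`, `exists_isom_of_aut`). It is in this group `autGroup` that the argument takes
place. It acts transitively on points and on triples of orthogonal points (`exists_aut_frame`), and
every Hermitian matrix can be diagonalized by it (`exists_aut_diagonal`).

*Subgroups of order three.* The elements of order three in `G351` are the nontrivial translations.
They form, with the identity, an elementary abelian group of order `27`, all of whose nontrivial
elements are conjugate up to inversion. So for its image `A` in `autGroup` the dimensions of the
fixed spaces of subgroups depend on a single character value, and integrality forces the dimensions
`9`, `3`, `1` for subgroups of order `3`, `9`, `27` (`card_mul_finrank_eq`). Given `W ≤ A` of order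
three, a group of order nine between `W` and `A` thus fixes a non-scalar matrix. One of the
eigenvalues of this matrix is strictly extreme, and its eigenvector is a fixed point in the
projective plane (`exists_point_fixed`). The sum of the points in its orbit under `A` is fixed by
`A`, hence is the identity matrix, so the orbit consists of three orthogonal points, all fixed by
`W` and permuted cyclically by `A` (`exists_frame`). Once they are moved to the diagonal matrix
units, the fixed space of `W` consists of the matrices whose off-diagonal entries lie in three
spaces of octonions; these have dimension two and are closed under `(x, y) ↦ conj (x y)`. Such a
triple of spaces is moved to `ℂ` by sandwich multiplications (Moufang identities) and an
automorphism of the octonions (`exists_aut_complex_of_mul`). The fixed points of `W` are then the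
complex matrices in the projective plane.

*Existence.* Triples `(H, M, M*)` of complex `3 × 3` matrices with `H` Hermitian describe Hermitian
octonionic matrices, the adjoint map being that of the first Tits construction (`sharp_ofTriple`).
In the Weyl basis, of products of powers of a cyclic permutation matrix and a diagonal matrix of
cube roots of unity, such triples become functions `z` on the field with `27` elements satisfying
`conj (z v) = z (-v)`, and the adjoint map becomes a twisted convolution `quad` (`triple_quad`).
With suitable phases in the basis, the twist is invariant under multiplication by an element `θ` of
order `13` (`phase_mulTheta`). So nonzero squares act by substitution, and translations act by
multiplication with additive characters, which is compatible with any convolution. This embeds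
`G351` in `autGroup` (`autHom`). By the first part, a subgroup of order three fixes a complex
projective plane, which becomes the standard one after a conjugation.
-/

open Octonion

/-! ### Arithmetic of the octonions -/

namespace Octonion

theorem ext_components {x y : Octonion} (h0 : x.fst.re = y.fst.re) (h1 : x.fst.imI = y.fst.imI)
    (h2 : x.fst.imJ = y.fst.imJ) (h3 : x.fst.imK = y.fst.imK) (h4 : x.snd.re = y.snd.re)
    (h5 : x.snd.imI = y.snd.imI) (h6 : x.snd.imJ = y.snd.imJ) (h7 : x.snd.imK = y.snd.imK) :
    x = y := by
  ext1
  · exact QuaternionAlgebra.ext h0 h1 h2 h3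
  · exact QuaternionAlgebra.ext h4 h5 h6 h7

theorem fst_sub (x y : Octonion) : (x - y).fst = x.fst - y.fst := by
  rw [sub_eq_add_neg, sub_eq_add_neg]; rfl

theorem snd_sub (x y : Octonion) : (x - y).snd = x.snd - y.snd := by
  rw [sub_eq_add_neg, sub_eq_add_neg]; rfl

theorem fst_re_mul (x y : Octonion) : (x * y).fst.re =
    x.fst.re * y.fst.re - x.fst.imI * y.fst.imI - x.fst.imJ * y.fst.imJ - x.fst.imK * y.fst.imK
    - x.snd.re * y.snd.re - x.snd.imI * y.snd.imI - x.snd.imJ * y.snd.imJ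
    - x.snd.imK * y.snd.imK := by
  simp; ring

theorem fst_imI_mul (x y : Octonion) : (x * y).fst.imI =
    x.fst.re * y.fst.imI + x.fst.imI * y.fst.re + x.fst.imJ * y.fst.imK - x.fst.imK * y.fst.imJ
    - x.snd.imI * y.snd.re + x.snd.re * y.snd.imI + x.snd.imK * y.snd.imJ
    - x.snd.imJ * y.snd.imK := by
  simp; ring

theorem fst_imJ_mul (x y : Octonion) : (x * y).fst.imJ =
    x.fst.re * y.fst.imJ - x.fst.imI * y.fst.imK + x.fst.imJ * y.fst.re + x.fst.imK * y.fst.imI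
    - x.snd.imJ * y.snd.re + x.snd.re * y.snd.imJ + x.snd.imI * y.snd.imK
    - x.snd.imK * y.snd.imI := by
  simp; ring

theorem fst_imK_mul (x y : Octonion) : (x * y).fst.imK =
    x.fst.re * y.fst.imK + x.fst.imI * y.fst.imJ - x.fst.imJ * y.fst.imI + x.fst.imK * y.fst.re
    - x.snd.imK * y.snd.re + x.snd.re * y.snd.imK + x.snd.imJ * y.snd.imI
    - x.snd.imI * y.snd.imJ := by
  simp; ring

theorem snd_re_mul (x y : Octonion) : (x * y).snd.re =
    y.snd.re * x.fst.re - y.snd.imI * x.fst.imI - y.snd.imJ * x.fst.imJ - y.snd.imK * x.fst.imK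
    + x.snd.re * y.fst.re + x.snd.imI * y.fst.imI + x.snd.imJ * y.fst.imJ
    + x.snd.imK * y.fst.imK := by
  simp; ring

theorem snd_imI_mul (x y : Octonion) : (x * y).snd.imI =
    y.snd.re * x.fst.imI + y.snd.imI * x.fst.re + y.snd.imJ * x.fst.imK - y.snd.imK * x.fst.imJ
    + x.snd.imI * y.fst.re - x.snd.re * y.fst.imI - x.snd.imJ * y.fst.imK
    + x.snd.imK * y.fst.imJ := by
  simp; ring

theorem snd_imJ_mul (x y : Octonion) : (x * y).snd.imJ =
    y.snd.re * x.fst.imJ - y.snd.imI * x.fst.imK + y.snd.imJ * x.fst.re + y.snd.imK * x.fst.imI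
    + x.snd.imJ * y.fst.re - x.snd.re * y.fst.imJ - x.snd.imK * y.fst.imI
    + x.snd.imI * y.fst.imK := by
  simp; ring

theorem snd_imK_mul (x y : Octonion) : (x * y).snd.imK =
    y.snd.re * x.fst.imK + y.snd.imI * x.fst.imJ - y.snd.imJ * x.fst.imI + y.snd.imK * x.fst.re
    + x.snd.imK * y.fst.re - x.snd.re * y.fst.imK - x.snd.imI * y.fst.imJ
    + x.snd.imJ * y.fst.imI := by
  simp; ring

/-- The Euclidean inner product `Re (x ȳ)` on the octonions. -/
noncomputable def dot (x y : Octonion) : ℝ := re (x * star y)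

theorem dot_eq (x y : Octonion) : dot x y =
    x.fst.re * y.fst.re + x.fst.imI * y.fst.imI + x.fst.imJ * y.fst.imJ + x.fst.imK * y.fst.imK +
    x.snd.re * y.snd.re + x.snd.imI * y.snd.imI + x.snd.imJ * y.snd.imJ +
      x.snd.imK * y.snd.imK := by
  simp [dot, re]; ring

theorem moufang_middle (u x y : Octonion) : (u * x) * (y * u) = (u * (x * y)) * u := by
  apply ext_components <;>
  simp only [fst_re_mul, fst_imI_mul, fst_imJ_mul, fst_imK_mul, snd_re_mul, snd_imI_mul,
    snd_imJ_mul, snd_imK_mul] <;> ring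

theorem moufang_right (u x y : Octonion) : ((x * u) * y) * u = x * ((u * y) * u) := by
  apply ext_components <;>
  simp only [fst_re_mul, fst_imI_mul, fst_imJ_mul, fst_imK_mul, snd_re_mul, snd_imI_mul,
    snd_imJ_mul, snd_imK_mul] <;> ring

end Octonion

namespace Octonion

open scoped Quaternion

instance : StarRing Octonion where
  star := star
  star_involutive x := by ext1 <;> simp
  star_mul x y := by
    apply ext_components <;> simp
  star_add x y := by ext1 <;> simp [add_comm]

instance : IsScalarTower ℝ Octonion Octonion :=
  ⟨fun r x y => by ext1 <;> simp [smul_sub, smul_add]⟩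

instance : SMulCommClass ℝ Octonion Octonion :=
  ⟨fun r x y => by ext1 <;> simp [smul_sub, smul_add]⟩

instance : StarModule ℝ Octonion := ⟨fun r x => by ext1 <;> simp⟩

/-- The underlying real vector space of the octonions is `ℍ × ℍ`. -/
def linearEquivProd : Octonion ≃ₗ[ℝ] Quaternion ℝ × Quaternion ℝ where
  toFun x := (x.fst, x.snd)
  invFun p := ⟨p.1, p.2⟩
  map_add' _ _ := rfl
  map_smul' _ _ := rfl
  left_inv _ := rfl
  right_inv _ := rfl

instance : FiniteDimensional ℝ Octonion :=
  Module.Finite.equiv linearEquivProd.symm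

theorem finrank_eq : Module.finrank ℝ Octonion = 8 := by
  rw [linearEquivProd.finrank_eq, Module.finrank_prod, Quaternion.finrank_eq_four]

theorem flexible (x y : Octonion) : (x * y) * x = x * (y * x) := by
  have := moufang_middle x 1 y
  simpa using this.symm

theorem moufang_left (u x y : Octonion) : u * (y * (u * x)) = ((u * y) * u) * x := by
  have := congrArg star (moufang_right (star u) (star x) (star y))
  simp only [star_mul, star_star] at this
  rw [this, flexible]

theorem dot_comm (x y : Octonion) : dot x y = dot y x := by
  rw [dot_eq, dot_eq]; ring

theorem dot_add_left (x y z : Octonion) : dot (x + y) z = dot x z + dot y z := by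
  simp only [dot_eq, fst_add, snd_add, Quaternion.re_add, Quaternion.imI_add, Quaternion.imJ_add,
    Quaternion.imK_add]; ring

theorem dot_smul_left (r : ℝ) (x y : Octonion) : dot (r • x) y = r * dot x y := by
  simp only [dot_eq, fst_smul, snd_smul, Quaternion.re_smul, Quaternion.imI_smul,
    Quaternion.imJ_smul, Quaternion.imK_smul, smul_eq_mul]; ring

/-- The inner product of the octonions as a bilinear form. -/
noncomputable def dotForm : LinearMap.BilinForm ℝ Octonion :=
  LinearMap.mk₂ ℝ dot dot_add_left dot_smul_left
    (fun x y z => by rw [dot_comm, dot_add_left, dot_comm y, dot_comm z])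
    (fun r x y => by rw [dot_comm, dot_smul_left, dot_comm y, smul_eq_mul])

theorem dotForm_apply (x y : Octonion) : dotForm x y = dot x y := rfl

theorem dot_add_right (x y z : Octonion) : dot x (y + z) = dot x y + dot x z :=
  (dotForm x).map_add y z
theorem dot_smul_right (r : ℝ) (x y : Octonion) : dot x (r • y) = r * dot x y :=
  (dotForm x).map_smul r y
@[simp] theorem dot_zero_left (x : Octonion) : dot 0 x = 0 := by simp [← dotForm_apply]
@[simp] theorem dot_zero_right (x : Octonion) : dot x 0 = 0 := by simp [← dotForm_apply]
theorem dot_sub_left (x y z : Octonion) : dot (x - y) z = dot x z - dot y z := by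
  simp [← dotForm_apply]
theorem dot_sub_right (x y z : Octonion) : dot x (y - z) = dot x y - dot x z := by
  simp [← dotForm_apply]

theorem dot_self_nonneg (x : Octonion) : 0 ≤ dot x x := by
  rw [dot_eq]
  nlinarith [sq_nonneg x.fst.re, sq_nonneg x.fst.imI, sq_nonneg x.fst.imJ, sq_nonneg x.fst.imK,
    sq_nonneg x.snd.re, sq_nonneg x.snd.imI, sq_nonneg x.snd.imJ, sq_nonneg x.snd.imK]

theorem dot_self_eq_zero {x : Octonion} : dot x x = 0 ↔ x = 0 := by
  refine ⟨fun h => ?_, fun h => by simp [h]⟩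
  rw [dot_eq] at h
  apply ext_components <;>
  simp only [fst_zero, snd_zero, Quaternion.re_zero, Quaternion.imI_zero, Quaternion.imJ_zero,
    Quaternion.imK_zero] <;> nlinarith

theorem dot_star_star (x y : Octonion) : dot (star x) (star y) = dot x y := by
  rw [dot_eq, dot_eq]; simp

theorem star_mul_mul_cancel (x y : Octonion) : star x * (x * y) = dot x x • y := by
  apply ext_components <;> simp [dot_eq] <;> ring

theorem mul_star_mul_cancel (x y : Octonion) : x * (star x * y) = dot x x • y := by
  have := star_mul_mul_cancel (star x) y
  rwa [star_star, dot_star_star] at this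

theorem mul_mul_star_cancel (x y : Octonion) : (y * x) * star x = dot x x • y := by
  have := congrArg star (mul_star_mul_cancel x (star y))
  simpa using this

theorem mul_star_mul_cancel_right (x y : Octonion) : (y * star x) * x = dot x x • y := by
  have := congrArg star (star_mul_mul_cancel x (star y))
  simpa using this

theorem mul_star_self (x : Octonion) : x * star x = dot x x • (1 : Octonion) := by
  simpa using mul_star_mul_cancel x 1

theorem star_mul_self_eq (x : Octonion) : star x * x = dot x x • (1 : Octonion) := by
  simpa using star_mul_mul_cancel x 1

/-- The norm of the octonions is multiplicative, in polarized form. -/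
theorem dot_mul_mul_left (u x y : Octonion) : dot (u * x) (u * y) = dot u u * dot x y := by
  simp only [dot_eq, fst_re_mul, fst_imI_mul, fst_imJ_mul, fst_imK_mul, snd_re_mul, snd_imI_mul,
    snd_imJ_mul, snd_imK_mul]; ring

theorem dot_mul_mul_right (u x y : Octonion) : dot (x * u) (y * u) = dot u u * dot x y := by
  rw [← dot_star_star, star_mul, star_mul, dot_mul_mul_left, dot_star_star, dot_star_star]

theorem dot_mul_self (x y : Octonion) : dot (x * y) (x * y) = dot x x * dot y y :=
  dot_mul_mul_left x y y

@[simp] theorem re_one : re 1 = 1 := rfl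

@[simp] theorem re_zero : re 0 = 0 := rfl

theorem dot_one_right (x : Octonion) : dot x 1 = re x := by simp [dot]

theorem dot_one_one : dot 1 1 = 1 := by rw [dot_one_right, re_one]

theorem re_mul_eq (x y : Octonion) : re (x * y) = dot x (star y) := by
  simp [dot]

theorem exists_unit_smul (x : Octonion) : ∃ (r : ℝ) (u : Octonion), dot u u = 1 ∧ x = r • u := by
  by_cases h : x = 0
  · exact ⟨0, 1, dot_one_one, by simp [h]⟩
  have hpos : 0 < dot x x :=
    (dot_self_nonneg _).lt_of_ne fun h' => h (dot_self_eq_zero.1 h'.symm)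
  have hn : Real.sqrt (dot x x) * Real.sqrt (dot x x) = dot x x := Real.mul_self_sqrt hpos.le
  have hn0 : Real.sqrt (dot x x) ≠ 0 := (Real.sqrt_pos.2 hpos).ne'
  refine ⟨Real.sqrt (dot x x), (Real.sqrt (dot x x))⁻¹ • x, ?_, ?_⟩
  · rw [dot_smul_left, dot_smul_right]; nth_rewrite 3 [← hn]; field_simp
  · rw [smul_smul, mul_inv_cancel₀ hn0, one_smul]

theorem re_smul (r : ℝ) (x : Octonion) : re (r • x) = r * re x := by simp [re]
theorem re_add (x y : Octonion) : re (x + y) = re x + re y := by simp [re]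
theorem re_sub (x y : Octonion) : re (x - y) = re x - re y := by simp [re, fst_sub]
theorem re_star (x : Octonion) : re (star x) = re x := by simp [re]

theorem star_eq_sub (x : Octonion) : star x = (2 * re x) • (1 : Octonion) - x := by
  apply ext_components <;> simp [re, fst_sub, snd_sub]
  ring

theorem star_eq_self_iff {x : Octonion} : star x = x ↔ x = re x • (1 : Octonion) := by
  refine ⟨fun h => ?_, fun h => by rw [h]; simp⟩
  have h2 := star_eq_sub x
  rw [h] at h2
  have h3 : (2 : ℝ) • x = (2 : ℝ) • (re x • (1 : Octonion)) := by
    rw [two_smul, smul_smul]; nth_rewrite 1 [h2]; abel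
  exact smul_right_injective _ two_ne_zero h3

theorem smul_one_injective : Function.Injective fun r : ℝ => r • (1 : Octonion) := fun r s h => by
  simpa [re_smul, re_one] using congrArg re h

end Octonion

/-! ### The space of Hermitian matrices and its automorphisms -/

/-- The space of Hermitian `3 × 3` matrices over the octonions in coordinates: `(ξ, x)` stands for
the matrix with diagonal entries `ξ i` and with the entry `x i` in position `(i + 1, i + 2)`,
indices being taken modulo `3`. -/
abbrev Albert : Type := (Fin 3 → ℝ) × (Fin 3 → Octonion)

namespace Albert

theorem ext3 {X Y : Albert} (h0 : X.1 0 = Y.1 0) (h1 : X.1 1 = Y.1 1) (h2 : X.1 2 = Y.1 2)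
    (k0 : X.2 0 = Y.2 0) (k1 : X.2 1 = Y.2 1) (k2 : X.2 2 = Y.2 2) : X = Y := by
  refine Prod.ext ?_ ?_
  · funext i; fin_cases i <;> assumption
  · funext i; fin_cases i <;> assumption

/-- The trace. -/
def tr (X : Albert) : ℝ := X.1 0 + X.1 1 + X.1 2

/-- Freudenthal's quadratic adjoint map, the analogue of the adjugate matrix. -/
noncomputable def sharp (X : Albert) : Albert :=
  (fun i => X.1 (i + 1) * X.1 (i + 2) - dot (X.2 i) (X.2 i),
   fun i => star (X.2 (i + 1) * X.2 (i + 2)) - X.1 i • X.2 i)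

theorem sharp_fst_zero (X : Albert) : (sharp X).1 0 = X.1 1 * X.1 2 - dot (X.2 0) (X.2 0) := rfl
theorem sharp_fst_one (X : Albert) : (sharp X).1 1 = X.1 2 * X.1 0 - dot (X.2 1) (X.2 1) := rfl
theorem sharp_fst_two (X : Albert) : (sharp X).1 2 = X.1 0 * X.1 1 - dot (X.2 2) (X.2 2) := rfl
theorem sharp_snd_zero (X : Albert) :
    (sharp X).2 0 = star (X.2 1 * X.2 2) - X.1 0 • X.2 0 := rfl
theorem sharp_snd_one (X : Albert) :
    (sharp X).2 1 = star (X.2 2 * X.2 0) - X.1 1 • X.2 1 := rfl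
theorem sharp_snd_two (X : Albert) :
    (sharp X).2 2 = star (X.2 0 * X.2 1) - X.1 2 • X.2 2 := rfl

/-- The inner product `Re tr (X Y)` of Hermitian matrices. -/
noncomputable def ip (X Y : Albert) : ℝ :=
  X.1 0 * Y.1 0 + X.1 1 * Y.1 1 + X.1 2 * Y.1 2 +
    2 * (dot (X.2 0) (Y.2 0) + dot (X.2 1) (Y.2 1) + dot (X.2 2) (Y.2 2))

theorem ip_comm (X Y : Albert) : ip X Y = ip Y X := by
  simp only [ip, dot_comm (X.2 _)]; ring

theorem ip_add_left (X Y Z : Albert) : ip (X + Y) Z = ip X Z + ip Y Z := by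
  simp only [ip, Prod.fst_add, Prod.snd_add, Pi.add_apply, dot_add_left]; ring

theorem ip_smul_left (r : ℝ) (X Y : Albert) : ip (r • X) Y = r * ip X Y := by
  simp only [ip, Prod.smul_fst, Prod.smul_snd, Pi.smul_apply, dot_smul_left, smul_eq_mul]; ring

/-- The inner product as a bilinear form. -/
noncomputable def ipForm : LinearMap.BilinForm ℝ Albert :=
  LinearMap.mk₂ ℝ ip ip_add_left ip_smul_left
    (fun x y z => by rw [ip_comm, ip_add_left, ip_comm y, ip_comm z])
    (fun r x y => by rw [ip_comm, ip_smul_left, ip_comm y, smul_eq_mul])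

theorem ipForm_apply (X Y : Albert) : ipForm X Y = ip X Y := rfl

theorem ip_add_right (X Y Z : Albert) : ip X (Y + Z) = ip X Y + ip X Z := (ipForm X).map_add Y Z
theorem ip_sub_left (X Y Z : Albert) : ip (X - Y) Z = ip X Z - ip Y Z := by
  simp [← ipForm_apply]
theorem ip_smul_right (r : ℝ) (X Y : Albert) : ip X (r • Y) = r * ip X Y := (ipForm X).map_smul r Y

theorem ip_self_eq_zero {X : Albert} : ip X X = 0 ↔ X = 0 := by
  refine ⟨fun h => ?_, fun h => by simp [h, ip]⟩
  have h0 := dot_self_nonneg (X.2 0)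
  have h1 := dot_self_nonneg (X.2 1)
  have h2 := dot_self_nonneg (X.2 2)
  have k0 := mul_self_nonneg (X.1 0)
  have k1 := mul_self_nonneg (X.1 1)
  have k2 := mul_self_nonneg (X.1 2)
  rw [ip] at h
  refine ext3 ?_ ?_ ?_ ?_ ?_ ?_
  · exact mul_self_eq_zero.1 (by linarith)
  · exact mul_self_eq_zero.1 (by linarith)
  · exact mul_self_eq_zero.1 (by linarith)
  · exact dot_self_eq_zero.1 (by linarith)
  · exact dot_self_eq_zero.1 (by linarith)
  · exact dot_self_eq_zero.1 (by linarith)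

theorem ip_self_eq_tr (X : Albert) : ip X X = tr X ^ 2 - 2 * tr (sharp X) := by
  simp only [ip, tr, sharp_fst_zero, sharp_fst_one, sharp_fst_two]; ring

/-- The points of the octonionic projective plane, in coordinates. -/
def points : Set Albert := {X | tr X = 1 ∧ sharp X = 0}

/-- The linear automorphisms of the space of Hermitian matrices that preserve the projective plane
and the inner product; this is the compact Lie group of type `F₄`. -/
noncomputable def autGroup : Subgroup (Albert ≃ₗ[ℝ] Albert) where
  carrier := {T | (∀ X, T X ∈ points ↔ X ∈ points) ∧ ∀ X Y, ip (T X) (T Y) = ip X Y}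
  mul_mem' := by
    rintro S T ⟨hS, hS'⟩ ⟨hT, hT'⟩
    exact ⟨fun X => (hS _).trans (hT X), fun X Y => (hS' _ _).trans (hT' X Y)⟩
  one_mem' := ⟨fun _ => Iff.rfl, fun _ _ => rfl⟩
  inv_mem' := by
    rintro T ⟨hT, hT'⟩
    refine ⟨fun X => ?_, fun X Y => ?_⟩
    · rw [← hT]; exact iff_of_eq (congrArg (· ∈ points) (T.apply_symm_apply X))
    · rw [← hT']
      exact congrArg₂ ip (T.apply_symm_apply X) (T.apply_symm_apply Y)

theorem mem_points_iff (k : autGroup) {X : Albert} : k.1 X ∈ points ↔ X ∈ points := k.2.1 X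

theorem ip_map (k : autGroup) (X Y : Albert) : ip (k.1 X) (k.1 Y) = ip X Y := k.2.2 X Y

@[simp] theorem coe_mul_apply (k l : autGroup) (X : Albert) : (k * l).1 X = k.1 (l.1 X) := rfl
@[simp] theorem coe_inv_apply_self (k : autGroup) (X : Albert) : (k⁻¹).1 (k.1 X) = X :=
  k.1.symm_apply_apply X
@[simp] theorem coe_apply_inv_self (k : autGroup) (X : Albert) : k.1 ((k⁻¹).1 X) = X :=
  k.1.apply_symm_apply X

/-- A linear map commuting with the trace and the adjoint map preserves the inner product, hence
is bijective, and it preserves the projective plane. -/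
theorem exists_aut (T : Albert →ₗ[ℝ] Albert) (htr : ∀ X, tr (T X) = tr X)
    (hsharp : ∀ X, sharp (T X) = T (sharp X)) : ∃ k : autGroup, ∀ X, k.1 X = T X := by
  have hself : ∀ X, ip (T X) (T X) = ip X X := fun X => by
    rw [ip_self_eq_tr, ip_self_eq_tr, hsharp, htr, htr]
  have hip : ∀ X Y, ip (T X) (T Y) = ip X Y := fun X Y => by
    have h := hself (X + Y)
    rw [map_add, ip_add_left, ip_add_right, ip_add_right, ip_add_left, ip_add_right,
      ip_add_right, hself, hself] at h
    linarith [ip_comm (T X) (T Y), ip_comm X Y]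
  have hinj : Function.Injective T := by
    refine (injective_iff_map_eq_zero T).2 fun X hX => ?_
    rw [← ip_self_eq_zero, ← hself, hX, ip_self_eq_zero]
  refine ⟨⟨LinearEquiv.ofInjectiveEndo T hinj, fun X => ?_, fun X Y => hip X Y⟩, fun X => rfl⟩
  change (tr (T X) = 1 ∧ sharp (T X) = 0) ↔ _
  rw [htr, hsharp, map_eq_zero_iff T hinj]
  rfl

/-- The cyclic permutation of the three coordinates. -/
theorem exists_aut_shift :
    ∃ k : autGroup, ∀ X i, (k.1 X).1 i = X.1 (i + 1) ∧ (k.1 X).2 i = X.2 (i + 1) := by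
  obtain ⟨k, hk⟩ := exists_aut
    { toFun := fun X => (fun i => X.1 (i + 1), fun i => X.2 (i + 1))
      map_add' := fun _ _ => rfl
      map_smul' := fun _ _ => rfl } (fun X => by
        change X.1 1 + X.1 2 + X.1 0 = X.1 0 + X.1 1 + X.1 2; ring)
    (fun X => ext3 rfl rfl rfl rfl rfl rfl)
  exact ⟨k, fun X i => by rw [hk]; exact ⟨rfl, rfl⟩⟩

/-- For a unit octonion `u`, the Moufang identities make `(x₀, x₁, x₂) ↦ (u x₀, x₁ u, ū x₂ ū)`
an automorphism. -/
theorem exists_aut_unit (u : Octonion) (hu : dot u u = 1) :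
    ∃ k : autGroup, ∀ X, (k.1 X).1 = X.1 ∧ (k.1 X).2 0 = u * X.2 0 ∧ (k.1 X).2 1 = X.2 1 * u ∧
      (k.1 X).2 2 = (star u * X.2 2) * star u := by
  obtain ⟨k, hk⟩ := exists_aut
    { toFun := fun X => (X.1, ![u * X.2 0, X.2 1 * u, (star u * X.2 2) * star u])
      map_add' := fun X Y => by
        refine ext3 rfl rfl rfl ?_ ?_ ?_
        · exact mul_add u _ _
        · exact add_mul _ _ u
        · change star u * (X.2 2 + Y.2 2) * star u = _
          rw [mul_add, add_mul]; rfl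
      map_smul' := fun r X => by
        refine ext3 rfl rfl rfl ?_ ?_ ?_
        · exact mul_smul_comm r u _
        · exact smul_mul_assoc r _ u
        · change star u * (r • X.2 2) * star u = _
          rw [mul_smul_comm, smul_mul_assoc]; rfl } (fun X => rfl) (fun X => by
    have hus : dot (star u) (star u) = 1 := by rw [dot_star_star, hu]
    have e1 : ∀ y, u * ((star u * y) * star u) * u = y := fun y => by
      rw [flexible, mul_star_mul_cancel_right, hu, one_smul, mul_star_mul_cancel, hu, one_smul]
    refine ext3 ?_ ?_ ?_ ?_ ?_ ?_
    · change _ - dot (u * X.2 0) (u * X.2 0) = _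
      rw [dot_mul_mul_left, hu, one_mul]; rfl
    · change _ - dot (X.2 1 * u) (X.2 1 * u) = _
      rw [dot_mul_mul_right, hu, one_mul]; rfl
    · change _ - dot (star u * X.2 2 * star u) (star u * X.2 2 * star u) = _
      rw [dot_mul_mul_right, dot_mul_mul_left, hus, one_mul, one_mul]; rfl
    · change star ((X.2 1 * u) * ((star u * X.2 2) * star u)) - X.1 0 • (u * X.2 0) =
        u * (star (X.2 1 * X.2 2) - X.1 0 • X.2 0)
      have h := moufang_right u (X.2 1) ((star u * X.2 2) * star u)
      rw [e1] at h
      have h2 := congrArg (· * star u) h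
      simp only [mul_mul_star_cancel, hu, one_smul] at h2
      rw [h2, star_mul _ (star u), star_star, mul_sub, mul_smul_comm]
    · change star (((star u * X.2 2) * star u) * (u * X.2 0)) - X.1 1 • (X.2 1 * u) =
        (star (X.2 2 * X.2 0) - X.1 1 • X.2 1) * u
      have h := moufang_left u (X.2 0) ((star u * X.2 2) * star u)
      rw [e1] at h
      have h2 := congrArg (star u * ·) h
      simp only [star_mul_mul_cancel, hu, one_smul] at h2
      rw [h2, star_mul (star u), star_star, sub_mul, smul_mul_assoc]
    · change star ((u * X.2 0) * (X.2 1 * u)) - X.1 2 • ((star u * X.2 2) * star u) =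
        (star u * (star (X.2 0 * X.2 1) - X.1 2 • X.2 2)) * star u
      rw [moufang_middle, star_mul, star_mul u, mul_sub, sub_mul, mul_smul_comm, smul_mul_assoc,
        ← flexible])
  exact ⟨k, fun X => by rw [hk]; exact ⟨rfl, rfl, rfl, rfl⟩⟩

/-- Conjugation by a rotation in the plane of the last two basis vectors. -/
theorem exists_aut_rotation (c s : ℝ) (h : c ^ 2 + s ^ 2 = 1) :
    ∃ k : autGroup, ∀ X, (k.1 X).1 0 = X.1 0 ∧
      (k.1 X).1 1 = X.1 1 - s * (s * (X.1 1 - X.1 2) + 2 * c * re (X.2 0)) ∧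
      (k.1 X).1 2 = X.1 2 + s * (s * (X.1 1 - X.1 2) + 2 * c * re (X.2 0)) ∧
      (k.1 X).2 0 = X.2 0 + (s * (c * (X.1 1 - X.1 2) - 2 * s * re (X.2 0))) • (1 : Octonion) ∧
      (k.1 X).2 1 = s • star (X.2 2) + c • X.2 1 ∧
      (k.1 X).2 2 = c • X.2 2 - s • star (X.2 1) := by
  obtain ⟨k, hk⟩ := exists_aut
    { toFun := fun X => (![X.1 0, X.1 1 - s * (s * (X.1 1 - X.1 2) + 2 * c * re (X.2 0)),
        X.1 2 + s * (s * (X.1 1 - X.1 2) + 2 * c * re (X.2 0))],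
        ![X.2 0 + (s * (c * (X.1 1 - X.1 2) - 2 * s * re (X.2 0))) • (1 : Octonion),
          s • star (X.2 2) + c • X.2 1, c • X.2 2 - s • star (X.2 1)])
      map_add' := fun X Y => by
        refine ext3 ?_ ?_ ?_ ?_ ?_ ?_ <;> simp [re_add] <;> first | module | ring
      map_smul' := fun r X => by
        refine ext3 ?_ ?_ ?_ ?_ ?_ ?_ <;> simp [re_smul] <;> first | module | ring }
    (fun X => by simp [tr]; ring) (fun X => by
    have h1 : ∀ x : Octonion, dot 1 x = re x := fun x => by rw [dot_comm, dot_one_right]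
    have hre : re (star (X.2 2) * star (X.2 1)) = dot (X.2 1) (star (X.2 2)) := by
      rw [re_mul_eq, star_star, dot_comm]
    have ha : star (X.2 0) = (2 * re (X.2 0)) • (1 : Octonion) - X.2 0 := star_eq_sub _
    have hb : X.2 1 * X.2 2 =
        (2 * dot (X.2 1) (star (X.2 2))) • (1 : Octonion) - star (X.2 2) * star (X.2 1) := by
      rw [← star_mul, ← re_mul_eq, ← re_star, ← star_eq_sub, star_star]
    have hd : dot (star (X.2 1)) (X.2 2) = dot (X.2 1) (star (X.2 2)) := by
      rw [← dot_star_star, star_star]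
    have hd' : dot (X.2 2) (star (X.2 1)) = dot (X.2 1) (star (X.2 2)) := by
      rw [dot_comm, hd]
    -- in each entry the two sides differ by a multiple of `c ^ 2 + s ^ 2 - 1`
    refine ext3 ?_ ?_ ?_ ?_ ?_ ?_
    · simp [sharp, dot_add_left, dot_add_right, dot_smul_left, dot_smul_right, dot_one_right, h1,
        re_add, re_smul]
      linear_combination (-s ^ 2 * ((X.1 1 - X.1 2) ^ 2 + 4 * re (X.2 0) ^ 2)) * h
    · simp [sharp, dot_add_left, dot_add_right, dot_smul_left, dot_smul_right, dot_star_star, hre,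
        dot_comm _ (X.2 1), re_sub, re_smul]
      linear_combination (-dot (X.2 1) (X.2 1)) * h
    · simp [sharp, dot_sub_left, dot_sub_right, dot_smul_left, dot_smul_right, dot_star_star, hre,
        hd, hd', re_sub, re_smul]
      linear_combination (-dot (X.2 2) (X.2 2)) * h
    · simp [sharp, hre, re_sub, re_smul, mul_add, sub_mul, smul_mul_assoc, mul_smul_comm, hb,
        star_mul_self_eq, mul_star_self]
      refine eq_of_sub_eq_zero ((?_ : _ = (c ^ 2 + s ^ 2 - 1) • (star (X.2 2) * star (X.2 1))).trans
        (by rw [h, sub_self, zero_smul]))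
      module
    · simp [sharp, ha, smul_mul_assoc, mul_smul_comm, mul_add, mul_sub, sub_mul, add_mul]
      refine eq_of_sub_eq_zero ((?_ : _ = (c ^ 2 + s ^ 2 - 1) •
        ((s * (X.1 1 - X.1 2)) • star (X.2 2) + (2 * s * re (X.2 0)) • X.2 1)).trans
        (by rw [h, sub_self, zero_smul]))
      module
    · simp [sharp, ha, smul_mul_assoc, mul_smul_comm, mul_add, add_mul, mul_sub, sub_mul]
      refine eq_of_sub_eq_zero ((?_ : _ = (c ^ 2 + s ^ 2 - 1) •
        ((s * (X.1 1 - X.1 2)) • star (X.2 1) - (2 * s * re (X.2 0)) • X.2 2)).trans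
        (by rw [h, sub_self, zero_smul]))
      module)
  exact ⟨k, fun X => by rw [hk]; exact ⟨rfl, rfl, rfl, rfl, rfl, rfl⟩⟩

end Albert

/-! ### Points of the projective plane -/

namespace Albert

/-- The diagonal matrix units. -/
noncomputable def E (i : Fin 3) : Albert := (Pi.single i 1, 0)

theorem E_mem_points (i : Fin 3) : E i ∈ points := by
  refine ⟨?_, ext3 ?_ ?_ ?_ ?_ ?_ ?_⟩ <;> fin_cases i <;> simp [E, tr, sharp, Pi.single_apply]

theorem ip_E_left (i : Fin 3) (X : Albert) : ip (E i) X = X.1 i := by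
  fin_cases i <;> simp [E, ip]

theorem ip_E_right (i : Fin 3) (X : Albert) : ip X (E i) = X.1 i := by
  rw [ip_comm, ip_E_left]

theorem ip_self_of_mem {P : Albert} (hP : P ∈ points) : ip P P = 1 := by
  rw [ip_self_eq_tr, hP.1, hP.2]; simp [tr]

theorem sum_fst {P : Albert} (hP : P ∈ points) : P.1 0 + P.1 1 + P.1 2 = 1 := hP.1

theorem dot_snd {P : Albert} (hP : P ∈ points) (i : Fin 3) :
    dot (P.2 i) (P.2 i) = P.1 (i + 1) * P.1 (i + 2) := by
  have := congrFun (congrArg Prod.fst hP.2) i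
  simp [sharp] at this
  linarith

theorem smul_snd {P : Albert} (hP : P ∈ points) (i : Fin 3) :
    P.1 i • P.2 i = star (P.2 (i + 1) * P.2 (i + 2)) := by
  have := congrFun (congrArg Prod.snd hP.2) i
  exact (sub_eq_zero.1 this).symm

theorem fst_nonneg {P : Albert} (hP : P ∈ points) (i : Fin 3) : 0 ≤ P.1 i := by
  have h := sum_fst hP
  have h0 := dot_snd hP (i + 1)
  have h1 := dot_snd hP (i + 2)
  have k0 := dot_self_nonneg (P.2 (i + 1))
  have k1 := dot_self_nonneg (P.2 (i + 2))
  have key : P.1 i = P.1 i * P.1 i + dot (P.2 (i + 1)) (P.2 (i + 1)) +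
      dot (P.2 (i + 2)) (P.2 (i + 2)) := by
    rw [h0, h1]
    fin_cases i <;> simp <;> linear_combination (-1 * P.1 _) * h
  nlinarith [mul_self_nonneg (P.1 i)]

theorem fst_le_one {P : Albert} (hP : P ∈ points) (i : Fin 3) : P.1 i ≤ 1 := by
  have h := sum_fst hP
  have h0 := fst_nonneg hP 0
  have h1 := fst_nonneg hP 1
  have h2 := fst_nonneg hP 2
  fin_cases i <;> simp <;> linarith

theorem snd_eq_zero {P : Albert} (hP : P ∈ points) (i : Fin 3)
    (h : P.1 (i + 1) = 0 ∨ P.1 (i + 2) = 0) : P.2 i = 0 := by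
  rw [← dot_self_eq_zero, dot_snd hP, mul_eq_zero]; exact h

theorem eq_E_of_fst_eq_one {P : Albert} (hP : P ∈ points) {i : Fin 3} (h : P.1 i = 1) :
    P = E i := by
  have hs := sum_fst hP
  have n0 := fst_nonneg hP 0
  have n1 := fst_nonneg hP 1
  have n2 := fst_nonneg hP 2
  have s0 := snd_eq_zero hP 0
  have s1 := snd_eq_zero hP 1
  have s2 := snd_eq_zero hP 2
  fin_cases i <;> simp at h s0 s1 s2
  · have a : P.1 1 = 0 := by linarith
    have b : P.1 2 = 0 := by linarith
    refine ext3 ?_ ?_ ?_ ?_ ?_ ?_ <;> simp [E, *]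
  · have a : P.1 0 = 0 := by linarith
    have b : P.1 2 = 0 := by linarith
    refine ext3 ?_ ?_ ?_ ?_ ?_ ?_ <;> simp [E, *]
  · have a : P.1 0 = 0 := by linarith
    have b : P.1 1 = 0 := by linarith
    refine ext3 ?_ ?_ ?_ ?_ ?_ ?_ <;> simp [E, *]

theorem exists_eq_E_of_snd_eq_zero {P : Albert} (hP : P ∈ points) (h : P.2 = 0) :
    ∃ i, P = E i := by
  have hs := sum_fst hP
  have d0 := dot_snd hP 0
  have d1 := dot_snd hP 1
  have d2 := dot_snd hP 2
  simp [h] at d0 d1 d2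
  by_cases h0 : P.1 0 = 0
  · by_cases h1 : P.1 1 = 0
    · exact ⟨2, eq_E_of_fst_eq_one hP (by linarith)⟩
    · exact ⟨1, eq_E_of_fst_eq_one hP (by have := d0.resolve_left h1; linarith)⟩
  · exact ⟨0, eq_E_of_fst_eq_one hP
      (by have := d1.resolve_right h0; have := d2.resolve_left h0; linarith)⟩

/-- The points other than `E 1` of the projective line through `E 0` and `E 1`, for unit octonions
`u`. -/
noncomputable def linePoint (s : ℝ) (u : Octonion) : Albert :=
  (1 + s ^ 2)⁻¹ • (![1, s ^ 2, 0], ![0, 0, s • u])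

theorem linePoint_mem (s : ℝ) (u : Octonion) (hu : dot u u = 1) : linePoint s u ∈ points := by
  have h : (1 + s ^ 2) ≠ 0 := by positivity
  refine ⟨?_, ext3 ?_ ?_ ?_ ?_ ?_ ?_⟩
  · simp [linePoint, tr]; field_simp
  all_goals simp [linePoint, sharp, dot_smul_left, dot_smul_right, hu]
  field_simp
  ring

theorem map_E_zero_of_fst {k : autGroup} (h : ∀ X, (k.1 X).1 0 = X.1 0) : k.1 (E 0) = E 0 :=
  eq_E_of_fst_eq_one ((mem_points_iff k).2 (E_mem_points 0)) (by rw [h]; simp [E])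

/-- The real numbers `c`, `s` below are the cosine and sine of the angle of rotation that
diagonalizes a real symmetric `2 × 2` matrix. -/
theorem exists_rotation_angle (r d : ℝ) :
    ∃ c s : ℝ, c ^ 2 + s ^ 2 = 1 ∧ r + s * (c * d - 2 * s * r) = 0 := by
  set w : ℂ := ⟨d / 2, -r⟩
  refine ⟨Real.cos (w.arg / 2), Real.sin (w.arg / 2), Real.cos_sq_add_sin_sq _, ?_⟩
  have h1 : ‖w‖ * Real.cos w.arg = d / 2 := Complex.norm_mul_cos_arg w
  have h2 : ‖w‖ * Real.sin w.arg = -r := Complex.norm_mul_sin_arg w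
  have h3 : w.arg = 2 * (w.arg / 2) := by ring
  rw [h3, Real.cos_two_mul'] at h1
  rw [h3, Real.sin_two_mul] at h2
  have h4 := Real.cos_sq_add_sin_sq (w.arg / 2)
  set c := Real.cos (w.arg / 2)
  set s := Real.sin (w.arg / 2)
  linear_combination (-r) * h4 - 2 * s * c * h1 + (c ^ 2 - s ^ 2) * h2

/-- Multiplication by a unit octonion makes the entry in position `(1, 2)` real. -/
theorem exists_aut_real (X : Albert) : ∃ k : autGroup, (∀ Y, (k.1 Y).1 = Y.1) ∧
    (∃ r : ℝ, (k.1 X).2 0 = r • (1 : Octonion)) ∧ (X.2 1 = 0 → (k.1 X).2 1 = 0) ∧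
      (X.2 2 = 0 → (k.1 X).2 2 = 0) := by
  obtain ⟨r, u, hu, hru⟩ := exists_unit_smul (X.2 0)
  obtain ⟨k, hk⟩ := exists_aut_unit (star u) (by rw [dot_star_star, hu])
  refine ⟨k, fun Y => (hk Y).1, ⟨r, ?_⟩, fun h => ?_, fun h => ?_⟩
  · rw [(hk X).2.1, hru, mul_smul_comm, star_mul_self_eq, hu, one_smul]
  · rw [(hk X).2.2.1, h, zero_mul]
  · rw [(hk X).2.2.2, h, mul_zero, zero_mul]

/-- Any element can be moved, by an automorphism fixing `E 0`, to one whose entry in position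
`(1, 2)` vanishes. -/
theorem exists_aut_snd_zero (X : Albert) : ∃ k : autGroup, (∀ Y, (k.1 Y).1 0 = Y.1 0) ∧
    (k.1 X).2 0 = 0 ∧ (X.2 1 = 0 → X.2 2 = 0 → (k.1 X).2 = 0) := by
  obtain ⟨k, hk, ⟨r, hr⟩, h1, h2⟩ := exists_aut_real X
  obtain ⟨c, s, hcs, hrot⟩ := exists_rotation_angle r ((k.1 X).1 1 - (k.1 X).1 2)
  obtain ⟨l, hl⟩ := exists_aut_rotation c s hcs
  have h0 : (l.1 (k.1 X)).2 0 = 0 := by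
    rw [(hl _).2.2.2.1, hr, ← add_smul, re_smul, re_one, mul_one, hrot, zero_smul]
  refine ⟨l * k, fun Y => ?_, h0, fun e1 e2 => ?_⟩
  · rw [coe_mul_apply, (hl _).1, hk]
  · rw [coe_mul_apply]
    funext i
    fin_cases i
    · exact h0
    · simp [(hl (k.1 X)).2.2.2.2.1, h1 e1, h2 e2]
    · simp [(hl (k.1 X)).2.2.2.2.2, h1 e1, h2 e2]

/-- The automorphism group acts transitively on the projective plane. -/
theorem exists_aut_eq_E_zero {P : Albert} (hP : P ∈ points) :
    ∃ k : autGroup, k.1 P = E 0 := by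
  obtain ⟨c, hc⟩ := exists_aut_shift
  have hE : ∀ i, ∃ k : autGroup, k.1 (E i) = E 0 := by
    have h2 : c.1 (E 1) = E 0 :=
      eq_E_of_fst_eq_one ((mem_points_iff c).2 (E_mem_points 1)) (by rw [(hc _ _).1]; simp [E])
    have h3 : c.1 (E 2) = E 1 :=
      eq_E_of_fst_eq_one ((mem_points_iff c).2 (E_mem_points 2)) (by rw [(hc _ _).1]; simp [E])
    intro i
    fin_cases i
    · exact ⟨1, rfl⟩
    · exact ⟨c, h2⟩
    · exact ⟨c * c, by rw [coe_mul_apply]; exact (congrArg c.1 h3).trans h2⟩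
  have hblock : ∀ Q ∈ points, Q.2 1 = 0 → Q.2 2 = 0 → ∃ k : autGroup, k.1 Q = E 0 := by
    intro Q hQ h1 h2
    obtain ⟨k, -, -, hk⟩ := exists_aut_snd_zero Q
    obtain ⟨i, hi⟩ := exists_eq_E_of_snd_eq_zero ((mem_points_iff k).2 hQ) (hk h1 h2)
    obtain ⟨l, hl⟩ := hE i
    exact ⟨l * k, by rw [coe_mul_apply, hi, hl]⟩
  obtain ⟨k, -, hk, -⟩ := exists_aut_snd_zero P
  have hQ := (mem_points_iff k).2 hP
  have hprod : (k.1 P).1 1 * (k.1 P).1 2 = 0 := by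
    have := dot_snd hQ 0
    rw [hk, dot_zero_left] at this
    exact this.symm
  rcases mul_eq_zero.1 hprod with h | h
  · have h2 : (k.1 P).2 2 = 0 := snd_eq_zero hQ 2 (Or.inr h)
    obtain ⟨l, hl⟩ := hblock (c.1 (k.1 P)) ((mem_points_iff c).2 hQ)
      (by rw [(hc _ _).2]; exact h2) (by rw [(hc _ _).2]; exact hk)
    exact ⟨l * c * k, hl⟩
  · have h1 : (k.1 P).2 1 = 0 := snd_eq_zero hQ 1 (Or.inl h)
    obtain ⟨l, hl⟩ := hblock (c.1 (c.1 (k.1 P)))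
      ((mem_points_iff c).2 ((mem_points_iff c).2 hQ))
      (by rw [(hc _ _).2, (hc _ _).2]; exact hk) (by rw [(hc _ _).2, (hc _ _).2]; exact h1)
    exact ⟨l * c * c * k, hl⟩

theorem ip_nonneg {P Q : Albert} (hP : P ∈ points) (hQ : Q ∈ points) : 0 ≤ ip P Q := by
  obtain ⟨k, hk⟩ := exists_aut_eq_E_zero hP
  rw [← ip_map k, hk, ip_E_left]
  exact fst_nonneg ((mem_points_iff k).2 hQ) 0

theorem ip_le_one {P Q : Albert} (hP : P ∈ points) (hQ : Q ∈ points) : ip P Q ≤ 1 := by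
  obtain ⟨k, hk⟩ := exists_aut_eq_E_zero hP
  rw [← ip_map k, hk, ip_E_left]
  exact fst_le_one ((mem_points_iff k).2 hQ) 0

/-- The diagonal matrix units are points, and differences of points on a line give the off-diagonal
entries. -/
theorem span_points : Submodule.span ℝ points = ⊤ := by
  obtain ⟨c, hc⟩ := exists_aut_shift
  have hshift : ∀ X, c.1 X ∈ Submodule.span ℝ points → X ∈ Submodule.span ℝ points := by
    intro X hX
    have := Submodule.mem_map_of_mem (f := (c⁻¹).1.toLinearMap) hX
    rw [Submodule.map_span] at this
    refine Submodule.span_mono ?_ ((coe_inv_apply_self c X) ▸ this)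
    rintro _ ⟨Y, hY, rfl⟩
    exact (mem_points_iff c⁻¹).2 hY
  have hE : ∀ i, E i ∈ Submodule.span ℝ points := fun i => Submodule.subset_span (E_mem_points i)
  have hu : ∀ u : Octonion, dot u u = 1 → ((0, Pi.single 2 u) : Albert) ∈
      Submodule.span ℝ points := by
    intro u hu
    have h1 := Submodule.subset_span (R := ℝ) (linePoint_mem 1 u hu)
    have h2 := Submodule.subset_span (R := ℝ) (linePoint_mem (-1) u hu)
    convert Submodule.sub_mem _ h1 h2 using 1
    refine ext3 ?_ ?_ ?_ ?_ ?_ ?_ <;> simp [linePoint]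
    module
  have hx : ∀ x : Octonion, ((0, Pi.single 2 x) : Albert) ∈ Submodule.span ℝ points := by
    intro x
    obtain ⟨r, u, hu', rfl⟩ := exists_unit_smul x
    convert Submodule.smul_mem _ r (hu u hu') using 1
    refine ext3 ?_ ?_ ?_ ?_ ?_ ?_ <;> simp
  have hx1 : ∀ x : Octonion, ((0, Pi.single 0 x) : Albert) ∈ Submodule.span ℝ points := by
    intro x
    refine hshift _ ?_
    convert hx x using 1
    refine ext3 ?_ ?_ ?_ ?_ ?_ ?_ <;> simp [hc]
  have hx2 : ∀ x : Octonion, ((0, Pi.single 1 x) : Albert) ∈ Submodule.span ℝ points := by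
    intro x
    refine hshift _ ?_
    convert hx1 x using 1
    refine ext3 ?_ ?_ ?_ ?_ ?_ ?_ <;> simp [hc]
  refine eq_top_iff.2 fun X _ => ?_
  have : X = X.1 0 • E 0 + X.1 1 • E 1 + X.1 2 • E 2 + (0, Pi.single 0 (X.2 0)) +
      (0, Pi.single 1 (X.2 1)) + (0, Pi.single 2 (X.2 2)) := by
    refine ext3 ?_ ?_ ?_ ?_ ?_ ?_ <;> simp [E]
  rw [this]
  exact Submodule.add_mem _ (Submodule.add_mem _ (Submodule.add_mem _ (Submodule.add_mem _
    (Submodule.add_mem _ (Submodule.smul_mem _ _ (hE 0)) (Submodule.smul_mem _ _ (hE 1)))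
    (Submodule.smul_mem _ _ (hE 2))) (hx1 _)) (hx2 _)) (hx _)

theorem eq_zero_of_ip_points {X : Albert} (h : ∀ P ∈ points, ip X P = 0) : X = 0 := by
  have : ipForm X = 0 := LinearMap.ext_on span_points (fun P hP => h P hP)
  rw [← ip_self_eq_zero, ← ipForm_apply, this]; rfl

/-- The identity matrix. -/
noncomputable def one : Albert := (1, 0)

theorem one_eq : one = E 0 + E 1 + E 2 := by
  refine ext3 ?_ ?_ ?_ ?_ ?_ ?_ <;> simp [E, one]

theorem ip_one (X : Albert) : ip one X = tr X := by
  rw [one_eq, ip_add_left, ip_add_left, ip_E_left, ip_E_left, ip_E_left]; rfl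

theorem map_identity (k : autGroup) : k.1 one = one := by
  refine sub_eq_zero.1 (eq_zero_of_ip_points fun P hP => ?_)
  have h1 : ip (k.1 one) P = 1 := by
    rw [← ip_map k⁻¹, coe_inv_apply_self, ip_one]
    exact ((mem_points_iff k⁻¹).2 hP).1
  rw [ip_sub_left, h1, ip_one, hP.1, sub_self]

/-- The automorphism group acts transitively on triples of mutually orthogonal points. -/
theorem exists_aut_frame {P Q R : Albert} (hP : P ∈ points) (hQ : Q ∈ points)
    (hPQ : ip P Q = 0) (hsum : P + Q + R = one) :
    ∃ k : autGroup, k.1 P = E 0 ∧ k.1 Q = E 1 ∧ k.1 R = E 2 := by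
  suffices h : ∃ k : autGroup, k.1 P = E 0 ∧ k.1 Q = E 1 by
    obtain ⟨k, h0, h1⟩ := h
    refine ⟨k, h0, h1, ?_⟩
    have := congrArg k.1 hsum
    rw [map_add, map_add, h0, h1, map_identity, one_eq] at this
    exact add_left_cancel this
  obtain ⟨k, hk⟩ := exists_aut_eq_E_zero hP
  have hQ' := (mem_points_iff k).2 hQ
  have h0 : (k.1 Q).1 0 = 0 := by rw [← ip_E_left, ← hk, ip_map, hPQ]
  obtain ⟨l, hl, -, hl2⟩ := exists_aut_snd_zero (k.1 Q)
  have hQ'' := (mem_points_iff l).2 hQ'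
  obtain ⟨i, hi⟩ := exists_eq_E_of_snd_eq_zero hQ'' (hl2 (snd_eq_zero hQ' 1 (Or.inr h0))
    (snd_eq_zero hQ' 2 (Or.inl h0)))
  have hi0 := hl (k.1 Q)
  rw [hi, h0] at hi0
  have hlE := map_E_zero_of_fst hl
  fin_cases i
  · simp [E] at hi0
  · exact ⟨l * k, by rw [coe_mul_apply, hk, hlE], hi⟩
  · -- a quarter turn exchanges `E 1` and `E 2`
    obtain ⟨m, hm⟩ := exists_aut_rotation 0 1 (by norm_num)
    refine ⟨m * l * k, ?_, ?_⟩
    · rw [coe_mul_apply, hk, coe_mul_apply, hlE, map_E_zero_of_fst fun X => (hm X).1]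
    · rw [coe_mul_apply, coe_mul_apply]
      refine eq_E_of_fst_eq_one ((mem_points_iff m).2 hQ'') ?_
      rw [hi, (hm _).2.1]
      simp [E]

end Albert

/-! ### Diagonalization -/

namespace Albert

/-- Compactness of the projective plane: a linear function attains its maximum on it. -/
theorem exists_max (X : Albert) : ∃ P ∈ points, ∀ Q ∈ points, ip X Q ≤ ip X P := by
  let F : (Fin 3 → ℝ) × (Fin 3 → Quaternion ℝ × Quaternion ℝ) → Albert :=
    fun p => (p.1, fun i => ⟨(p.2 i).1, (p.2 i).2⟩)
  have hF : Function.Surjective F := fun X => ⟨(X.1, fun i => ((X.2 i).fst, (X.2 i).snd)), rfl⟩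
  have hdot : ∀ x y : Octonion, dot x y =
      (x.fst * star y.fst).re + (star y.snd * x.snd).re := fun x y => by
    simp [dot, re]
  have hclosed : IsClosed (F ⁻¹' points) := by
    have : F ⁻¹' points = {p | p.1 0 + p.1 1 + p.1 2 = 1} ∩
        (⋂ i, {p | p.1 (i + 1) * p.1 (i + 2) - dot ((F p).2 i) ((F p).2 i) = 0}) ∩
        (⋂ i, {p | ((sharp (F p)).2 i).fst = 0}) ∩
        (⋂ i, {p | ((sharp (F p)).2 i).snd = 0}) := by
      ext p
      simp only [Set.mem_preimage, Set.mem_inter_iff, Set.mem_iInter, Set.mem_ofPred_eq]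
      constructor
      · rintro ⟨h1, h2⟩
        exact ⟨⟨⟨h1, fun i => congrFun (congrArg Prod.fst h2) i⟩, fun i => by rw [h2]; rfl⟩,
          fun i => by rw [h2]; rfl⟩
      · rintro ⟨⟨⟨h1, h2⟩, h3⟩, h4⟩
        exact ⟨h1, Prod.ext (funext h2) (funext fun i => Octonion.ext (h3 i) (h4 i))⟩
    rw [this]
    refine ((IsClosed.inter ?_ ?_).inter ?_).inter ?_
    · exact isClosed_eq (by fun_prop) (by fun_prop)
    · refine isClosed_iInter fun i => isClosed_eq ?_ (by fun_prop)
      simp only [hdot, F]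
      have := Quaternion.continuous_re
      fun_prop
    · refine isClosed_iInter fun i => isClosed_eq ?_ (by fun_prop)
      simp only [sharp, fst_sub, fst_star, fst_mul, fst_smul, F]
      fun_prop
    · refine isClosed_iInter fun i => isClosed_eq ?_ (by fun_prop)
      simp only [sharp, snd_sub, snd_star, snd_mul, snd_smul, F]
      fun_prop
  have hcompact : IsCompact (F ⁻¹' points) := by
    refine (isCompact_closedBall (0 : (Fin 3 → ℝ) × (Fin 3 → Quaternion ℝ × Quaternion ℝ)) 1)
      |>.of_isClosed_subset hclosed fun p hp => ?_
    have hp' : F p ∈ points := hp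
    rw [mem_closedBall_zero_iff, Prod.norm_def]
    refine max_le ((pi_norm_le_iff_of_nonneg zero_le_one).2 fun i => ?_)
      ((pi_norm_le_iff_of_nonneg zero_le_one).2 fun i => ?_)
    · rw [Real.norm_eq_abs, abs_le]
      exact ⟨by linarith [fst_nonneg hp' i], fst_le_one hp' i⟩
    · have h1 : dot ((F p).2 i) ((F p).2 i) ≤ 1 := by
        rw [dot_snd hp']
        exact mul_le_one₀ (fst_le_one hp' _) (fst_nonneg hp' _) (fst_le_one hp' _)
      have h2 : dot ((F p).2 i) ((F p).2 i) = ‖(p.2 i).1‖ * ‖(p.2 i).1‖ +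
          ‖(p.2 i).2‖ * ‖(p.2 i).2‖ := by
        rw [hdot, ← Quaternion.normSq_eq_norm_mul_self, ← Quaternion.normSq_eq_norm_mul_self]
        simp [Quaternion.self_mul_star, Quaternion.star_mul_self, F]
      rw [Prod.norm_def]
      refine max_le ?_ ?_ <;>
      nlinarith [norm_nonneg (p.2 i).1, norm_nonneg (p.2 i).2]
  have hne : (F ⁻¹' points).Nonempty := by
    obtain ⟨p, hp⟩ := hF (E 0)
    exact ⟨p, show F p ∈ points by rw [hp]; exact E_mem_points 0⟩
  have hcont : Continuous fun p => ip X (F p) := by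
    simp only [ip, hdot, F]
    have := Quaternion.continuous_re
    fun_prop
  obtain ⟨p, hp, hmax⟩ := hcompact.exists_isMaxOn hne hcont.continuousOn
  refine ⟨F p, hp, fun Q hQ => ?_⟩
  obtain ⟨q, rfl⟩ := hF Q
  exact hmax hQ

/-- If `ip X` is maximal at `E 0`, the first order condition along lines through `E 0` gives
vanishing of the entries of `X` in the first row outside the diagonal. -/
theorem snd_two_eq_zero_of_max {X : Albert} (h : ∀ Q ∈ points, ip X Q ≤ ip X (E 0)) :
    X.2 2 = 0 := by
  by_contra hne
  have hpos : 0 < dot (X.2 2) (X.2 2) :=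
    (dot_self_nonneg _).lt_of_ne fun h' => hne (dot_self_eq_zero.1 h'.symm)
  set n := Real.sqrt (dot (X.2 2) (X.2 2))
  have hn : n * n = dot (X.2 2) (X.2 2) := Real.mul_self_sqrt hpos.le
  have hn0 : 0 < n := Real.sqrt_pos.2 hpos
  have key : ∀ s : ℝ, s ^ 2 * (X.1 1 - X.1 0) + 2 * s * n ≤ 0 := by
    intro s
    have h1 := h _ (linePoint_mem s (n⁻¹ • X.2 2) (by
      rw [dot_smul_left, dot_smul_right, ← hn]; field_simp))
    have hd : dot (X.2 2) (n⁻¹ • X.2 2) = n := by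
      rw [dot_smul_right, ← hn]; field_simp
    rw [ip_E_right, linePoint, ip_smul_right] at h1
    have hs : 0 < 1 + s ^ 2 := by positivity
    rw [inv_mul_le_iff₀ hs] at h1
    simp [ip, dot_smul_right s, hd] at h1
    linarith
  by_cases hd : X.1 1 - X.1 0 = 0
  · have := key 1
    rw [hd] at this
    linarith
  · have h1 := key (n / |X.1 1 - X.1 0|)
    have h2 : 0 < |X.1 1 - X.1 0| := abs_pos.2 hd
    have h3 := neg_abs_le (X.1 1 - X.1 0)
    have h4 : (n / |X.1 1 - X.1 0|) ^ 2 * (X.1 1 - X.1 0) ≥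
        (n / |X.1 1 - X.1 0|) ^ 2 * (- |X.1 1 - X.1 0|) := by gcongr
    have h5 : (n / |X.1 1 - X.1 0|) ^ 2 * (- |X.1 1 - X.1 0|) +
        2 * (n / |X.1 1 - X.1 0|) * n = n ^ 2 / |X.1 1 - X.1 0| := by
      field_simp; ring
    have h6 : 0 < n ^ 2 / |X.1 1 - X.1 0| := by positivity
    linarith

/-- Every Hermitian matrix over the octonions can be diagonalized. -/
theorem exists_aut_diagonal (X : Albert) : ∃ k : autGroup, (k.1 X).2 = 0 := by
  obtain ⟨P, hP, hmax⟩ := exists_max X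
  obtain ⟨k, hk⟩ := exists_aut_eq_E_zero hP
  have hmaxk : ∀ Q ∈ points, ip (k.1 X) Q ≤ ip (k.1 X) (E 0) := fun Q hQ => by
    have h := hmax _ ((mem_points_iff k⁻¹).2 hQ)
    rwa [← ip_map k, ← ip_map k X P, coe_apply_inv_self, hk] at h
  have h2 : (k.1 X).2 2 = 0 := snd_two_eq_zero_of_max hmaxk
  have h1 : (k.1 X).2 1 = 0 := by
    -- a quarter turn exchanges the two off-diagonal entries of the first row
    obtain ⟨m, hm⟩ := exists_aut_rotation 0 1 (by norm_num)
    have hmE := map_E_zero_of_fst fun X => (hm X).1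
    have h := snd_two_eq_zero_of_max (X := m.1 (k.1 X)) fun Q hQ => by
      have h := hmaxk _ ((mem_points_iff m⁻¹).2 hQ)
      rwa [← ip_map m, ← ip_map m _ (E 0), coe_apply_inv_self, hmE] at h
    rw [(hm _).2.2.2.2.2] at h
    simpa using h
  obtain ⟨l, -, -, hl⟩ := exists_aut_snd_zero (k.1 X)
  exact ⟨l * k, hl h1 h2⟩

/-- If `a` is larger, or smaller, than both `b` and `c`, then a convex combination of `a`, `b`, `c`
with value `a` has all its weight on `a`. -/
theorem weight_eq_one {a b c x y z : ℝ} (h : 0 < (a - b) * (a - c)) (hy : 0 ≤ y) (hz : 0 ≤ z)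
    (hs : x + y + z = 1) (e : a * x + b * y + c * z = a) : x = 1 := by
  have h1 : (a - b) ^ 2 * y + (a - b) * (a - c) * z = 0 := by
    linear_combination (a - b) * (a * hs - e)
  have hab : a - b ≠ 0 := left_ne_zero_of_mul h.ne'
  have hz0 : z = 0 := by
    have := mul_nonneg h.le hz
    have := mul_nonneg (sq_nonneg (a - b)) hy
    exact (mul_eq_zero.1 (by linarith : (a - b) * (a - c) * z = 0)).resolve_left h.ne'
  have hy0 : y = 0 := by
    rw [hz0, mul_zero, add_zero] at h1
    exact (mul_eq_zero.1 h1).resolve_left (pow_ne_zero 2 hab)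
  linarith

/-- A strictly extreme eigenvalue determines its eigenvector: a set of automorphisms fixing a
non-scalar matrix has a common fixed point in the projective plane. -/
theorem exists_point_fixed {X : Albert} (hX : ∀ r : ℝ, X ≠ r • one) :
    ∃ P ∈ points, ∀ k : autGroup, k.1 X = X → k.1 P = P := by
  obtain ⟨l, hl⟩ := exists_aut_diagonal X
  set D := l.1 X with hD
  have hip : ∀ Q, ip D Q = D.1 0 * Q.1 0 + D.1 1 * Q.1 1 + D.1 2 * Q.1 2 := fun Q => by
    simp [ip, hl]
  have hns : ¬ (D.1 0 = D.1 1 ∧ D.1 0 = D.1 2) := by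
    rintro ⟨h1, h2⟩
    refine hX (D.1 0) ?_
    have h3 : D = D.1 0 • one :=
      ext3 (by simp [one]) (by simp [one, h1]) (by simp [one, h2])
        (by simp [one, hl]) (by simp [one, hl]) (by simp [one, hl])
    have h4 := congrArg (l⁻¹).1 h3
    rwa [hD, map_smul, coe_inv_apply_self, map_identity, ← hD] at h4
  -- it suffices to find a diagonal entry of `D` that is strictly extreme
  suffices h : ∃ i, ∀ Q ∈ points, ip D Q = D.1 i → Q.1 i = 1 by
    obtain ⟨i, hi⟩ := h
    refine ⟨(l⁻¹).1 (E i), (mem_points_iff l⁻¹).2 (E_mem_points i), fun k hk => ?_⟩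
    have hfix : (l * k * l⁻¹).1 D = D := by simp [hD, hk]
    have h1 : (l * k * l⁻¹).1 (E i) = E i := by
      have hm := (mem_points_iff (l * k * l⁻¹)).2 (E_mem_points i)
      refine eq_E_of_fst_eq_one hm (hi _ hm ?_)
      nth_rewrite 1 [← hfix]
      rw [ip_map, ip_E_right]
    have h2 := congrArg (l⁻¹).1 h1
    simpa using h2
  have hpos : 0 < (D.1 0 - D.1 1) ^ 2 + (D.1 1 - D.1 2) ^ 2 + (D.1 2 - D.1 0) ^ 2 := by
    by_contra hle
    refine hns ⟨?_, ?_⟩ <;>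
    nlinarith [sq_nonneg (D.1 0 - D.1 1), sq_nonneg (D.1 1 - D.1 2), sq_nonneg (D.1 2 - D.1 0)]
  have hcases : 0 < (D.1 0 - D.1 1) * (D.1 0 - D.1 2) ∨ 0 < (D.1 1 - D.1 2) * (D.1 1 - D.1 0) ∨
      0 < (D.1 2 - D.1 0) * (D.1 2 - D.1 1) := by
    by_contra! h
    nlinarith [h.1, h.2.1, h.2.2]
  rcases hcases with h | h | h
  · refine ⟨0, fun Q hQ e => weight_eq_one h (fst_nonneg hQ 1) (fst_nonneg hQ 2) (sum_fst hQ) ?_⟩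
    rw [hip] at e; linarith
  · refine ⟨1, fun Q hQ e => weight_eq_one h (fst_nonneg hQ 2) (fst_nonneg hQ 0) ?_ ?_⟩
    · linarith [sum_fst hQ]
    · rw [hip] at e; linarith
  · refine ⟨2, fun Q hQ e => weight_eq_one h (fst_nonneg hQ 0) (fst_nonneg hQ 1) ?_ ?_⟩
    · linarith [sum_fst hQ]
    · rw [hip] at e; linarith

end Albert

/-! ### Automorphisms of the octonions -/

namespace Octonion

open scoped Quaternion

/-- The quaternion with the given coordinates. -/
def quat (a b c d : ℝ) : Quaternion ℝ := ⟨a, b, c, d⟩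

@[simp] theorem re_quat (a b c d : ℝ) : (quat a b c d).re = a := rfl
@[simp] theorem imI_quat (a b c d : ℝ) : (quat a b c d).imI = b := rfl
@[simp] theorem imJ_quat (a b c d : ℝ) : (quat a b c d).imJ = c := rfl
@[simp] theorem imK_quat (a b c d : ℝ) : (quat a b c d).imK = d := rfl

/-- Unital `*`-endomorphisms of the algebra of octonions. -/
structure IsStarHom (φ : Octonion →ₗ[ℝ] Octonion) : Prop where
  map_one : φ 1 = 1
  map_mul : ∀ x y, φ (x * y) = φ x * φ y
  map_star : ∀ x, φ (star x) = star (φ x)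

theorem IsStarHom.comp {φ ψ : Octonion →ₗ[ℝ] Octonion} (hφ : IsStarHom φ) (hψ : IsStarHom ψ) :
    IsStarHom (φ ∘ₗ ψ) where
  map_one := by rw [LinearMap.comp_apply, hψ.map_one, hφ.map_one]
  map_mul x y := by simp only [LinearMap.comp_apply, hψ.map_mul, hφ.map_mul]
  map_star x := by simp only [LinearMap.comp_apply, hψ.map_star, hφ.map_star]

theorem IsStarHom.dot_self {φ : Octonion →ₗ[ℝ] Octonion} (hφ : IsStarHom φ) (x : Octonion) :
    dot (φ x) (φ x) = dot x x := by
  apply smul_one_injective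
  change dot (φ x) (φ x) • (1 : Octonion) = dot x x • 1
  rw [← mul_star_self, ← hφ.map_star, ← hφ.map_mul, mul_star_self, map_smul, hφ.map_one]

theorem IsStarHom.injective {φ : Octonion →ₗ[ℝ] Octonion} (hφ : IsStarHom φ) :
    Function.Injective φ := by
  refine (injective_iff_map_eq_zero φ).2 fun x hx => ?_
  rw [← dot_self_eq_zero, ← hφ.dot_self, hx, dot_zero_left]

/-- The automorphisms of the octonions that preserve the subalgebra of quaternions. -/
theorem exists_starHom_conj (p q : Quaternion ℝ) (hp : star p * p = 1) (hq : star q * q = 1) :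
    ∃ φ : Octonion →ₗ[ℝ] Octonion, IsStarHom φ ∧
      ∀ x, φ x = ⟨p * x.fst * star p, q * x.snd * star p⟩ := by
  have hp' : p * star p = 1 := by
    rw [Quaternion.star_mul_self] at hp; rw [Quaternion.self_mul_star, hp]
  refine ⟨{ toFun := fun x => ⟨p * x.fst * star p, q * x.snd * star p⟩
            map_add' := fun x y => by ext1 <;> simp [mul_add, add_mul]
            map_smul' := fun r x => by ext1 <;> simp }, ⟨?_, ?_, ?_⟩, fun x => rfl⟩
  · refine Octonion.ext ?_ ?_ <;> simp [hp']
  · intro x y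
    refine Octonion.ext ?_ ?_
    · simp only [LinearMap.coe_mk, AddHom.coe_mk, fst_mul, snd_mul, star_mul, star_star]
      have h1 : p * x.fst * star p * (p * y.fst * star p) = p * (x.fst * y.fst) * star p := by
        calc _ = p * x.fst * (star p * p) * y.fst * star p := by noncomm_ring
          _ = _ := by rw [hp]; noncomm_ring
      have h2 : p * (star y.snd * star q) * (q * x.snd * star p) =
          p * (star y.snd * x.snd) * star p := by
        calc _ = p * star y.snd * (star q * q) * x.snd * star p := by noncomm_ring
          _ = _ := by rw [hq]; noncomm_ring
      rw [h1, h2]; noncomm_ring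
    · simp only [LinearMap.coe_mk, AddHom.coe_mk, fst_mul, snd_mul, star_mul, star_star]
      have h1 : q * y.snd * star p * (p * x.fst * star p) = q * (y.snd * x.fst) * star p := by
        calc _ = q * y.snd * (star p * p) * x.fst * star p := by noncomm_ring
          _ = _ := by rw [hp]; noncomm_ring
      have h2 : q * x.snd * star p * (p * (star y.fst * star p)) =
          q * (x.snd * star y.fst) * star p := by
        calc _ = q * x.snd * (star p * p) * star y.fst * star p := by noncomm_ring
          _ = _ := by rw [hp]; noncomm_ring
      rw [h1, h2]; noncomm_ring
  · intro x
    refine Octonion.ext ?_ ?_ <;> simp [mul_assoc]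

/-- The automorphism of the octonions that fixes `i` and exchanges `j` and `ℓ`. -/
theorem exists_starHom_swap : ∃ φ : Octonion →ₗ[ℝ] Octonion, IsStarHom φ ∧
    ∀ x, φ x = ⟨quat x.fst.re x.fst.imI x.snd.re x.snd.imI,
      quat x.fst.imJ x.fst.imK (-x.snd.imJ) (-x.snd.imK)⟩ := by
  refine ⟨{ toFun := fun x => ⟨quat x.fst.re x.fst.imI x.snd.re x.snd.imI,
              quat x.fst.imJ x.fst.imK (-x.snd.imJ) (-x.snd.imK)⟩
            map_add' := fun x y => by apply ext_components <;> simp [add_comm]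
            map_smul' := fun r x => by apply ext_components <;> simp }, ⟨?_, ?_, ?_⟩, fun x => rfl⟩
  · apply ext_components <;> simp
  · intro x y
    apply ext_components <;>
    simp only [LinearMap.coe_mk, AddHom.coe_mk, fst_re_mul, fst_imI_mul, fst_imJ_mul, fst_imK_mul,
      re_quat, imI_quat, imJ_quat, imK_quat, snd_re_mul, snd_imI_mul, snd_imJ_mul,
      snd_imK_mul] <;> ring
  · intro x
    apply ext_components <;> simp

/-- Every imaginary quaternion is conjugate to a real multiple of `i`. -/
theorem exists_conj_eq_imI (m : Quaternion ℝ) (hm : m.re = 0) :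
    ∃ p : Quaternion ℝ, star p * p = 1 ∧ ∃ t : ℝ, p * m * star p = quat 0 t 0 0 := by
  set s := Real.sqrt (m.imI ^ 2 + m.imJ ^ 2 + m.imK ^ 2)
  have hs : s ^ 2 = m.imI ^ 2 + m.imJ ^ 2 + m.imK ^ 2 := Real.sq_sqrt (by positivity)
  by_cases h : m.imJ = 0 ∧ m.imK = 0
  · refine ⟨1, by simp, m.imI, ?_⟩
    ext <;> simp [hm, h.1, h.2]
  have hpos : 0 < m.imJ ^ 2 + m.imK ^ 2 := by
    rcases not_and_or.1 h with h | h
    · have := sq_pos_of_ne_zero h; nlinarith [sq_nonneg m.imK]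
    · have := sq_pos_of_ne_zero h; nlinarith [sq_nonneg m.imJ]
  -- the rotation exchanging `m` and `s i` is the half turn about their sum
  set N := (m.imI + s) ^ 2 + m.imJ ^ 2 + m.imK ^ 2
  have hN : 0 < N := by have := sq_nonneg (m.imI + s); simp only [N]; linarith
  have hr : Real.sqrt N ^ 2 = N := Real.sq_sqrt hN.le
  have hr0 : Real.sqrt N ≠ 0 := (Real.sqrt_pos.2 hN).ne'
  refine ⟨(Real.sqrt N)⁻¹ • quat 0 (m.imI + s) m.imJ m.imK, ?_, s, ?_⟩
  · rw [Quaternion.star_smul, smul_mul_smul_comm, ← sq, inv_pow, hr, inv_smul_eq_iff₀ hN.ne']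
    ext <;> simp [N] <;> ring
  · rw [Quaternion.star_smul, smul_mul_assoc, smul_mul_smul_comm, ← sq, inv_pow, hr,
      inv_smul_eq_iff₀ hN.ne']
    ext
    · simp [hm]; ring
    · simp [hm, N]; linear_combination (-(m.imI + s)) * hs
    · simp [hm, N]; linear_combination (-m.imJ) * hs
    · simp [hm, N]; linear_combination (-m.imK) * hs

/-- Every imaginary unit is moved to `± i` by an automorphism of the octonions: one preserving the
quaternions makes the first component a multiple of `i` and the second one real, and the swap of `j`
and `ℓ` then moves the result into the quaternions. -/
theorem exists_starHom_eq_I {n : Octonion} (hn : re n = 0) (hn1 : dot n n = 1) :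
    ∃ φ : Octonion →ₗ[ℝ] Octonion, IsStarHom φ ∧
      (φ n = ofComplex Complex.I ∨ φ n = - ofComplex Complex.I) := by
  have hquat : ∀ n : Octonion, re n = 0 → dot n n = 1 → n.snd = 0 →
      ∃ φ : Octonion →ₗ[ℝ] Octonion, IsStarHom φ ∧
        (φ n = ofComplex Complex.I ∨ φ n = - ofComplex Complex.I) := by
    intro n hn hn1 h0
    obtain ⟨p, hp, t, ht⟩ := exists_conj_eq_imI n.fst hn
    obtain ⟨φ, hφ, hφ'⟩ := exists_starHom_conj p 1 hp (by simp)
    have e : φ n = ⟨quat 0 t 0 0, 0⟩ := by rw [hφ', ht, h0]; simp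
    have h1 : t = 1 ∨ t = -1 := by
      have := hφ.dot_self n
      rw [hn1, e, dot_eq] at this
      exact mul_self_eq_one_iff.1 (by simpa using this)
    refine ⟨φ, hφ, ?_⟩
    rcases h1 with h | h
    · left; rw [e, h]; apply ext_components <;> simp [ofComplex]
    · right; rw [e, h]; apply ext_components <;> simp [ofComplex]
  obtain ⟨p, hp, t, ht⟩ := exists_conj_eq_imI n.fst hn
  obtain ⟨q, hq, r, hr⟩ : ∃ q : Quaternion ℝ, star q * q = 1 ∧
      ∃ r : ℝ, q * n.snd * star p = (r : Quaternion ℝ) := by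
    by_cases h : n.snd = 0
    · exact ⟨1, by simp, 0, by simp [h]⟩
    · have hN : Quaternion.normSq n.snd ≠ 0 := Quaternion.normSq_ne_zero.2 h
      have hr : Real.sqrt (Quaternion.normSq n.snd) ^ 2 = Quaternion.normSq n.snd :=
        Real.sq_sqrt Quaternion.normSq_nonneg
      have hcoe : ∀ r : ℝ, (r : Quaternion ℝ) = r • (1 : Quaternion ℝ) := fun r => by
        ext <;> simp
      have hp' : p * star p = 1 := by
        rw [Quaternion.star_mul_self] at hp; rw [Quaternion.self_mul_star, hp]
      refine ⟨(Real.sqrt (Quaternion.normSq n.snd))⁻¹ • (p * star n.snd), ?_,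
        (Real.sqrt (Quaternion.normSq n.snd))⁻¹ * Quaternion.normSq n.snd, ?_⟩
      · rw [Quaternion.star_smul, smul_mul_smul_comm, ← sq, inv_pow, hr, inv_smul_eq_iff₀ hN,
          star_mul, star_star, mul_assoc, ← mul_assoc (star p), hp, one_mul,
          Quaternion.self_mul_star,
          hcoe]
      · rw [smul_mul_assoc, mul_assoc p, Quaternion.star_mul_self, hcoe,
          mul_smul_comm, mul_one, smul_mul_assoc, smul_mul_assoc, hp', smul_smul,
          ← hcoe]
  obtain ⟨φ, hφ, hφ'⟩ := exists_starHom_conj p q hp hq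
  obtain ⟨ψ, hψ, hψ'⟩ := exists_starHom_swap
  have hpsi : ψ (φ n) = ⟨quat 0 t r 0, 0⟩ := by
    rw [hφ', hψ', ht, hr]; apply ext_components <;> simp
  obtain ⟨χ, hχ, hχ'⟩ := hquat (ψ (φ n)) (by rw [hpsi]; rfl)
    (by rw [hψ.dot_self, hφ.dot_self, hn1]) (by rw [hpsi])
  exact ⟨χ ∘ₗ ψ ∘ₗ φ, hχ.comp (hψ.comp hφ), hχ'⟩

end Octonion

/-! ### Automorphisms fixing a frame -/

namespace Albert

/-- The matrices whose only nonzero entries are `x` in position `(i + 1, i + 2)` and its conjugate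
in the transposed position. -/
noncomputable def inj (i : Fin 3) : Octonion →ₗ[ℝ] Albert :=
  LinearMap.inr ℝ _ _ ∘ₗ LinearMap.single ℝ (fun _ => Octonion) i

theorem inj_fst (i : Fin 3) (x : Octonion) : (inj i x).1 = 0 := rfl
theorem inj_snd (i : Fin 3) (x : Octonion) : (inj i x).2 = Pi.single i x := rfl

theorem eq_sum (X : Albert) : X = X.1 0 • E 0 + X.1 1 • E 1 + X.1 2 • E 2 +
    (inj 0 (X.2 0) + inj 1 (X.2 1) + inj 2 (X.2 2)) := by
  refine ext3 ?_ ?_ ?_ ?_ ?_ ?_ <;> simp [E, inj_fst, inj_snd]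

/-- The automorphisms fixing the three diagonal matrix units. -/
def FixesFrame (k : autGroup) : Prop := ∀ i, k.1 (E i) = E i

theorem FixesFrame.mul {k l : autGroup} (hk : FixesFrame k) (hl : FixesFrame l) :
    FixesFrame (k * l) := fun i => by rw [coe_mul_apply, hl, hk]

theorem FixesFrame.map_fst {k : autGroup} (hk : FixesFrame k) (X : Albert) :
    (k.1 X).1 = X.1 := by
  funext i
  rw [← ip_E_left, ← hk, ip_map, ip_E_left]

theorem fixesFrame_of_map_fst {k : autGroup} (hk : ∀ X, (k.1 X).1 = X.1) : FixesFrame k :=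
  fun i => eq_E_of_fst_eq_one ((mem_points_iff k).2 (E_mem_points i)) (by rw [hk]; simp [E])

/-- The action of an automorphism on the off-diagonal entries in position `(i + 1, i + 2)`. -/
noncomputable def entryMap (k : autGroup) (i : Fin 3) : Octonion →ₗ[ℝ] Octonion :=
  LinearMap.proj i ∘ₗ LinearMap.snd ℝ (Fin 3 → ℝ) (Fin 3 → Octonion) ∘ₗ k.1.toLinearMap ∘ₗ inj i

theorem entryMap_apply (k : autGroup) (i : Fin 3) (x : Octonion) :
    entryMap k i x = (k.1 (inj i x)).2 i := rfl

/-- The third diagonal entry of `linePoint 1 u` vanishes, hence so does that of its image; this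
confines the image of `inj 2 u` to position `2`. -/
theorem FixesFrame.map_inj_two {k : autGroup} (hk : FixesFrame k) (x : Octonion) :
    k.1 (inj 2 x) = inj 2 (entryMap k 2 x) := by
  obtain ⟨r, u, hu, rfl⟩ := exists_unit_smul x
  suffices h : k.1 (inj 2 u) = inj 2 (entryMap k 2 u) by
    simp only [map_smul, h]
  have hline : linePoint 1 u = (2⁻¹ : ℝ) • (E 0 + E 1 + inj 2 u) := by
    refine ext3 ?_ ?_ ?_ ?_ ?_ ?_ <;> simp [linePoint, E, inj_fst, inj_snd] <;> norm_num
  have hP := (mem_points_iff k).2 (linePoint_mem 1 u hu)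
  have hfst : (k.1 (linePoint 1 u)).1 2 = 0 := by rw [hk.map_fst]; simp [linePoint]
  have h0 := snd_eq_zero hP 0 (Or.inr hfst)
  have h1 := snd_eq_zero hP 1 (Or.inl hfst)
  rw [hline, map_smul, map_add, map_add, hk, hk] at h0 h1
  simp [E] at h0 h1
  have hf := hk.map_fst (inj 2 u)
  refine ext3 (congrFun hf 0) (congrFun hf 1) (congrFun hf 2) ?_ ?_ ?_
  · rw [h0]; simp [inj_snd]
  · rw [h1]; simp [inj_snd]
  · simp [inj_snd, entryMap_apply]

/-- The cyclic permutation of the coordinates as an automorphism. -/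
noncomputable def shift : autGroup := exists_aut_shift.choose

theorem shift_fst (X : Albert) (i : Fin 3) : (shift.1 X).1 i = X.1 (i + 1) :=
  (exists_aut_shift.choose_spec X i).1

theorem shift_snd (X : Albert) (i : Fin 3) : (shift.1 X).2 i = X.2 (i + 1) :=
  (exists_aut_shift.choose_spec X i).2

theorem shift_inj (i : Fin 3) (x : Octonion) : shift.1 (inj (i + 1) x) = inj i x := by
  refine Prod.ext (funext fun j => ?_) (funext fun j => ?_)
  · rw [shift_fst]; rfl
  · rw [shift_snd, inj_snd, inj_snd, Pi.single_apply, Pi.single_apply]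
    simp

theorem shift_E (i : Fin 3) : shift.1 (E (i + 1)) = E i := by
  refine Prod.ext (funext fun j => ?_) (funext fun j => ?_)
  · rw [shift_fst]; simp [E, Pi.single_apply]
  · rw [shift_snd]; rfl

theorem shift_inv_E (i : Fin 3) : (shift⁻¹).1 (E i) = E (i + 1) := by
  rw [← shift_E, coe_inv_apply_self]

theorem shift_inv_inj (i : Fin 3) (x : Octonion) : (shift⁻¹).1 (inj i x) = inj (i + 1) x := by
  rw [← shift_inj, coe_inv_apply_self]

/-- An automorphism fixing the frame preserves all spaces of off-diagonal entries. -/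
theorem FixesFrame.map_inj {k : autGroup} (hk : FixesFrame k) (i : Fin 3) (x : Octonion) :
    k.1 (inj i x) = inj i (entryMap k i x) := by
  have step : ∀ i, (∀ k : autGroup, FixesFrame k → ∀ x, ∃ y, k.1 (inj i x) = inj i y) →
      ∀ k : autGroup, FixesFrame k → ∀ x, ∃ y, k.1 (inj (i + 1) x) = inj (i + 1) y := by
    intro i h k hk x
    obtain ⟨y, hy⟩ := h (shift * k * shift⁻¹)
      (fun j => by
        rw [coe_mul_apply, coe_mul_apply, shift_inv_E, hk, shift_E]) x
    refine ⟨y, ?_⟩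
    rw [coe_mul_apply, coe_mul_apply, shift_inv_inj] at hy
    rw [← shift_inv_inj i y, ← hy, coe_inv_apply_self]
  have h2 : ∀ k : autGroup, FixesFrame k → ∀ x, ∃ y, k.1 (inj 2 x) = inj 2 y :=
    fun k hk x => ⟨_, hk.map_inj_two x⟩
  have h0 := step 2 h2
  have h1 := step 0 h0
  obtain ⟨y, hy⟩ : ∃ y, k.1 (inj i x) = inj i y := by
    fin_cases i
    exacts [h0 k hk x, h1 k hk x, h2 k hk x]
  rw [entryMap_apply, hy, inj_snd, Pi.single_eq_same]

theorem FixesFrame.map_snd {k : autGroup} (hk : FixesFrame k) (X : Albert) (i : Fin 3) :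
    (k.1 X).2 i = entryMap k i (X.2 i) := by
  conv_lhs => rw [eq_sum X]
  simp only [map_add, map_smul, hk _, hk.map_inj]
  fin_cases i <;> simp [E, inj_snd]

theorem FixesFrame.dot_entryMap {k : autGroup} (hk : FixesFrame k) (i : Fin 3) (x : Octonion) :
    dot (entryMap k i x) (entryMap k i x) = dot x x := by
  have h := ip_map k (inj i x) (inj i x)
  rw [hk.map_inj] at h
  fin_cases i <;> simpa [ip, inj_fst, inj_snd] using h

theorem FixesFrame.entryMap_injective {k : autGroup} (hk : FixesFrame k) (i : Fin 3) :
    Function.Injective (entryMap k i) := by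
  refine (injective_iff_map_eq_zero _).2 fun x hx => ?_
  rw [← dot_self_eq_zero, ← hk.dot_entryMap i, hx, dot_zero_left]

/-- Three unit octonions multiplying to `1` in cyclic order are the off-diagonal entries of a point.
-/
theorem third_smul_mem_points {u v w : Octonion} (hu : dot u u = 1) (hv : dot v v = 1)
    (hw : dot w w = 1) (h0 : star (v * w) = u) (h1 : star (w * u) = v) (h2 : star (u * v) = w) :
    ((3⁻¹ : ℝ) • (1, ![u, v, w]) : Albert) ∈ points := by
  have h : ∀ x y : Octonion, star ((3⁻¹ : ℝ) • x * (3⁻¹ : ℝ) • y) =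
      (3⁻¹ : ℝ) • (3⁻¹ : ℝ) • star (x * y) := fun x y => by
    rw [smul_mul_assoc, mul_smul_comm, star_smul, star_smul]; simp
  refine ⟨?_, ext3 ?_ ?_ ?_ ?_ ?_ ?_⟩
  · simp [tr]; norm_num
  · simp [sharp_fst_zero, dot_smul_left, dot_smul_right, hu]
  · simp [sharp_fst_one, dot_smul_left, dot_smul_right, hv]
  · simp [sharp_fst_two, dot_smul_left, dot_smul_right, hw]
  · exact sub_eq_zero.2 ((h v w).trans (by rw [h0]; simp))
  · exact sub_eq_zero.2 ((h w u).trans (by rw [h1]; simp))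
  · exact sub_eq_zero.2 ((h u v).trans (by rw [h2]; simp))

/-- The three entry maps form a triality triple, because they preserve the points of
`third_smul_mem_points`. -/
theorem FixesFrame.entryMap_mul {k : autGroup} (hk : FixesFrame k) (x y : Octonion) :
    entryMap k 2 (star (x * y)) = star (entryMap k 0 x * entryMap k 1 y) := by
  obtain ⟨r, u, hu, rfl⟩ := exists_unit_smul x
  obtain ⟨s, v, hv, rfl⟩ := exists_unit_smul y
  have huv : dot (star (u * v)) (star (u * v)) = 1 := by
    rw [dot_star_star, dot_mul_self, hu, hv, one_mul]
  have hP := third_smul_mem_points hu hv huv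
    (by rw [star_mul u v, mul_star_mul_cancel, hv, one_smul, star_star])
    (by rw [star_mul u v, mul_star_mul_cancel_right, hu, one_smul, star_star]) rfl
  have h := smul_snd ((mem_points_iff k).2 hP) 2
  rw [hk.map_fst, hk.map_snd, hk.map_snd, hk.map_snd] at h
  have h' : (3⁻¹ : ℝ) • (3⁻¹ : ℝ) • entryMap k 2 (star (u * v)) =
      (3⁻¹ : ℝ) • (3⁻¹ : ℝ) • star (entryMap k 0 u * entryMap k 1 v) := by
    have e : ∀ x y : Octonion, star ((3⁻¹ : ℝ) • x * (3⁻¹ : ℝ) • y) =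
        (3⁻¹ : ℝ) • (3⁻¹ : ℝ) • star (x * y) := fun x y => by
      rw [smul_mul_assoc, mul_smul_comm, star_smul, star_smul]; simp
    rw [← e, ← map_smul, ← map_smul, ← map_smul]
    rw [← map_smul]
    simpa using h
  have h3 : (3⁻¹ : ℝ) ≠ 0 := by norm_num
  have key := smul_right_injective _ h3 (smul_right_injective _ h3 h')
  rw [smul_mul_assoc, mul_smul_comm, star_smul, star_smul, map_smul, map_smul, map_smul, map_smul,
    smul_mul_assoc, mul_smul_comm, star_smul, star_smul, key]

end Albert

/-! ### Complex subspaces of Hermitian matrices -/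

namespace Albert

open scoped Quaternion

theorem range_ofComplex (x : Octonion) : x ∈ Set.range ofComplex ↔
    x ∈ Submodule.span ℝ {1, ofComplex Complex.I} := by
  rw [Submodule.mem_span_pair]
  constructor
  · rintro ⟨z, rfl⟩
    exact ⟨z.re, z.im, by apply ext_components <;> simp [ofComplex]⟩
  · rintro ⟨a, b, rfl⟩
    exact ⟨⟨a, b⟩, by apply ext_components <;> simp [ofComplex]⟩

/-- A two-dimensional space of octonions that contains `1` is a copy of the complex numbers, and
can be moved to the standard one by an automorphism. -/
theorem exists_starHom_complex (U : Submodule ℝ Octonion) (hU : Module.finrank ℝ U = 2)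
    (h1 : (1 : Octonion) ∈ U) : ∃ φ : Octonion →ₗ[ℝ] Octonion, IsStarHom φ ∧
      ∀ x, x ∈ U ↔ φ x ∈ Set.range ofComplex := by
  have hne1 : (1 : Octonion) ≠ 0 := fun h => by
    have := dot_one_one; rw [h, dot_zero_left] at this; exact zero_ne_one this
  obtain ⟨x, hx, hx1⟩ : ∃ x ∈ U, x ∉ Submodule.span ℝ {(1 : Octonion)} := by
    by_contra! h
    have h2 := Submodule.finrank_mono (show U ≤ Submodule.span ℝ {(1 : Octonion)} from h)
    rw [hU, finrank_span_singleton hne1] at h2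
    omega
  have hy : x - re x • 1 ∈ U := U.sub_mem hx (U.smul_mem _ h1)
  obtain ⟨r, n, hn, hrn⟩ := exists_unit_smul (x - re x • 1)
  have hr : r ≠ 0 := by
    rintro rfl
    rw [zero_smul, sub_eq_zero] at hrn
    exact hx1 (Submodule.mem_span_singleton.2 ⟨_, hrn.symm⟩)
  have hnU : n ∈ U := by
    rw [hrn] at hy
    exact (U.smul_mem_iff hr).1 hy
  have hn0 : re n = 0 := by
    have := congrArg re hrn
    rw [re_sub, re_smul, re_one, re_smul, mul_one, sub_self] at this
    exact (mul_eq_zero.1 this.symm).resolve_left hr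
  obtain ⟨φ, hφ, hφn⟩ := exists_starHom_eq_I hn0 hn
  have hspan : Submodule.span ℝ {1, n} = U := by
    have hle : Submodule.span ℝ {1, n} ≤ U := by
      rw [Submodule.span_le]
      rintro y (rfl | rfl)
      exacts [h1, hnU]
    refine Submodule.eq_of_le_of_finrank_eq hle ?_
    have hli : LinearIndependent ℝ ![(1 : Octonion), n] := by
      rw [LinearIndependent.pair_iff]
      intro s t hst
      have hs : s = 0 := by
        have := congrArg re hst
        simpa [re_add, re_smul, hn0] using this
      have hnz : n ≠ 0 := fun h => by rw [h, dot_zero_left] at hn; exact zero_ne_one hn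
      rw [hs, zero_smul, zero_add, smul_eq_zero] at hst
      exact ⟨hs, hst.resolve_right hnz⟩
    have := finrank_span_eq_card hli
    rw [Matrix.range_cons, Matrix.range_cons, Matrix.range_empty, Set.union_empty,
      Set.singleton_union, Fintype.card_fin] at this
    rw [hU, this]
  refine ⟨φ, hφ, fun y => ?_⟩
  rw [range_ofComplex, ← hspan, ← SetLike.mem_coe, ← hφ.injective.mem_set_image,
    ← Submodule.map_coe, Submodule.map_span, Set.image_pair, hφ.map_one]
  rcases hφn with h | h <;> rw [h]
  · rfl
  · rw [SetLike.mem_coe, Submodule.mem_span_pair, Submodule.mem_span_pair]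
    constructor
    · rintro ⟨a, b, h⟩; exact ⟨a, -b, by rw [← h, neg_smul, smul_neg]⟩
    · rintro ⟨a, b, h⟩; exact ⟨a, -b, by rw [← h, neg_smul, smul_neg, neg_neg]⟩

/-- Automorphisms of the octonions act on matrices entrywise. -/
theorem exists_aut_of_starHom {φ : Octonion →ₗ[ℝ] Octonion} (hφ : IsStarHom φ) :
    ∃ k : autGroup, ∀ X i, (k.1 X).2 i = φ (X.2 i) := by
  obtain ⟨k, hk⟩ := exists_aut
    { toFun := fun X => (X.1, fun i => φ (X.2 i))
      map_add' := fun X Y => Prod.ext rfl (funext fun i => map_add φ _ _)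
      map_smul' := fun r X => Prod.ext rfl (funext fun i => map_smul φ _ _) }
    (fun X => rfl) (fun X => Prod.ext
      (funext fun i => by
        change _ - dot (φ (X.2 i)) (φ (X.2 i)) = _
        rw [hφ.dot_self]; rfl)
      (funext fun i => by
        change star (φ (X.2 (i + 1)) * φ (X.2 (i + 2))) - X.1 i • φ (X.2 i) =
          φ (star (X.2 (i + 1) * X.2 (i + 2)) - X.1 i • X.2 i)
        rw [map_sub, hφ.map_star, hφ.map_mul, map_smul]))
  exact ⟨k, fun X i => by rw [hk]; rfl⟩

/-- A triple of two-dimensional spaces of octonions closed under `(x, y) ↦ conj (x y)` such that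
the first two contain `1` can be moved to the standard complex numbers. -/
theorem exists_aut_complex_of_one_mem (U : Fin 3 → Submodule ℝ Octonion)
    (hU : ∀ i, Module.finrank ℝ (U i) = 2)
    (hmul : ∀ x ∈ U 0, ∀ y ∈ U 1, star (x * y) ∈ U 2) (h0 : (1 : Octonion) ∈ U 0)
    (h1 : (1 : Octonion) ∈ U 1) :
    ∃ k : autGroup, ∀ X : Albert, (∀ i, X.2 i ∈ U i) ↔ ∀ i, (k.1 X).2 i ∈ Set.range ofComplex := by
  have hstar : ∀ V W : Submodule ℝ Octonion, Module.finrank ℝ V = 2 → Module.finrank ℝ W = 2 →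
      (1 : Octonion) ∈ V → (∀ x ∈ V, star x ∈ W) → V = W := by
    intro V W hV hW h1 h
    have hs : ∀ x ∈ V, star x ∈ V := fun x hx => by
      rw [star_eq_sub]; exact V.sub_mem (V.smul_mem _ h1) hx
    refine Submodule.eq_of_le_of_finrank_eq (fun x hx => ?_) (hV.trans hW.symm)
    have := h _ (hs x hx)
    rwa [star_star] at this
  have e0 : U 0 = U 2 := hstar _ _ (hU 0) (hU 2) h0 fun x hx => by
    simpa using hmul x hx 1 h1
  have e1 : U 1 = U 2 := hstar _ _ (hU 1) (hU 2) h1 fun x hx => by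
    simpa using hmul 1 h0 x hx
  obtain ⟨φ, hφ, hφU⟩ := exists_starHom_complex (U 2) (hU 2) (e0 ▸ h0)
  obtain ⟨k, hk⟩ := exists_aut_of_starHom hφ
  refine ⟨k, fun X => forall_congr' fun i => ?_⟩
  rw [hk, ← hφU]
  fin_cases i
  · simp only [Fin.zero_eta, e0]
  · simp only [Fin.mk_one, e1]
  · rfl

/-- For every octonion `y` there is an imaginary unit `v` such that `v * y` is imaginary. -/
theorem exists_imaginary_factor (y : Octonion) :
    ∃ v : Octonion, re v = 0 ∧ dot v v = 1 ∧ re (v * y) = 0 := by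
  by_cases h : y.fst.imI = 0
  · exact ⟨⟨quat 0 1 0 0, 0⟩, rfl, by simp [dot_eq], by simp [re, h]⟩
  · have hN : 0 < y.fst.imI ^ 2 + y.fst.imJ ^ 2 := by
      have := sq_pos_of_ne_zero h
      positivity
    set N := y.fst.imI ^ 2 + y.fst.imJ ^ 2
    have hr : Real.sqrt N ^ 2 = N := Real.sq_sqrt hN.le
    have hr0 : Real.sqrt N ≠ 0 := (Real.sqrt_pos.2 hN).ne'
    refine ⟨(Real.sqrt N)⁻¹ • ⟨quat 0 (-y.fst.imJ) y.fst.imI 0, 0⟩, by simp [re], ?_, ?_⟩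
    · rw [dot_smul_left, dot_smul_right, ← mul_assoc, ← sq, inv_pow, hr,
        inv_mul_eq_iff_eq_mul₀ hN.ne']
      simp [dot_eq, N]; ring
    · rw [smul_mul_assoc, re_smul]
      simp [re]; ring_nf; tauto

/-- A triple of two-dimensional spaces of octonions closed under `(x, y) ↦ conj (x y)` can be moved
to the standard complex numbers: the first two spaces can be made to contain `1`. -/
theorem exists_aut_complex_of_mul (U : Fin 3 → Submodule ℝ Octonion)
    (hU : ∀ i, Module.finrank ℝ (U i) = 2)
    (hmul : ∀ x ∈ U 0, ∀ y ∈ U 1, star (x * y) ∈ U 2) :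
    ∃ k : autGroup, ∀ X : Albert, (∀ i, X.2 i ∈ U i) ↔ ∀ i, (k.1 X).2 i ∈ Set.range ofComplex := by
  have hunit : ∀ i, ∃ u ∈ U i, dot u u = 1 := by
    intro i
    have hne : U i ≠ ⊥ := fun h => by
      have := hU i; rw [h, finrank_bot] at this; omega
    obtain ⟨x, hx, hx0⟩ := Submodule.exists_mem_ne_zero_of_ne_bot hne
    obtain ⟨r, u, hu, rfl⟩ := exists_unit_smul x
    exact ⟨u, ((U i).smul_mem_iff (fun h => hx0 (by rw [h, zero_smul]))).1 hx, hu⟩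
  obtain ⟨a, haU, ha⟩ := hunit 0
  obtain ⟨b, hbU, hb⟩ := hunit 1
  suffices h : ∃ k : autGroup, FixesFrame k ∧ entryMap k 0 a = 1 ∧ entryMap k 1 b = 1 by
    obtain ⟨k, hk, hka, hkb⟩ := h
    obtain ⟨l, hl⟩ := exists_aut_complex_of_one_mem (fun i => (U i).map (entryMap k i))
      (fun i => by
        rw [← (Submodule.equivMapOfInjective _ (hk.entryMap_injective i) (U i)).finrank_eq, hU])
      (by
        rintro _ ⟨x, hx, rfl⟩ _ ⟨y, hy, rfl⟩
        exact ⟨_, hmul x hx y hy, hk.entryMap_mul x y⟩)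
      ⟨a, haU, hka⟩ ⟨b, hbU, hkb⟩
    refine ⟨l * k, fun X => ?_⟩
    rw [coe_mul_apply, ← hl]
    refine forall_congr' fun i => ?_
    rw [hk.map_snd]
    exact ((hk.entryMap_injective i).mem_set_image (s := (U i : Set Octonion))).symm
  -- left multiplication by the conjugate of `a` in position `0`
  obtain ⟨k, hk⟩ := exists_aut_unit (star a) (by rw [dot_star_star, ha])
  have hkf : FixesFrame k := fixesFrame_of_map_fst fun X => (hk X).1
  have hk0 : entryMap k 0 a = 1 := by
    rw [entryMap_apply, (hk _).2.1, inj_snd, Pi.single_eq_same, star_mul_self_eq, ha, one_smul]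
  set y := entryMap k 1 b with hy
  have hyy : dot y y = 1 := by rw [hy, hkf.dot_entryMap, hb]
  have hrot : ∀ v : Octonion, dot v v = 1 → ∃ k : autGroup, FixesFrame k ∧
      (∀ x, entryMap k 0 x = (star v * x) * star v) ∧ ∀ x, entryMap k 1 x = v * x := by
    intro v hv
    obtain ⟨k, hk⟩ := exists_aut_unit v hv
    have hkf : FixesFrame k := fixesFrame_of_map_fst fun X => (hk X).1
    have e : ∀ i x, (shift⁻¹ * k * shift).1 (inj (i + 1) x) = inj (i + 1) (entryMap k i x) := by
      intro i x
      rw [coe_mul_apply, coe_mul_apply, shift_inj, hkf.map_inj, shift_inv_inj]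
    refine ⟨shift⁻¹ * k * shift, fun i => ?_, fun x => ?_, fun x => ?_⟩
    · have : (shift⁻¹ * k * shift).1 (E (i + 2 + 1)) = E (i + 2 + 1) := by
        rw [coe_mul_apply, coe_mul_apply, shift_E, hkf, shift_inv_E]
      rwa [show i + 2 + 1 = i by fin_cases i <;> rfl] at this
    · have := e 2 x
      rw [entryMap_apply]
      change ((shift⁻¹ * k * shift).1 (inj (2 + 1) x)).2 (2 + 1) = _
      rw [this, inj_snd, Pi.single_eq_same, entryMap_apply, (hk _).2.2.2, inj_snd,
        Pi.single_eq_same]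
    · have := e 0 x
      rw [entryMap_apply]
      change ((shift⁻¹ * k * shift).1 (inj (0 + 1) x)).2 (0 + 1) = _
      rw [this, inj_snd, Pi.single_eq_same, entryMap_apply, (hk _).2.1, inj_snd,
        Pi.single_eq_same]
  have hcomp : ∀ k l : autGroup, FixesFrame k → FixesFrame l → ∀ i x,
      entryMap (l * k) i x = entryMap l i (entryMap k i x) := by
    intro k l hk hl i x
    rw [entryMap_apply, coe_mul_apply, hk.map_inj, entryMap_apply l]
  -- the imaginary units `v` and `v y` have squares `-1`, so the two sandwich maps cancel on `1`
  obtain ⟨v, hv0, hv1, hvy⟩ := exists_imaginary_factor y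
  have hvy1 : dot (star (v * y)) (star (v * y)) = 1 := by
    rw [dot_star_star, dot_mul_self, hv1, hyy, one_mul]
  obtain ⟨l, hlf, hl0, hl1⟩ := hrot v hv1
  obtain ⟨m, hmf, hm0, hm1⟩ := hrot (star (v * y)) hvy1
  have hsq : ∀ n : Octonion, re n = 0 → dot n n = 1 → star n * star n = -1 := fun n hn hn1 => by
    have h : star n = -n := by rw [star_eq_sub, hn, mul_zero, zero_smul, zero_sub]
    nth_rewrite 2 [h]
    rw [mul_neg, star_mul_self_eq, hn1, one_smul]
  refine ⟨m * (l * k), hmf.mul (hlf.mul hkf), ?_, ?_⟩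
  · rw [hcomp _ _ (hlf.mul hkf) hmf, hcomp _ _ hkf hlf, hk0, hl0, mul_one, hsq v hv0 hv1, hm0,
      star_star, mul_neg, mul_one, neg_mul]
    have := hsq (star (v * y)) (by rw [re_star, hvy]) hvy1
    rw [star_star] at this
    rw [this, neg_neg]
  · rw [hcomp _ _ (hlf.mul hkf) hmf, hcomp _ _ hkf hlf, ← hy, hl1, hm1, star_mul_self_eq,
      ← dot_star_star, hvy1, one_smul]

/-- A nine-dimensional space of vectors fixed by automorphisms that fix the frame consists of the
matrices with off-diagonal entries in three spaces of octonions. If a cyclic permutation of the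
frame preserves it, these spaces have dimension two, and they can be moved to the complex numbers.
-/
theorem exists_aut_complex_of_frame (S : Set autGroup) (hS : ∀ k ∈ S, FixesFrame k)
    (C : Submodule ℝ Albert) (hC : ∀ X, X ∈ C ↔ ∀ k ∈ S, k.1 X = X)
    (hrank : Module.finrank ℝ C = 9) (τ : autGroup) (hτ : ∀ i, τ.1 (E i) = E (i + 1))
    (hτC : ∀ X ∈ C, τ.1 X ∈ C) :
    ∃ k : autGroup, ∀ X, X ∈ C ↔ ∀ i, (k.1 X).2 i ∈ Set.range ofComplex := by
  set U : Fin 3 → Submodule ℝ Octonion := fun i => C.comap (inj i)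
  have hE : ∀ i, E i ∈ C := fun i => (hC _).2 fun k hk => hS k hk i
  have hmem : ∀ X, X ∈ C ↔ ∀ i, X.2 i ∈ U i := by
    refine fun X => ⟨fun hX i => (hC _).2 fun k hk => ?_, fun hX => ?_⟩
    · rw [(hS k hk).map_inj, ← (hS k hk).map_snd, (hC X).1 hX k hk]
    · rw [eq_sum X]
      exact C.add_mem (C.add_mem (C.add_mem (C.smul_mem _ (hE 0)) (C.smul_mem _ (hE 1)))
        (C.smul_mem _ (hE 2))) (C.add_mem (C.add_mem (hX 0) (hX 1)) (hX 2))
  have hle : ∀ i, Module.finrank ℝ (U i) ≤ Module.finrank ℝ (U (i + 1)) := by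
    intro i
    have hf : FixesFrame (shift * τ) := fun j => by rw [coe_mul_apply, hτ, shift_E]
    have hmaps : ∀ x ∈ U i, entryMap (shift * τ) i x ∈ U (i + 1) := fun x hx => by
      have h1 := hτC _ hx
      have h2 := hf.map_inj i x
      rw [coe_mul_apply] at h2
      have h3 := congrArg (shift⁻¹).1 h2
      rw [coe_inv_apply_self, shift_inv_inj] at h3
      rwa [h3] at h1
    exact LinearMap.finrank_le_finrank_of_injective
      (f := (entryMap (shift * τ) i).restrict hmaps)
      (fun x y h => Subtype.ext (hf.entryMap_injective i (congrArg Subtype.val h)))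
  let e : C ≃ₗ[ℝ] (Fin 3 → ℝ) × (U 0 × U 1 × U 2) :=
    { toFun := fun X => (X.1.1, ⟨X.1.2 0, (hmem _).1 X.2 0⟩, ⟨X.1.2 1, (hmem _).1 X.2 1⟩,
        ⟨X.1.2 2, (hmem _).1 X.2 2⟩)
      map_add' := fun _ _ => rfl
      map_smul' := fun _ _ => rfl
      invFun := fun p => ⟨(p.1, ![p.2.1, p.2.2.1, p.2.2.2]), (hmem _).2 fun i => by
        fin_cases i
        exacts [p.2.1.2, p.2.2.1.2, p.2.2.2.2]⟩
      left_inv := fun X => Subtype.ext (ext3 rfl rfl rfl rfl rfl rfl)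
      right_inv := fun p => rfl }
  have hdim := e.finrank_eq
  rw [hrank, Module.finrank_prod, Module.finrank_prod, Module.finrank_prod,
    Module.finrank_fin_fun] at hdim
  have l0 := hle 0
  have l1 := hle 1
  have l2 := hle 2
  simp at l0 l1 l2
  obtain ⟨k, hk⟩ := exists_aut_complex_of_mul U
    (fun i => by fin_cases i <;> simp <;> omega)
    (fun x hx y hy => (hC _).2 fun k hk => by
      have hx' := (hC _).1 hx k hk
      have hy' := (hC _).1 hy k hk
      have hkf := hS k hk
      have ex : entryMap k 0 x = x := by rw [entryMap_apply, hx', inj_snd, Pi.single_eq_same]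
      have ey : entryMap k 1 y = y := by rw [entryMap_apply, hy', inj_snd, Pi.single_eq_same]
      rw [hkf.map_inj, hkf.entryMap_mul, ex, ey])
  exact ⟨k, fun X => (hmem X).trans (hk X)⟩

end Albert

/-! ### Isometries and automorphisms -/

namespace Albert

/-- The coordinates of a matrix. -/
noncomputable def coord (A : Matrix (Fin 3) (Fin 3) Octonion) : Albert :=
  (fun i => re (A i i), fun i => A (i + 1) (i + 2))

/-- The Hermitian matrix with the given coordinates. -/
noncomputable def toMatrix (X : Albert) : Matrix (Fin 3) (Fin 3) Octonion :=
  !![X.1 0 • 1, X.2 2, star (X.2 1); star (X.2 2), X.1 1 • 1, X.2 0;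
    X.2 1, star (X.2 0), X.1 2 • 1]

theorem coord_toMatrix (X : Albert) : coord (toMatrix X) = X := by
  refine ext3 ?_ ?_ ?_ ?_ ?_ ?_ <;> simp [coord, toMatrix, re_smul]

theorem toMatrix_coord {A : Matrix (Fin 3) (Fin 3) Octonion} (hA : A.IsHermitian) :
    toMatrix (coord A) = A := by
  have h : ∀ i j, star (A i j) = A j i := fun i j => hA.apply j i
  have hd : ∀ i, re (A i i) • (1 : Octonion) = A i i := fun i =>
    (star_eq_self_iff.1 (h i i)).symm
  ext1 i j
  fin_cases i <;> fin_cases j <;> simp [coord, toMatrix, h, hd]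

theorem toMatrix_mem {X : Albert} (hX : X ∈ points) : toMatrix X ∈ projPlane Octonion := by
  have hs := sum_fst hX
  have d0 := dot_snd hX 0
  have d1 := dot_snd hX 1
  have d2 := dot_snd hX 2
  have m0 := smul_snd hX 0
  have m1 := smul_snd hX 1
  have m2 := smul_snd hX 2
  simp at d0 d1 d2
  have e0 : star (X.2 1 * X.2 2) = X.1 0 • X.2 0 := m0.symm
  have e1 : star (X.2 2 * X.2 0) = X.1 1 • X.2 1 := m1.symm
  have e2 : star (X.2 0 * X.2 1) = X.1 2 • X.2 2 := m2.symm
  have f0 : X.2 1 * X.2 2 = X.1 0 • star (X.2 0) := by rw [← star_star (X.2 1 * X.2 2), e0]; simp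
  have f1 : X.2 2 * X.2 0 = X.1 1 • star (X.2 1) := by rw [← star_star (X.2 2 * X.2 0), e1]; simp
  have f2 : X.2 0 * X.2 1 = X.1 2 • star (X.2 2) := by rw [← star_star (X.2 0 * X.2 1), e2]; simp
  rw [star_mul] at e0 e1 e2
  have c0 : X.1 0 = 1 - X.1 1 - X.1 2 := by linarith
  refine ⟨?_, ?_, ?_⟩
  · ext1 i j
    fin_cases i <;> fin_cases j <;> simp [toMatrix]
  · ext1 i j
    fin_cases i <;> fin_cases j <;>
    simp [toMatrix, Matrix.mul_apply, Fin.sum_univ_three, e0, e1, e2, f0, f1, f2, mul_star_self,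
      star_mul_self_eq, d0, d1, d2, c0] <;> module
  · simp only [toMatrix, Matrix.trace, Fin.sum_univ_three]
    simp [← add_smul, hs]

theorem coord_mem {A : Matrix (Fin 3) (Fin 3) Octonion} (hA : A ∈ projPlane Octonion) :
    coord A ∈ points := by
  obtain ⟨h1, h2, h3⟩ := hA
  rw [← toMatrix_coord h1] at h2 h3
  generalize coord A = X at h2 h3
  have ht : X.1 0 + X.1 1 + X.1 2 = 1 := by
    have := congrArg re h3
    simpa [toMatrix, Matrix.trace, Fin.sum_univ_three, re_add, re_smul] using this
  have key : ∀ i j, (toMatrix X * toMatrix X) i j = toMatrix X i j := fun i j => by rw [h2]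
  have k0 := congrArg re (key 0 0)
  have k1 := congrArg re (key 1 1)
  have k2 := congrArg re (key 2 2)
  have l0 := key 1 2
  have l1 := key 2 0
  have l2 := key 0 1
  simp [toMatrix, Matrix.mul_apply, Fin.sum_univ_three, mul_star_self, star_mul_self_eq, re_add,
    re_smul] at k0 k1 k2
  simp [toMatrix, Matrix.mul_apply, Fin.sum_univ_three] at l0 l1 l2
  have c0 : X.1 0 = 1 - X.1 1 - X.1 2 := by linarith
  rw [c0] at k0
  refine ⟨ht, ext3 ?_ ?_ ?_ ?_ ?_ ?_⟩
  · rw [sharp_fst_zero]; change _ = (0 : ℝ)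
    linear_combination (-1/2) * k1 - (1/2) * k2 + (1/2) * k0
  · rw [sharp_fst_one]; change _ = (0 : ℝ)
    rw [c0]
    linear_combination (-1/2) * k0 - (1/2) * k2 + (1/2) * k1
  · rw [sharp_fst_two]; change _ = (0 : ℝ)
    rw [c0]
    linear_combination (-1/2) * k0 - (1/2) * k1 + (1/2) * k2
  · rw [sharp_snd_zero, star_mul, c0]
    refine (sub_eq_zero.2 l0).symm.trans ?_ |>.symm
    module
  · rw [sharp_snd_one, star_mul, show X.1 1 = 1 - X.1 0 - X.1 2 by linarith]
    refine (sub_eq_zero.2 l1).symm.trans ?_ |>.symm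
    module
  · rw [sharp_snd_two, star_mul, show X.1 2 = 1 - X.1 0 - X.1 1 by linarith]
    refine (sub_eq_zero.2 l2).symm.trans ?_ |>.symm
    module

theorem coord_injective : Function.Injective fun P : OP2 => coord P.1 := fun P Q h =>
  Subtype.ext (by rw [← toMatrix_coord P.2.1, ← toMatrix_coord Q.2.1]; exact congrArg toMatrix h)

theorem exists_coord_eq {X : Albert} (hX : X ∈ points) : ∃ P : OP2, coord P.1 = X :=
  ⟨⟨toMatrix X, toMatrix_mem hX⟩, coord_toMatrix X⟩

theorem re_trace_mul (P Q : OP2) : re (P.1 * Q.1).trace = ip (coord P.1) (coord Q.1) := by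
  rw [← toMatrix_coord P.2.1, ← toMatrix_coord Q.2.1, coord_toMatrix, coord_toMatrix]
  generalize coord P.1 = X
  generalize coord Q.1 = Y
  have h : ∀ x y : Octonion, re (x * star y) = dot x y := fun _ _ => rfl
  have h' : ∀ x y : Octonion, re (star x * y) = dot x y := fun x y => by
    rw [re_mul_eq, dot_star_star]
  simp [toMatrix, Matrix.trace, Fin.sum_univ_three, re_add, re_smul, h, h', ip]
  ring

theorem fubiniStudyDist_eq_iff (P Q R S : OP2) : fubiniStudyDist P Q = fubiniStudyDist R S ↔
    ip (coord P.1) (coord Q.1) = ip (coord R.1) (coord S.1) := by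
  rw [fubiniStudyDist, fubiniStudyDist, re_trace_mul, re_trace_mul]
  have hmem : ∀ P Q : OP2, √(ip (coord P.1) (coord Q.1)) ∈ Set.Icc (-1 : ℝ) 1 := fun P Q =>
    ⟨by linarith [Real.sqrt_nonneg (ip (coord P.1) (coord Q.1))],
      Real.sqrt_le_one.2 (ip_le_one (coord_mem P.2) (coord_mem Q.2))⟩
  rw [Real.arccos_injOn.eq_iff (hmem P Q) (hmem R S),
    Real.sqrt_inj (ip_nonneg (coord_mem P.2) (coord_mem Q.2))
      (ip_nonneg (coord_mem R.2) (coord_mem S.2))]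

theorem span_range_coord : Submodule.span ℝ (Set.range fun P : OP2 => coord P.1) = ⊤ := by
  rw [← span_points]
  congr 1
  ext X
  exact ⟨fun ⟨P, hP⟩ => hP ▸ coord_mem P.2, fun hX => exists_coord_eq hX⟩

/-- Every isometry of the projective plane is the restriction of a unique automorphism: it
preserves inner products of points, which determine all linear relations among them. -/
theorem exists_aut_of_isom (f : IsomOP2) :
    ∃ k : autGroup, ∀ P : OP2, k.1 (coord P.1) = coord (f.1 P).1 := by
  let c : OP2 → Albert := fun P => coord P.1
  have hf : ∀ P Q, ip (c (f.1 P)) (c (f.1 Q)) = ip (c P) (c Q) := fun P Q =>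
    (fubiniStudyDist_eq_iff _ _ _ _).1 (f.2 P Q)
  let φ : (OP2 →₀ ℝ) →ₗ[ℝ] Albert := Finsupp.linearCombination ℝ c
  let ψ : (OP2 →₀ ℝ) →ₗ[ℝ] Albert := Finsupp.linearCombination ℝ (fun P => c (f.1 P))
  have hφ : Function.Surjective φ := by
    rw [← LinearMap.range_eq_top, Finsupp.range_linearCombination]
    exact span_range_coord
  have hform : ipForm.compl₁₂ ψ ψ = ipForm.compl₁₂ φ φ := by
    ext P Q
    simp [φ, ψ, ipForm_apply, hf]
  have hip : ∀ v w, ip (ψ v) (ψ w) = ip (φ v) (φ w) := fun v w =>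
    LinearMap.congr_fun₂ hform v w
  have hker : ∀ v, φ v = 0 → ψ v = 0 := fun v hv => by
    rw [← ip_self_eq_zero, hip, hv, ip_self_eq_zero]
  obtain ⟨g, hg⟩ := φ.exists_rightInverse_of_surjective (LinearMap.range_eq_top.2 hφ)
  have hT : ∀ v, ψ (g (φ v)) = ψ v := fun v => by
    rw [← sub_eq_zero, ← map_sub]
    apply hker
    rw [map_sub, sub_eq_zero]
    exact LinearMap.congr_fun hg (φ v)
  set T := ψ ∘ₗ g with hTdef
  have hTc : ∀ P, T (c P) = c (f.1 P) := fun P => by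
    have := hT (Finsupp.single P 1)
    have e1 : φ (Finsupp.single P 1) = c P := by simp [φ]
    have e2 : ψ (Finsupp.single P 1) = c (f.1 P) := by simp [ψ]
    rw [e1, e2] at this
    exact this
  have hTip : ∀ X Y, ip (T X) (T Y) = ip X Y := fun X Y => by
    obtain ⟨v, rfl⟩ := hφ X
    obtain ⟨w, rfl⟩ := hφ Y
    rw [hTdef, LinearMap.comp_apply, LinearMap.comp_apply, hT, hT, hip]
  have hinj : Function.Injective T := by
    refine (injective_iff_map_eq_zero T).2 fun X hX => ?_
    rw [← ip_self_eq_zero, ← hTip, hX, ip_self_eq_zero]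
  refine ⟨⟨LinearEquiv.ofInjectiveEndo T hinj, fun X => ⟨fun hX => ?_, fun hX => ?_⟩, hTip⟩, hTc⟩
  · obtain ⟨Q, hQ⟩ := exists_coord_eq hX
    have h : T X = T (c (f.1.symm Q)) := by
      rw [hTc, Equiv.apply_symm_apply]; exact hQ.symm
    rw [hinj h]
    exact coord_mem (f.1.symm Q).2
  · obtain ⟨Q, rfl⟩ := exists_coord_eq hX
    change T (c Q) ∈ points
    rw [hTc]
    exact coord_mem (f.1 Q).2

theorem aut_ext {k l : autGroup} (h : ∀ P : OP2, k.1 (coord P.1) = l.1 (coord P.1)) : k = l := by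
  refine Subtype.ext (LinearEquiv.toLinearMap_injective (LinearMap.ext_on_range span_range_coord h))

/-- The linear extension of an isometry. -/
noncomputable def ofIsom : IsomOP2 →* autGroup where
  toFun f := (exists_aut_of_isom f).choose
  map_one' := aut_ext fun P => (exists_aut_of_isom 1).choose_spec P
  map_mul' f g := aut_ext fun P => by
    rw [(exists_aut_of_isom (f * g)).choose_spec, coe_mul_apply,
      (exists_aut_of_isom g).choose_spec, (exists_aut_of_isom f).choose_spec]
    rfl

theorem ofIsom_coord (f : IsomOP2) (P : OP2) : (ofIsom f).1 (coord P.1) = coord (f.1 P).1 :=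
  (exists_aut_of_isom f).choose_spec P

theorem ofIsom_injective : Function.Injective ofIsom := fun f g h => by
  refine Subtype.ext (Equiv.ext fun P => coord_injective ?_)
  change coord (f.1 P).1 = coord (g.1 P).1
  rw [← ofIsom_coord, ← ofIsom_coord, h]

/-- Every automorphism restricts to an isometry of the projective plane. -/
theorem exists_isom_of_aut (k : autGroup) :
    ∃ f : IsomOP2, ∀ P : OP2, coord (f.1 P).1 = k.1 (coord P.1) := by
  have h : ∀ k : autGroup, ∃ f : OP2 → OP2, ∀ P, coord (f P).1 = k.1 (coord P.1) := fun k =>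
    Classical.axiom_of_choice fun P => exists_coord_eq ((mem_points_iff k).2 (coord_mem P.2))
  obtain ⟨f, hf⟩ := h k
  obtain ⟨g, hg⟩ := h k⁻¹
  refine ⟨⟨⟨f, g, fun P => coord_injective ?_, fun P => coord_injective ?_⟩, fun P Q => ?_⟩, hf⟩
  · change coord (g (f P)).1 = coord P.1
    rw [hg, hf, coe_inv_apply_self]
  · change coord (f (g P)).1 = coord P.1
    rw [hf, hg, coe_apply_inv_self]
  · rw [fubiniStudyDist_eq_iff]
    change ip (coord (f P).1) (coord (f Q).1) = _
    rw [hf, hf, ip_map]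

theorem mem_standardCP2 (P : OP2) :
    P ∈ standardCP2 ↔ ∀ i, (coord P.1).2 i ∈ Set.range ofComplex := by
  constructor
  · rintro ⟨Q, rfl⟩ i
    exact ⟨Q.1 (i + 1) (i + 2), rfl⟩
  · intro h
    have hP : ∀ i j, ∃ z, ofComplex z = P.1 i j := by
      have hstar : ∀ x ∈ Set.range ofComplex, star x ∈ Set.range ofComplex := by
        rintro _ ⟨z, rfl⟩; exact ⟨star z, ofComplex_star z⟩
      have hreal : ∀ r : ℝ, r • (1 : Octonion) ∈ Set.range ofComplex := fun r =>
        (range_ofComplex _).2 (Submodule.smul_mem _ _ (Submodule.subset_span (Or.inl rfl)))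
      intro i j
      rw [← toMatrix_coord P.2.1]
      have h0 := h 0
      have h1 := h 1
      have h2 := h 2
      fin_cases i <;> fin_cases j
      exacts [hreal _, h2, hstar _ h1, hstar _ h2, hreal _, h0, h1, hstar _ h0, hreal _]
    choose Q hQ using hP
    have hinj : Function.Injective ofComplex := fun z w h => by
      have h1 := congrArg (fun x : Octonion => x.fst.re) h
      have h2 := congrArg (fun x : Octonion => x.fst.imI) h
      exact Complex.ext h1 h2
    have h0 : ofComplex 0 = 0 := by apply ext_components <;> simp [ofComplex]
    obtain ⟨p1, p2, p3⟩ := P.2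
    refine ⟨⟨Matrix.of Q, ?_, ?_, ?_⟩, Subtype.ext (Matrix.ext hQ)⟩
    · ext1 i j
      apply hinj
      rw [Matrix.conjTranspose_apply, ofComplex_star]
      simp only [Matrix.of_apply, hQ]
      exact p1.apply i j
    · ext1 i j
      apply hinj
      rw [Matrix.mul_apply, Fin.sum_univ_three, ofComplex_add, ofComplex_add, ofComplex_mul,
        ofComplex_mul, ofComplex_mul]
      simp only [Matrix.of_apply, hQ]
      have := congrFun (congrFun p2 i) j
      rwa [Matrix.mul_apply, Fin.sum_univ_three] at this
    · apply hinj
      rw [Matrix.trace, Fin.sum_univ_three, ofComplex_add, ofComplex_add, ofComplex_one]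
      simp only [Matrix.diag_apply, Matrix.of_apply, hQ]
      rwa [Matrix.trace, Fin.sum_univ_three] at p3

end Albert

/-! ### Dimensions of fixed spaces -/

namespace Albert

/-- The tautological representation of the group of automorphisms. -/
noncomputable def rep : Representation ℝ autGroup Albert where
  toFun k := k.1.toLinearMap
  map_one' := rfl
  map_mul' _ _ := rfl

/-- The subspace of vectors fixed by a set of automorphisms. -/
def fixedSpace (S : Set autGroup) : Submodule ℝ Albert where
  carrier := {X | ∀ k ∈ S, k.1 X = X}
  zero_mem' k _ := map_zero k.1
  add_mem' hX hY k hk := by rw [map_add, hX k hk, hY k hk]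
  smul_mem' r X hX k hk := by rw [map_smul, hX k hk]

theorem mem_fixedSpace {S : Set autGroup} {X : Albert} :
    X ∈ fixedSpace S ↔ ∀ k ∈ S, k.1 X = X := Iff.rfl

theorem finrank_albert : Module.finrank ℝ Albert = 27 := by
  rw [Module.finrank_prod, Module.finrank_pi_fintype, Module.finrank_pi_fintype]
  simp [Octonion.finrank_eq]

/-- The number of fixed vectors is the average of the character. -/
theorem card_mul_finrank_fixedSpace (W : Subgroup autGroup) [Fintype W] :
    (Nat.card W : ℝ) * Module.finrank ℝ (fixedSpace (W : Set autGroup)) =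
      ∑ w : W, rep.character w.1 := by
  set ρ : Representation ℝ W Albert := rep.comp W.subtype
  have h : (fixedSpace (W : Set autGroup)) = ρ.invariants := by
    ext X
    exact ⟨fun h w => h w.1 w.2, fun h k hk => h ⟨k, hk⟩⟩
  have hc : (Fintype.card W : ℝ) ≠ 0 := Nat.cast_ne_zero.2 Fintype.card_ne_zero
  let _ : Invertible (Fintype.card W : ℝ) := invertibleOfNonzero hc
  have ht := ρ.isProj_averageMap.trace
  rw [h, ← ht, Nat.card_eq_fintype_card]
  simp only [Representation.averageMap, GroupAlgebra.average, map_smul, map_sum,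
    MonoidAlgebra.of_apply, Representation.asAlgebraHom_single_one, smul_eq_mul]
  rw [← mul_assoc, mul_invOf_self, one_mul]
  rfl

/-- The fixed vectors of an element `k` with `k ^ 3 = 1` have even codimension: on their complement,
`2 k + 1` is a square root of `-3`, so that `(-3) ^ codim` is a square of a determinant. -/
theorem even_of_cube_eq_one {k : autGroup} (hk : k ^ 3 = 1) :
    Even (27 - Module.finrank ℝ (fixedSpace {k})) := by
  set T : Module.End ℝ Albert := rep k with hT
  have hT3 : T ^ 3 = 1 := by rw [hT, ← map_pow, hk, map_one]
  have hT3' : ∀ X, T (T (T X)) = X := fun X => by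
    have := LinearMap.congr_fun hT3 X
    simpa [pow_succ] using this
  set N : Module.End ℝ Albert := 1 + T + T ^ 2 with hN
  have hNa : ∀ X, N X = X + T X + T (T X) := fun X => by simp [hN, pow_succ]
  have hrange : LinearMap.range N = fixedSpace {k} := by
    ext X
    rw [mem_fixedSpace]
    constructor
    · rintro ⟨Y, rfl⟩ l rfl
      change T (N Y) = N Y
      rw [hNa, map_add, map_add, hT3']
      abel
    · intro h
      have h : T X = X := h k rfl
      refine ⟨(1 / 3 : ℝ) • X, ?_⟩
      rw [map_smul, hNa, h, h]
      module
  have hdim := LinearMap.finrank_range_add_finrank_ker N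
  rw [hrange, finrank_albert] at hdim
  have hsub : 27 - Module.finrank ℝ (fixedSpace {k}) = Module.finrank ℝ (LinearMap.ker N) := by
    omega
  rw [hsub]
  by_contra hodd
  have hmaps : ∀ X ∈ LinearMap.ker N, (2 • T + 1 : Module.End ℝ Albert) X ∈ LinearMap.ker N := by
    intro X hX
    rw [LinearMap.mem_ker] at hX ⊢
    have : N (T X) = T (N X) := by rw [hNa, hNa, map_add, map_add]
    simp only [LinearMap.add_apply, LinearMap.smul_apply, Module.End.one_apply, map_add, map_nsmul,
      this, hX, map_zero, smul_zero, add_zero]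
  set f := (2 • T + 1 : Module.End ℝ Albert).restrict hmaps
  have hf : f * f = (-3 : ℝ) • 1 := by
    ext1 X
    apply Subtype.ext
    have hX : N X.1 = 0 := X.2
    rw [hNa] at hX
    change (2 • T + 1 : Module.End ℝ Albert) ((2 • T + 1 : Module.End ℝ Albert) X.1) =
      (-3 : ℝ) • X.1
    simp only [LinearMap.add_apply, LinearMap.smul_apply, Module.End.one_apply, map_add]
    rw [map_nsmul, ← sub_eq_zero, ← smul_zero (4 : ℝ), ← hX]
    module
  have hdet := congrArg LinearMap.det hf
  rw [map_mul, LinearMap.det_smul, map_one, mul_one] at hdet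
  have := Odd.pow_neg (Nat.not_even_iff_odd.1 hodd) (show (-3 : ℝ) < 0 by norm_num)
  nlinarith [mul_self_nonneg (LinearMap.det f)]

/-- If all nontrivial elements of `A` are conjugate up to inversion, the dimensions of the fixed
spaces of its subgroups depend on a single number `s`, the value of the character on `k + k⁻¹`. -/
theorem exists_character_sum (A : Subgroup autGroup)
    (hconj : ∀ k ∈ A, ∀ l ∈ A, k ≠ 1 → l ≠ 1 →
      ∃ g : autGroup, g * k * g⁻¹ = l ∨ g * k * g⁻¹ = l⁻¹) :
    ∃ s : ℝ, ∀ W ≤ A, Finite W → 2 * ((Nat.card W : ℝ) *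
      Module.finrank ℝ (fixedSpace (W : Set autGroup))) = 54 + (Nat.card W - 1) * s := by
  classical
  have hchar : ∀ g k : autGroup, rep.character (g * k * g⁻¹) = rep.character k := fun g k =>
    rep.char_conj k g
  obtain ⟨s, hs⟩ : ∃ s : ℝ, ∀ k ∈ A, k ≠ 1 → rep.character k + rep.character k⁻¹ = s := by
    by_cases h : ∃ k ∈ A, k ≠ 1
    · obtain ⟨k, hk, hk1⟩ := h
      refine ⟨rep.character k + rep.character k⁻¹, fun l hl hl1 => ?_⟩
      obtain ⟨g, hg | hg⟩ := hconj k hk l hl hk1 hl1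
      · rw [← hg, hchar, ← hchar g k⁻¹]
        rw [mul_inv_rev, mul_inv_rev, inv_inv, mul_assoc]
      · have : l = g * k⁻¹ * g⁻¹ := by rw [← inv_inv l, ← hg]; group
        rw [← hg, hchar, this, hchar, add_comm]
    · push Not at h
      exact ⟨0, fun k hk hk1 => (hk1 (h k hk)).elim⟩
  refine ⟨s, fun W hW hfin => ?_⟩
  let _ := Fintype.ofFinite W
  rw [card_mul_finrank_fixedSpace W]
  have hinv : ∑ w : W, rep.character w.1 = ∑ w : W, rep.character (w.1)⁻¹ :=
    (Equiv.sum_comp (Equiv.inv W) fun w => rep.character w.1).symm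
  have h1 : rep.character (1 : autGroup) = 27 := by
    rw [Representation.char_one, finrank_albert]; rfl
  have h2 : ∀ w ∈ Finset.univ.erase (1 : W), rep.character w.1 + rep.character (w.1)⁻¹ = s :=
    fun w hw => hs _ (hW w.2) fun h => (Finset.mem_erase.1 hw).1 (Subtype.ext h)
  rw [two_mul]
  nth_rw 2 [hinv]
  rw [← Finset.sum_add_distrib, ← Finset.add_sum_erase _ _ (Finset.mem_univ 1),
    Finset.sum_congr rfl h2, Finset.sum_const, Finset.card_erase_of_mem (Finset.mem_univ _),
    Finset.card_univ, Nat.card_eq_fintype_card, nsmul_eq_mul,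
    Nat.cast_sub (Nat.one_le_iff_ne_zero.2 Fintype.card_ne_zero)]
  simp only [Subgroup.coe_one, inv_one, h1]
  norm_num

/-- The fixed spaces of subgroups of order `3`, `9`, `27` have dimensions `9`, `3`, `1`. Integrality
leaves the possibilities `1`, `14`, `27` for the dimension of the fixed space of `A`; the last one
contradicts faithfulness, and `14` would make the fixed space of an element of order three
`18`-dimensional, of odd codimension. -/
theorem card_mul_finrank_eq (A : Subgroup autGroup) (hA : Nat.card A = 27)
    (hA3 : ∀ k ∈ A, k ^ 3 = 1)
    (hconj : ∀ k ∈ A, ∀ l ∈ A, k ≠ 1 → l ≠ 1 →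
      ∃ g : autGroup, g * k * g⁻¹ = l ∨ g * k * g⁻¹ = l⁻¹)
    (W : Subgroup autGroup) (hW : W ≤ A) :
    Nat.card W * Module.finrank ℝ (fixedSpace (W : Set autGroup)) = 27 := by
  obtain ⟨s, hs⟩ := exists_character_sum A hconj
  have hAfin : Finite A := Nat.finite_of_card_ne_zero (by omega)
  have hWfin : Finite W := Finite.of_injective _ (Subgroup.inclusion_injective hW)
  obtain ⟨k, hk, hk1⟩ : ∃ k ∈ A, k ≠ 1 := by
    by_contra! h
    have : A = ⊥ := (Subgroup.eq_bot_iff_forall A).2 h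
    rw [this, Subgroup.card_bot] at hA
    omega
  set Z := Subgroup.zpowers k
  have hZA : Z ≤ A := (Subgroup.zpowers_le).2 hk
  have hZfin : Finite Z := Finite.of_injective _ (Subgroup.inclusion_injective hZA)
  have hZ : Nat.card Z = 3 := by
    have : Fact (Nat.Prime 3) := ⟨Nat.prime_three⟩
    rw [Nat.card_zpowers, orderOf_eq_prime (hA3 k hk) hk1]
  have hfix : fixedSpace (Z : Set autGroup) = fixedSpace {k} := by
    ext X
    rw [mem_fixedSpace, mem_fixedSpace]
    refine ⟨fun h l hl => h l (hl ▸ Subgroup.mem_zpowers k), fun h l hl => ?_⟩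
    have hle : Z ≤ (MulAction.stabilizer (Albert ≃ₗ[ℝ] Albert) X).comap autGroup.subtype :=
      Subgroup.zpowers_le.2 (h k rfl)
    exact hle hl
  have e3 := hs Z hZA hZfin
  have e27 := hs A le_rfl hAfin
  have hle : Module.finrank ℝ (fixedSpace (A : Set autGroup)) ≤ 27 :=
    finrank_albert ▸ Submodule.finrank_le _
  have hodd := even_of_cube_eq_one (hA3 k hk)
  rw [← hfix] at hodd
  have hnot : Module.finrank ℝ (fixedSpace (A : Set autGroup)) ≠ 27 := fun h => by
    rw [← finrank_albert] at h
    have htop := Submodule.eq_top_of_finrank_eq h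
    refine hk1 (Subtype.ext (LinearEquiv.ext fun X => ?_))
    exact (htop ▸ Submodule.mem_top : X ∈ fixedSpace (A : Set autGroup)) k hk
  rw [hZ] at e3
  rw [hA] at e27
  generalize hd3 : Module.finrank ℝ (fixedSpace (Z : Set autGroup)) = d at e3 hodd
  generalize Module.finrank ℝ (fixedSpace (A : Set autGroup)) = a at e27 hle hnot
  push_cast at e3 e27
  have hda : (13 : ℝ) * d = 108 + 9 * a := by linarith
  have hda' : 13 * d = 108 + 9 * a := by exact_mod_cast hda
  have ha : a = 1 := by
    rcases hodd with ⟨m, hm⟩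
    omega
  have hs0 : s = 0 := by rw [ha] at e27; push_cast at e27; linarith
  have := hs W hW hWfin
  rw [hs0] at this
  have h' : (Nat.card W : ℝ) * Module.finrank ℝ (fixedSpace (W : Set autGroup)) = 27 := by linarith
  exact_mod_cast h'

end Albert

/-! ### Fixed spaces of subgroups of order three -/

namespace Albert

/-- The subgroup of automorphisms fixing a vector. -/
def stab (X : Albert) : Subgroup autGroup where
  carrier := {k | k.1 X = X}
  mul_mem' {k l} hk hl := by
    change k.1 (l.1 X) = X
    rw [hl, hk]
  one_mem' := rfl
  inv_mem' {k} hk := by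
    change (k⁻¹).1 X = X
    nth_rw 1 [← (show k.1 X = X from hk)]
    exact coe_inv_apply_self k X

/-- Let `B ⊇ W` have order `9`. A non-scalar vector fixed by `B` yields a point `P` fixed by `B`,
and the sum of the three points in its orbit is fixed by `A`, so it is scalar. -/
theorem exists_frame (A : Subgroup autGroup) (hA : Nat.card A = 27)
    (hA3 : ∀ k ∈ A, k ^ 3 = 1) (hcomm : ∀ k ∈ A, ∀ l ∈ A, k * l = l * k)
    (hconj : ∀ k ∈ A, ∀ l ∈ A, k ≠ 1 → l ≠ 1 →
      ∃ g : autGroup, g * k * g⁻¹ = l ∨ g * k * g⁻¹ = l⁻¹)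
    (W : Subgroup autGroup) (hW : W ≤ A) (hW3 : Nat.card W = 3) :
    ∃ P ∈ points, (∀ k ∈ W, k.1 P = P) ∧ ∃ σ ∈ A, P + σ.1 P + σ.1 (σ.1 P) = one := by
  have hdim := card_mul_finrank_eq A hA hA3 hconj
  have hAfin : Finite A := Nat.finite_of_card_ne_zero (by omega)
  have : Fact (Nat.Prime 3) := ⟨Nat.prime_three⟩
  obtain ⟨B', hB', hWB'⟩ := Sylow.exists_subgroup_card_pow_prime_le 3 (n := 1) (m := 2)
    (by rw [hA]; norm_num) (W.subgroupOf A)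
    (by rw [Nat.card_congr (Subgroup.subgroupOfEquivOfLe hW).toEquiv, hW3]; norm_num)
    (by norm_num)
  set B : Subgroup autGroup := B'.map A.subtype
  have hBA : B ≤ A := Subgroup.map_subtype_le B'
  have hB : Nat.card B = 9 :=
    (Subgroup.card_map_of_injective A.subtype_injective).trans hB'
  have hWB : W ≤ B := fun w hw => ⟨⟨w, hW hw⟩, hWB' hw, rfl⟩
  have hBfin : Finite B := Nat.finite_of_card_ne_zero (by omega)
  have hdB := hdim B hBA
  have hdA := hdim A le_rfl
  rw [hB] at hdB
  rw [hA] at hdA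
  obtain ⟨X, hX, hX1⟩ : ∃ X ∈ fixedSpace (B : Set autGroup), ∀ r : ℝ, X ≠ r • one := by
    by_contra! h
    have hle : fixedSpace (B : Set autGroup) ≤ Submodule.span ℝ {one} := fun X hX => by
      obtain ⟨r, hr⟩ := h X hX
      exact Submodule.mem_span_singleton.2 ⟨r, hr.symm⟩
    have := (Submodule.finrank_mono hle).trans (finrank_span_le_card _)
    simp at this
    omega
  obtain ⟨P, hP, hPfix⟩ := exists_point_fixed hX1
  have hPB : ∀ k ∈ B, k.1 P = P := fun k hk => hPfix k (hX k hk)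
  obtain ⟨σ, hσA, hσB⟩ : ∃ σ ∈ A, σ ∉ B := by
    by_contra! h
    have : A = B := le_antisymm h hBA
    rw [this] at hA
    omega
  refine ⟨P, hP, fun k hk => hPB k (hWB hk), σ, hσA, ?_⟩
  set Y := P + σ.1 P + σ.1 (σ.1 P)
  have hB3 : B ≤ A ⊓ stab Y := fun k hk => ⟨hBA hk, by
    have h := hPB k hk
    have h' : ∀ Z, k.1 (σ.1 Z) = σ.1 (k.1 Z) := fun Z => by
      rw [← coe_mul_apply, hcomm k (hBA hk) σ hσA, coe_mul_apply]
    change k.1 Y = Y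
    rw [map_add, map_add, h', h', h', h]⟩
  have hσ3 : σ.1 (σ.1 (σ.1 P)) = P := by
    have : (σ ^ 3).1 P = P := by rw [hA3 σ hσA]; rfl
    rwa [pow_succ, pow_two, coe_mul_apply, coe_mul_apply] at this
  have hσY : σ ∈ A ⊓ stab Y := ⟨hσA, by
    change σ.1 Y = Y
    rw [map_add, map_add, hσ3]
    change _ = P + σ.1 P + σ.1 (σ.1 P)
    abel⟩
  -- the stabilizer of `Y` in `A` is larger than `B`, which has index three
  have hstab : A ⊓ stab Y = A := by
    have hfin : Finite (A ⊓ stab Y : Subgroup autGroup) :=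
      Finite.of_injective _ (Subgroup.inclusion_injective inf_le_left)
    refine Subgroup.eq_of_le_of_card_ge inf_le_left ?_
    have h1 : Nat.card (A ⊓ stab Y : Subgroup autGroup) ∣ 27 :=
      hA ▸ Subgroup.card_dvd_of_le inf_le_left
    have h2 : 9 ∣ Nat.card (A ⊓ stab Y : Subgroup autGroup) := hB ▸ Subgroup.card_dvd_of_le hB3
    have h3 : Nat.card (A ⊓ stab Y : Subgroup autGroup) ≠ 9 := fun h => by
      have := Subgroup.eq_of_le_of_card_ge hB3 (by omega)
      exact hσB (this ▸ hσY)
    obtain ⟨m, hm⟩ := h2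
    obtain ⟨n, hn⟩ := h1
    rw [hm] at hn h3 ⊢
    have h4 : m * n = 3 := by rw [mul_assoc] at hn; omega
    have h5 : m ∣ 3 := ⟨n, h4.symm⟩
    rcases (Nat.dvd_prime Nat.prime_three).1 h5 with rfl | rfl
    · omega
    · omega
  have hYA : Y ∈ fixedSpace (A : Set autGroup) := fun k hk => (hstab.ge hk).2
  have hone : (one : Albert) ≠ 0 := fun h => by
    have := congrFun (congrArg Prod.fst h) 0
    exact one_ne_zero this
  have hspan : Submodule.span ℝ {one} = fixedSpace (A : Set autGroup) := by
    refine Submodule.eq_of_le_of_finrank_le ?_ ?_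
    · rw [Submodule.span_singleton_le_iff_mem]
      exact fun k _ => map_identity k
    · rw [finrank_span_singleton hone]
      omega
  obtain ⟨r, hr⟩ := Submodule.mem_span_singleton.1 (hspan ▸ hYA)
  have htr : ip one Y = 3 := by
    have h1 := hP.1
    have h2 := ((mem_points_iff σ).2 hP).1
    have h3 := ((mem_points_iff σ).2 ((mem_points_iff σ).2 hP)).1
    rw [← ip_one] at h1 h2 h3
    rw [ip_add_right, ip_add_right, h1, h2, h3]
    norm_num
  rw [← hr, ip_comm, ip_smul_left, ip_one] at htr
  have hr1 : r = 1 := by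
    have : tr one = 3 := by norm_num [tr, one]
    rw [this] at htr
    linarith
  rw [← hr, hr1, one_smul]

/-- The fixed space of a subgroup of order three is the space of complex Hermitian matrices, up to
an automorphism: the points of an orbit given by `exists_frame` are orthogonal, since their inner
products are nonnegative, and can be moved to the standard frame. -/
theorem exists_aut_complex (A : Subgroup autGroup) (hA : Nat.card A = 27)
    (hA3 : ∀ k ∈ A, k ^ 3 = 1) (hcomm : ∀ k ∈ A, ∀ l ∈ A, k * l = l * k)
    (hconj : ∀ k ∈ A, ∀ l ∈ A, k ≠ 1 → l ≠ 1 →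
      ∃ g : autGroup, g * k * g⁻¹ = l ∨ g * k * g⁻¹ = l⁻¹)
    (W : Subgroup autGroup) (hW : W ≤ A) (hW3 : Nat.card W = 3) :
    ∃ k : autGroup, ∀ X, X ∈ fixedSpace (W : Set autGroup) ↔
      ∀ i, (k.1 X).2 i ∈ Set.range ofComplex := by
  obtain ⟨P, hP, hPW, σ, hσA, hsum⟩ := exists_frame A hA hA3 hcomm hconj W hW hW3
  have hdim := card_mul_finrank_eq A hA hA3 hconj W hW
  have hσP := (mem_points_iff σ).2 hP
  have hσσP := (mem_points_iff σ).2 hσP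
  have horth : ip P (σ.1 P) = 0 := by
    have h := congrArg (ip P) hsum
    have h1 := ip_nonneg hP hσP
    have h2 := ip_nonneg hP hσσP
    rw [ip_add_right, ip_add_right, ip_self_of_mem hP, ip_comm P one, ip_one, hP.1] at h
    linarith
  have hσ3 : σ.1 (σ.1 (σ.1 P)) = P := by
    have : (σ ^ 3).1 P = P := by rw [hA3 σ hσA]; rfl
    rwa [pow_succ, pow_two, coe_mul_apply, coe_mul_apply] at this
  have hWσ : ∀ w ∈ W, ∀ Z, w.1 (σ.1 Z) = σ.1 (w.1 Z) := fun w hw Z => by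
    rw [← coe_mul_apply, hcomm w (hW hw) σ hσA, coe_mul_apply]
  obtain ⟨k, k0, k1, k2⟩ := exists_aut_frame hP hσP horth hsum
  have k0' : (k⁻¹).1 (E 0) = P := by rw [← k0, coe_inv_apply_self]
  have k1' : (k⁻¹).1 (E 1) = σ.1 P := by rw [← k1, coe_inv_apply_self]
  have k2' : (k⁻¹).1 (E 2) = σ.1 (σ.1 P) := by rw [← k2, coe_inv_apply_self]
  set C : Submodule ℝ Albert := (fixedSpace (W : Set autGroup)).map k.1.toLinearMap
  have hC : ∀ X, k.1 X ∈ C ↔ X ∈ fixedSpace (W : Set autGroup) := fun X =>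
    k.1.injective.mem_set_image
  have hC' : ∀ X, X ∈ C ↔ (k⁻¹).1 X ∈ fixedSpace (W : Set autGroup) := fun X => by
    rw [← hC, coe_apply_inv_self]
  obtain ⟨l, hl⟩ := exists_aut_complex_of_frame ((fun w => k * w * k⁻¹) '' (W : Set autGroup))
    (by
      rintro _ ⟨w, hw, rfl⟩ i
      have h0 := hPW w hw
      have h1 := hWσ w hw P
      rw [h0] at h1
      have h2 := hWσ w hw (σ.1 P)
      rw [h1] at h2
      fin_cases i
      · change k.1 (w.1 ((k⁻¹).1 (E 0))) = E 0
        rw [k0', h0, k0]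
      · change k.1 (w.1 ((k⁻¹).1 (E 1))) = E 1
        rw [k1', h1, k1]
      · change k.1 (w.1 ((k⁻¹).1 (E 2))) = E 2
        rw [k2', h2, k2]) C
    (fun X => by
      rw [hC', mem_fixedSpace, Set.forall_mem_image]
      refine forall₂_congr fun w hw => ?_
      change _ ↔ k.1 (w.1 ((k⁻¹).1 X)) = X
      constructor
      · intro h
        rw [h, coe_apply_inv_self]
      · intro h
        nth_rw 2 [← h]
        rw [coe_inv_apply_self])
    (by
      rw [LinearEquiv.finrank_map_eq]
      rw [hW3] at hdim
      omega)
    (k * σ * k⁻¹)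
    (fun i => by
      fin_cases i
      · change k.1 (σ.1 ((k⁻¹).1 (E 0))) = E 1
        rw [k0', k1]
      · change k.1 (σ.1 ((k⁻¹).1 (E 1))) = E 2
        rw [k1', k2]
      · change k.1 (σ.1 ((k⁻¹).1 (E 2))) = E 0
        rw [k2', hσ3, k0])
    (fun X hX => by
      rw [hC'] at hX ⊢
      intro w hw
      rw [coe_mul_apply, coe_mul_apply, coe_inv_apply_self, hWσ w hw, hX w hw])
  exact ⟨l * k, fun X => by rw [← hC, hl]; rfl⟩

end Albert

/-! ### Translations and subgroups of order three -/

open Albert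

theorem natCard_field : Nat.card (GaloisField 3 3) = 27 := by
  rw [GaloisField.card 3 3 (by norm_num)]; norm_num

/-- Since `-1` is not a square in the field with `27` elements, every element is a square up to
sign. -/
theorem isSquare_or_isSquare_neg (a : GaloisField 3 3) : IsSquare a ∨ IsSquare (-a) := by
  classical
  let _ : Fintype (GaloisField 3 3) := Fintype.ofFinite _
  by_contra! h
  have hF : ringChar (GaloisField 3 3) ≠ 2 := by
    rw [ringChar.eq (GaloisField 3 3) 3]; norm_num
  have h1 : ¬ IsSquare (-1 : GaloisField 3 3) := by
    rw [FiniteField.isSquare_neg_one_iff, ← Nat.card_eq_fintype_card, natCard_field]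
    norm_num
  rw [← quadraticChar_neg_one_iff_not_isSquare] at h1
  have h2 := quadraticChar_neg_one_iff_not_isSquare.2 h.1
  have h3 := quadraticChar_neg_one_iff_not_isSquare.2 h.2
  rw [neg_eq_neg_one_mul, map_mul, h1, h2] at h3
  norm_num at h3

/-- The inclusion of the group of translations. -/
noncomputable def translations : Multiplicative (GaloisField 3 3) →* G351 where
  toFun b := ⟨Equiv.addRight b.toAdd, 1, b.toAdd, one_ne_zero, IsSquare.one, fun x => by simp⟩
  map_one' := Subtype.ext (Equiv.ext fun x => add_zero x)
  map_mul' b c := Subtype.ext (Equiv.ext fun x => by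
    change x + (b.toAdd + c.toAdd) = x + c.toAdd + b.toAdd
    ring)

theorem translations_apply (b : Multiplicative (GaloisField 3 3)) (x : GaloisField 3 3) :
    (translations b).1 x = x + b.toAdd := rfl

theorem translations_injective : Function.Injective translations := fun b c h => by
  have := congrArg (fun σ : G351 => σ.1 0) h
  simpa [translations_apply] using this

theorem natCard_range_translations : Nat.card translations.range = 27 := by
  rw [← natCard_field]
  exact (Nat.card_congr (MonoidHom.ofInjective translations_injective).toEquiv).symm

theorem pow_three_of_mem_translations {σ : G351} (h : σ ∈ translations.range) : σ ^ 3 = 1 := by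
  obtain ⟨b, rfl⟩ := h
  rw [← map_pow]
  have : b ^ 3 = 1 := by
    have : (3 : ℕ) • b.toAdd = 0 := by
      rw [nsmul_eq_mul, CharP.cast_eq_zero, zero_mul]
    exact this
  rw [this, map_one]

/-- The linear part `a` of an affine map of order three satisfies `(a - 1) ^ 3 = a ^ 3 - 1 = 0`. -/
theorem mem_translations_of_pow_three {σ : G351} (h : σ ^ 3 = 1) : σ ∈ translations.range := by
  obtain ⟨σ, a, b, ha, hs, hσ⟩ := σ
  have h3 : ∀ x, σ (σ (σ x)) = x := fun x => by
    have := congrArg (fun τ : G351 => τ.1 x) h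
    simpa [pow_succ] using this
  have h0 := h3 0
  have h1 := h3 1
  simp only [hσ] at h0 h1
  have hcube : (a - 1) ^ 3 = 0 := by
    rw [sub_pow_char]
    linear_combination h1 - h0
  have ha1 : a = 1 := sub_eq_zero.1 (pow_eq_zero_iff (by norm_num) |>.1 hcube)
  refine ⟨Multiplicative.ofAdd b, Subtype.ext (Equiv.ext fun x => ?_)⟩
  rw [translations_apply]
  change x + b = σ x
  rw [hσ, ha1, one_mul]

/-- Conjugation by `x ↦ a x` multiplies translation vectors by `a`. -/
theorem exists_conj_translations {σ τ : G351} (hσ : σ ∈ translations.range)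
    (hτ : τ ∈ translations.range) (hσ1 : σ ≠ 1) (hτ1 : τ ≠ 1) :
    ∃ g : G351, g * σ * g⁻¹ = τ ∨ g * σ * g⁻¹ = τ⁻¹ := by
  obtain ⟨b, rfl⟩ := hσ
  obtain ⟨c, rfl⟩ := hτ
  have hb : b.toAdd ≠ 0 := fun h => hσ1 (by rw [show b = 1 from h, map_one])
  have hc : c.toAdd ≠ 0 := fun h => hτ1 (by rw [show c = 1 from h, map_one])
  have key : ∀ d : Multiplicative (GaloisField 3 3), d.toAdd ≠ 0 →
      IsSquare (d.toAdd / b.toAdd) → ∃ g : G351, g * translations b * g⁻¹ = translations d := by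
    intro d hd hsq
    set a := d.toAdd / b.toAdd
    have ha : a ≠ 0 := div_ne_zero hd hb
    refine ⟨⟨Equiv.mulLeft₀ a ha, a, 0, ha, hsq, fun x => by simp⟩, ?_⟩
    rw [mul_inv_eq_iff_eq_mul]
    refine Subtype.ext (Equiv.ext fun x => ?_)
    change a * (x + b.toAdd) = a * x + d.toAdd
    rw [mul_add, div_mul_cancel₀ _ hb]
  rcases isSquare_or_isSquare_neg (c.toAdd / b.toAdd) with h | h
  · obtain ⟨g, hg⟩ := key c hc h
    exact ⟨g, Or.inl hg⟩
  · rw [← neg_div] at h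
    obtain ⟨g, hg⟩ := key c⁻¹ (neg_ne_zero.2 hc) h
    exact ⟨g, Or.inr (by rw [hg, map_inv])⟩

/-- Subgroups of order three in a group isomorphic to `G351` fix a complex projective plane. -/
theorem exists_image_fixedPoints_eq (G H : Subgroup IsomOP2) (e : G ≃* G351) (hHG : H ≤ G)
    (hH : Nat.card H = 3) : ∃ g : IsomOP2,
      (fun P : OP2 => g • P) '' MulAction.fixedPoints H OP2 = standardCP2 := by
  set φ : G351 →* autGroup := (ofIsom.comp G.subtype).comp e.symm.toMonoidHom
  have hφ : Function.Injective φ :=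
    (ofIsom_injective.comp G.subtype_injective).comp e.symm.injective
  obtain ⟨k, hk⟩ := exists_aut_complex (translations.range.map φ)
    ((Subgroup.card_map_of_injective hφ).trans natCard_range_translations)
    (by
      rintro _ ⟨σ, hσ, rfl⟩
      rw [← map_pow, pow_three_of_mem_translations hσ, map_one])
    (by
      rintro _ ⟨_, ⟨b, rfl⟩, rfl⟩ _ ⟨_, ⟨c, rfl⟩, rfl⟩
      rw [← map_mul, ← map_mul, ← map_mul, ← map_mul, mul_comm])
    (by
      rintro _ ⟨σ, hσ, rfl⟩ _ ⟨τ, hτ, rfl⟩ hσ1 hτ1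
      obtain ⟨g, hg⟩ := exists_conj_translations hσ hτ (fun h => hσ1 (by rw [h, map_one]))
        (fun h => hτ1 (by rw [h, map_one]))
      refine ⟨φ g, hg.imp (fun h => ?_) fun h => ?_⟩
      · rw [← h, map_mul, map_mul, map_inv]
      · rw [← map_inv φ τ, ← h, map_mul, map_mul, map_inv])
    (H.map ofIsom)
    (by
      rintro _ ⟨h, hh, rfl⟩
      have h3 : h ^ 3 = 1 := by
        have := pow_card_eq_one' (x := (⟨h, hh⟩ : H))
        rw [hH] at this
        exact congrArg Subtype.val this
      refine ⟨e ⟨h, hHG hh⟩, mem_translations_of_pow_three ?_, ?_⟩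
      · rw [← map_pow, ← map_one e]
        exact congrArg e (Subtype.ext h3)
      · change ofIsom (e.symm (e ⟨h, hHG hh⟩)).1 = ofIsom h
        rw [MulEquiv.symm_apply_apply])
    ((Subgroup.card_map_of_injective ofIsom_injective).trans hH)
  obtain ⟨g, hg⟩ := exists_isom_of_aut k
  have hfix : ∀ P : OP2, P ∈ MulAction.fixedPoints H OP2 ↔ g • P ∈ standardCP2 := fun P => by
    rw [mem_standardCP2]
    change _ ↔ ∀ i, (coord (g.1 P).1).2 i ∈ _
    rw [hg, ← hk, mem_fixedSpace]
    refine (Subtype.forall (p := fun h => h ∈ H)).trans (Iff.trans ?_ Set.forall_mem_image.symm)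
    refine forall₂_congr fun h hh => ?_
    rw [ofIsom_coord]
    exact coord_injective.eq_iff.symm
  refine ⟨g, Set.ext fun Q => ⟨?_, fun hQ => ⟨g⁻¹ • Q, ?_, smul_inv_smul g Q⟩⟩⟩
  · rintro ⟨P, hP, rfl⟩
    exact (hfix P).1 hP
  · rw [hfix, smul_inv_smul]
    exact hQ

/-! ### Triples of complex matrices -/

open scoped ComplexConjugate

namespace Octonion

/-- The octonion with a component `c` in `ℂ` and components `v 0`, `v 1`, `v 2` in its orthogonal
complement, which is identified with `ℂ³`. -/
def ofComponents (c : ℂ) (v : Fin 3 → ℂ) : Octonion :=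
  ⟨⟨c.re, c.im, (v 0).re, -(v 0).im⟩, ⟨(v 1).re, -(v 1).im, -(v 2).re, -(v 2).im⟩⟩

section components
variable (c : ℂ) (v : Fin 3 → ℂ)

theorem ofComponents_fst_re : (ofComponents c v).fst.re = c.re := rfl
theorem ofComponents_fst_imI : (ofComponents c v).fst.imI = c.im := rfl
theorem ofComponents_fst_imJ : (ofComponents c v).fst.imJ = (v 0).re := rfl
theorem ofComponents_fst_imK : (ofComponents c v).fst.imK = -(v 0).im := rfl
theorem ofComponents_snd_re : (ofComponents c v).snd.re = (v 1).re := rfl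
theorem ofComponents_snd_imI : (ofComponents c v).snd.imI = -(v 1).im := rfl
theorem ofComponents_snd_imJ : (ofComponents c v).snd.imJ = -(v 2).re := rfl
theorem ofComponents_snd_imK : (ofComponents c v).snd.imK = -(v 2).im := rfl

end components

attribute [local simp] ofComponents_fst_re ofComponents_fst_imI ofComponents_fst_imJ
  ofComponents_fst_imK ofComponents_snd_re ofComponents_snd_imI ofComponents_snd_imJ
  ofComponents_snd_imK

theorem exists_eq_ofComponents (x : Octonion) : ∃ c v, x = ofComponents c v :=
  ⟨⟨x.fst.re, x.fst.imI⟩, ![⟨x.fst.imJ, -x.fst.imK⟩, ⟨x.snd.re, -x.snd.imI⟩,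
    ⟨-x.snd.imJ, -x.snd.imK⟩], by apply ext_components <;> simp⟩

theorem ofComponents_injective {c d : ℂ} {v w : Fin 3 → ℂ}
    (h : ofComponents c v = ofComponents d w) : c = d ∧ v = w := by
  have h0 := congrArg (fun x : Octonion => x.fst.re) h
  have h1 := congrArg (fun x : Octonion => x.fst.imI) h
  have h2 := congrArg (fun x : Octonion => x.fst.imJ) h
  have h3 := congrArg (fun x : Octonion => x.fst.imK) h
  have h4 := congrArg (fun x : Octonion => x.snd.re) h
  have h5 := congrArg (fun x : Octonion => x.snd.imI) h
  have h6 := congrArg (fun x : Octonion => x.snd.imJ) h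
  have h7 := congrArg (fun x : Octonion => x.snd.imK) h
  simp at h0 h1 h2 h3 h4 h5 h6 h7
  refine ⟨Complex.ext h0 h1, funext fun i => ?_⟩
  fin_cases i
  exacts [Complex.ext h2 h3, Complex.ext h4 h5, Complex.ext h6 h7]

theorem ofComponents_mul (c d : ℂ) (v w : Fin 3 → ℂ) :
    ofComponents c v * ofComponents d w =
      ofComponents (c * d - (conj (v 0) * w 0 + conj (v 1) * w 1 + conj (v 2) * w 2))
        fun i => d * v i + conj c * w i - conj (v (i + 1) * w (i + 2) - v (i + 2) * w (i + 1)) := by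
  apply ext_components <;>
  simp [fst_re_mul, fst_imI_mul, fst_imJ_mul, fst_imK_mul, snd_re_mul, snd_imI_mul,
    snd_imJ_mul, snd_imK_mul, -fst_mul, -snd_mul] <;> ring

theorem star_ofComponents (c : ℂ) (v : Fin 3 → ℂ) :
    star (ofComponents c v) = ofComponents (conj c) fun i => -v i := by
  apply ext_components <;> simp

theorem ofComponents_sub_smul (r : ℝ) (c d : ℂ) (v w : Fin 3 → ℂ) :
    ofComponents c v - r • ofComponents d w =
      ofComponents (c - r * d) fun i => v i - r * w i := by
  apply ext_components <;> simp [fst_sub, snd_sub] <;> ring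

theorem ofComponents_add (c d : ℂ) (v w : Fin 3 → ℂ) :
    ofComponents (c + d) (fun i => v i + w i) = ofComponents c v + ofComponents d w := by
  apply ext_components <;> simp <;> ring

theorem ofComponents_smul (r : ℝ) (c : ℂ) (v : Fin 3 → ℂ) :
    ofComponents (r * c) (fun i => r * v i) = r • ofComponents c v := by
  apply ext_components <;> simp

theorem dot_ofComponents (c : ℂ) (v : Fin 3 → ℂ) :
    ((dot (ofComponents c v) (ofComponents c v) : ℝ) : ℂ) =
      c * conj c + (v 0 * conj (v 0) + v 1 * conj (v 1) + v 2 * conj (v 2)) := by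
  rw [dot_eq]
  apply Complex.ext <;> simp <;> ring

end Octonion

namespace Albert

/-- A triple of complex `3 × 3` matrices is self-adjoint if the first one is Hermitian and the other
two are adjoint to each other. -/
def IsSelfAdj (t : Fin 3 → Fin 3 → Fin 3 → ℂ) : Prop := ∀ l p q, conj (t l p q) = t (-l) q p

/-- The adjoint map on triples of complex matrices (the first Tits construction): it maps `(a, b,
c)` to `(adj a - b c, adj c - a b, adj b - c a)`. -/
def sharpTriple (t : Fin 3 → Fin 3 → Fin 3 → ℂ) (l p q : Fin 3) : ℂ :=
  t (2 * l) (q + 1) (p + 1) * t (2 * l) (q + 2) (p + 2) -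
    t (2 * l) (q + 1) (p + 2) * t (2 * l) (q + 2) (p + 1) -
    ∑ r, t (2 * l + 1) p r * t (2 * l + 2) r q

/-- The Hermitian octonionic matrix given by a self-adjoint triple `(H, M, M*)` of complex matrices:
the off-diagonal entries of `H` are the components in `ℂ`, the rows of `M` are the components in
`ℂ³`. -/
noncomputable def ofTriple (t : Fin 3 → Fin 3 → Fin 3 → ℂ) : Albert :=
  (fun i => (t 0 i i).re, fun i => ofComponents (t 0 (i + 1) (i + 2)) (t 1 i))

theorem ofTriple_add (t u : Fin 3 → Fin 3 → Fin 3 → ℂ) :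
    ofTriple (fun l p q => t l p q + u l p q) = ofTriple t + ofTriple u :=
  Prod.ext rfl (funext fun _ => ofComponents_add _ _ _ _)

theorem ofTriple_smul (r : ℝ) (t : Fin 3 → Fin 3 → Fin 3 → ℂ) :
    ofTriple (fun l p q => r * t l p q) = r • ofTriple t :=
  Prod.ext (funext fun _ => Complex.re_ofReal_mul _ _) (funext fun _ => ofComponents_smul _ _ _)

theorem ofTriple_injective {t u : Fin 3 → Fin 3 → Fin 3 → ℂ} (ht : IsSelfAdj t) (hu : IsSelfAdj u)
    (h : ofTriple t = ofTriple u) : t = u := by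
  have hre : ∀ {t}, IsSelfAdj t → ∀ i, ((t 0 i i).re : ℂ) = t 0 i i := fun ht i =>
    Complex.conj_eq_iff_re.1 (ht 0 i i)
  have hd : ∀ i, t 0 i i = u 0 i i := fun i => by
    rw [← hre ht, ← hre hu]
    exact congrArg _ (congrFun (congrArg Prod.fst h) i)
  have ho : ∀ i, t 0 (i + 1) (i + 2) = u 0 (i + 1) (i + 2) ∧ t 1 i = u 1 i := fun i =>
    ofComponents_injective (congrFun (congrArg Prod.snd h) i)
  have ho' : ∀ i, t 0 (i + 2) (i + 1) = u 0 (i + 2) (i + 1) := fun i => by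
    have h1 := ht 0 (i + 1) (i + 2)
    have h2 := hu 0 (i + 1) (i + 2)
    rw [(ho i).1, h2] at h1
    exact h1.symm
  have h2 : ∀ p q, t 2 p q = u 2 p q := fun p q => by
    have h1 := ht 1 q p
    rw [(ho q).2, hu 1 q p] at h1
    exact h1.symm
  funext l p q
  fin_cases l
  · fin_cases p <;> fin_cases q
    exacts [hd 0, (ho 2).1, ho' 1, ho' 2, hd 1, (ho 0).1, (ho 1).1, ho' 0, hd 2]
  · exact congrFun (ho p).2 q
  · exact h2 p q

theorem exists_ofTriple_eq (X : Albert) : ∃ t, IsSelfAdj t ∧ ofTriple t = X := by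
  have h : ∀ i, ∃ c v, X.2 i = ofComponents c v := fun i => exists_eq_ofComponents _
  choose c v hcv using h
  refine ⟨![![![X.1 0, c 2, conj (c 1)], ![conj (c 2), X.1 1, c 0], ![c 1, conj (c 0), X.1 2]],
    fun p q => v p q, fun p q => conj (v q p)], ?_, ?_⟩
  · intro l p q
    fin_cases l
    · fin_cases p <;> fin_cases q <;> simp
    · simp
    · simp
  · refine ext3 ?_ ?_ ?_ ?_ ?_ ?_
    · simp [ofTriple]
    · simp [ofTriple]
    · simp [ofTriple]
    · rw [hcv]; rfl
    · rw [hcv]; rfl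
    · rw [hcv]; rfl

theorem sharp_ofTriple {t : Fin 3 → Fin 3 → Fin 3 → ℂ} (ht : IsSelfAdj t) :
    sharp (ofTriple t) = ofTriple (sharpTriple t) := by
  have hre : ∀ i, ((t 0 i i).re : ℂ) = t 0 i i := fun i => Complex.conj_eq_iff_re.1 (ht 0 i i)
  have h0 : ∀ p q, conj (t 0 p q) = t 0 q p := fun p q => ht 0 p q
  have h1 : ∀ p q, conj (t 1 p q) = t 2 q p := fun p q => ht 1 p q
  have h2 : ∀ p q, conj (t 2 p q) = t 1 q p := fun p q => ht 2 p q
  have hfst : ∀ i, ((sharp (ofTriple t)).1 i : ℂ) = sharpTriple t 0 i i := fun i => by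
    simp only [sharp, ofTriple, Complex.ofReal_sub, Complex.ofReal_mul, hre, dot_ofComponents, h0,
      h1, sharpTriple, Fin.sum_univ_three, mul_zero, zero_add]
    ring
  have hsnd : ∀ i, (sharp (ofTriple t)).2 i = (ofTriple (sharpTriple t)).2 i := fun i => by
    simp only [sharp, ofTriple, ofComponents_mul, star_ofComponents, ofComponents_sub_smul, hre]
    congr 1
    · simp only [map_sub, map_add, map_mul, h0, h1, h2, sharpTriple, Fin.sum_univ_three]
      fin_cases i <;> simp <;> ring
    · funext k
      simp only [map_sub, map_mul, h0, h1, sharpTriple, Fin.sum_univ_three]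
      fin_cases i <;> fin_cases k <;> simp <;> ring
  exact Prod.ext (funext fun i => by rw [← Complex.ofReal_re ((sharp (ofTriple t)).1 i), hfst]; rfl)
    (funext hsnd)

end Albert

/-! ### The Weyl basis -/

namespace Albert

/-- The cube root of unity `exp (2 π i a / 3)`. -/
noncomputable def χ : AddChar (ZMod 3) ℂ := ZMod.stdAddChar

theorem conj_χ (a : ZMod 3) : conj (χ a) = χ (-a) := (AddChar.map_neg_eq_conj χ a).symm

theorem χ_injective : Function.Injective χ := ZMod.injective_stdAddChar

theorem sum_χ (a : ZMod 3) : ∑ j, χ (a * j) = if a = 0 then 3 else 0 := by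
  have := AddChar.sum_mulShift a (ZMod.isPrimitive_stdAddChar 3)
  simp only [ZMod.card] at this
  rw [χ]
  simp only [mul_comm a, this]
  split_ifs <;> simp

theorem sum_zmod_three (f : ZMod 3 → ℂ) : ∑ j, f j = f 0 + f 1 + f 2 := Fin.sum_univ_three f

theorem χ_one_add_χ_two : χ 1 + χ 2 = -1 := by
  have := sum_χ 1
  rw [sum_zmod_three, if_neg (by decide)] at this
  simp only [one_mul, AddChar.map_zero_eq_one] at this
  linear_combination this

/-- The matrix with coefficients `y (s, j)` with respect to the Weyl basis of the `3 × 3` matrices,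
whose elements are the products of powers of a cyclic permutation matrix and of a diagonal matrix of
cube roots of unity, with suitable phases. -/
noncomputable def weyl (y : ZMod 3 × ZMod 3 → ℂ) (p q : ZMod 3) : ℂ :=
  ∑ j, χ (-((p + q) * j)) * y (q - p, j)

/-- The Weyl basis is closed under multiplication up to phases. -/
theorem weyl_mul_weyl (y y' : ZMod 3 × ZMod 3 → ℂ) (p q : ZMod 3) :
    ∑ r, weyl y p r * weyl y' r q =
      weyl (fun a => ∑ b, χ (b.2 * (a - b).1 - b.1 * (a - b).2) * (y b * y' (a - b))) p q := by
  have hl : ∑ r, weyl y p r * weyl y' r q = ∑ t, ∑ j, ∑ k,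
      χ (-((p + (t + p)) * j)) * y (t + p - p, j) * (χ (-((t + p + q) * k)) *
        y' (q - (t + p), k)) := by
    rw [← Equiv.sum_comp (Equiv.addRight p)]
    simp only [weyl, Finset.sum_mul_sum, Equiv.coe_addRight]
  have hr : weyl (fun a => ∑ b, χ (b.2 * (a - b).1 - b.1 * (a - b).2) * (y b * y' (a - b))) p q =
      ∑ t, ∑ j, ∑ k, χ (-((p + q) * (k + j))) * (χ (j * (q - p - t) - t * (k + j - j)) *
        (y (t, j) * y' (q - p - t, k + j - j))) := by
    simp only [weyl, Fintype.sum_prod_type, Finset.mul_sum]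
    rw [Finset.sum_comm]
    refine Finset.sum_congr rfl fun t _ => ?_
    rw [Finset.sum_comm]
    refine Finset.sum_congr rfl fun j _ => ?_
    exact (Equiv.sum_comp (Equiv.addRight j) _).symm
  rw [hl, hr]
  refine Finset.sum_congr rfl fun t _ => Finset.sum_congr rfl fun j _ =>
    Finset.sum_congr rfl fun k _ => ?_
  have e1 : χ (-((p + (t + p)) * j)) * χ (-((t + p + q) * k)) =
      χ (-((p + q) * (k + j))) * χ (j * (q - p - t) - t * k) := by
    rw [← AddChar.map_add_eq_mul, ← AddChar.map_add_eq_mul]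
    congr 1
    ring
  rw [add_sub_cancel_right, add_sub_cancel_right, show q - (t + p) = q - p - t by ring]
  linear_combination y (t, j) * y' (q - p - t, k) * e1

/-- The adjugate of a matrix in the Weyl basis. The two pairs of indices `p + 1, p + 2` and `q + 1,
q + 2` involve the values `p - q`, twice, and `p - q + 1`, `p - q + 2` of the first coordinate. -/
theorem weyl_adj (y : ZMod 3 × ZMod 3 → ℂ) (p q : ZMod 3) :
    weyl y (q + 1) (p + 1) * weyl y (q + 2) (p + 2) -
      weyl y (q + 1) (p + 2) * weyl y (q + 2) (p + 1) =
      weyl (fun a => ∑ b, (if b = a - b then 1 else -1 / 2) * (y b * y (a - b))) p q := by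
  have h3 : (3 : ZMod 3) = 0 := rfl
  set f : ZMod 3 → ZMod 3 → ℂ := fun t j => χ (-((p + q) * j)) * y (p - q + t, j)
  have hr : weyl (fun a => ∑ b, (if b = a - b then 1 else -1 / 2) * (y b * y (a - b))) p q =
      ∑ t, ∑ j, ∑ k, (if t = -t ∧ j = k then 1 else -1 / 2) * (f t j * f (-t) k) := by
    simp only [weyl, Fintype.sum_prod_type, Finset.mul_sum]
    rw [Finset.sum_comm, ← Equiv.sum_comp (Equiv.addLeft (p - q))]
    refine Finset.sum_congr rfl fun t _ => ?_
    rw [Finset.sum_comm]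
    refine Finset.sum_congr rfl fun j _ => ?_
    rw [← Equiv.sum_comp (Equiv.addRight j)]
    refine Finset.sum_congr rfl fun k _ => ?_
    simp only [Equiv.coe_addRight, Equiv.coe_addLeft, Prod.mk_sub_mk, add_sub_cancel_right, f,
      Prod.mk.injEq]
    have e1 : q - p - (p - q + t) = p - q + -t := by linear_combination (q - p) * h3
    simp only [e1, add_right_inj, mul_add, neg_add, AddChar.map_add_eq_mul]
    ring
  have hw : ∀ s u : ZMod 3, weyl y (q + s) (p + u) = ∑ j, χ (-(s + u) * j) * f (u - s) j := by
    intro s u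
    refine Finset.sum_congr rfl fun j _ => ?_
    simp only [f]
    rw [← mul_assoc, ← AddChar.map_add_eq_mul]
    congr 2
    · ring
    · congr 1; ring
  have e11 : weyl y (q + 1) (p + 1) = ∑ j, χ (1 * j) * f 0 j := hw 1 1
  have e22 : weyl y (q + 2) (p + 2) = ∑ j, χ (2 * j) * f 0 j := hw 2 2
  have e12 : weyl y (q + 1) (p + 2) = ∑ j, χ (0 * j) * f 1 j := hw 1 2
  have e21 : weyl y (q + 2) (p + 1) = ∑ j, χ (0 * j) * f 2 j := hw 2 1
  rw [e11, e22, e12, e21, hr]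
  have d1 : (1 : ZMod 3) ≠ 0 := by decide
  have d2 : (2 : ZMod 3) ≠ 0 := by decide
  have d3 : (2 : ZMod 3) ≠ 1 := by decide
  have n1 : -(1 : ZMod 3) = 2 := rfl
  have n2 : -(2 : ZMod 3) = 1 := rfl
  have hmul : χ 1 * χ 2 = 1 := by
    rw [← AddChar.map_add_eq_mul]
    exact AddChar.map_zero_eq_one χ
  have h11 : χ 1 * χ 1 = χ 2 := (AddChar.map_add_eq_mul χ 1 1).symm
  have h22 : χ 2 * χ 2 = χ 1 := (AddChar.map_add_eq_mul χ 2 2).symm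
  have m22 : (2 : ZMod 3) * 2 = 1 := rfl
  simp only [sum_zmod_three, n1, n2, neg_zero, zero_mul, mul_zero, one_mul, mul_one, m22, d1, d2,
    d3, d1.symm, d2.symm, d3.symm, if_true, if_false, and_true, and_false, AddChar.map_zero_eq_one]
  linear_combination (f 0 1 ^ 2 + f 0 2 ^ 2) * hmul + f 0 1 * f 0 2 * (h11 + h22) +
    (f 0 0 * f 0 1 + f 0 0 * f 0 2 + f 0 1 * f 0 2) * χ_one_add_χ_two

theorem weyl_conj (y : ZMod 3 × ZMod 3 → ℂ) (p q : ZMod 3) :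
    conj (weyl y p q) = weyl (fun a => conj (y (-a))) q p := by
  simp only [weyl, map_sum, map_mul, conj_χ, Prod.neg_mk, neg_sub]
  refine (Equiv.sum_comp (Equiv.neg _) _).symm.trans (Finset.sum_congr rfl fun j _ => ?_)
  simp [add_comm]

theorem weyl_inversion (y : ZMod 3 × ZMod 3 → ℂ) (s j : ZMod 3) :
    ∑ p, χ ((2 * p + s) * j) * weyl y p (p + s) = 3 * y (s, j) := by
  have h : ∀ p k, χ ((2 * p + s) * j) * (χ (-((p + (p + s)) * k)) * y (p + s - p, k)) =
      χ (s * (j - k)) * y (s, k) * χ (2 * (j - k) * p) := fun p k => by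
    rw [add_sub_cancel_left]
    have e : χ ((2 * p + s) * j) * χ (-((p + (p + s)) * k)) =
        χ (s * (j - k)) * χ (2 * (j - k) * p) := by
      rw [← AddChar.map_add_eq_mul, ← AddChar.map_add_eq_mul]
      congr 1
      ring
    linear_combination y (s, k) * e
  simp only [weyl, Finset.mul_sum, h]
  rw [Finset.sum_comm]
  simp only [← Finset.mul_sum, sum_χ]
  have h2 : ∀ j k : ZMod 3, 2 * (j - k) = 0 ↔ k = j := by decide
  simp only [h2, mul_ite, mul_zero, Finset.sum_ite_eq', Finset.mem_univ, if_true,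
    sub_self, AddChar.map_zero_eq_one]
  ring

theorem exists_weyl_eq (m : ZMod 3 → ZMod 3 → ℂ) : ∃ y, weyl y = m := by
  refine ⟨fun a => 1 / 3 * ∑ r, χ ((2 * r + a.1) * a.2) * m r (r + a.1), funext₂ fun p q => ?_⟩
  have h : ∀ j r, χ (-((p + q) * j)) * (1 / 3 * (χ ((2 * r + (q - p)) * j) * m r (r + (q - p)))) =
      1 / 3 * m r (r + (q - p)) * χ (2 * (r - p) * j) := fun j r => by
    have e : χ (-((p + q) * j)) * χ ((2 * r + (q - p)) * j) = χ (2 * (r - p) * j) := by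
      rw [← AddChar.map_add_eq_mul]
      congr 1
      ring
    rw [← e]
    ring
  simp only [weyl, Finset.mul_sum, h]
  rw [Finset.sum_comm]
  simp only [← Finset.mul_sum, sum_χ]
  have h2 : ∀ p k : ZMod 3, 2 * (k - p) = 0 ↔ k = p := by decide
  simp only [h2, mul_ite, mul_zero, Finset.sum_ite_eq', Finset.mem_univ, if_true,
    add_sub_cancel]
  ring

end Albert

/-! ### A model on functions -/

namespace Albert

/-- Coordinates for the additive group of the field with `27` elements: `((s, j), l)` stands for
`s θ + j θ² + l`, where `θ ^ 3 = θ + 1`. -/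
abbrev Vec : Type := (ZMod 3 × ZMod 3) × ZMod 3

/-- A cubic form on `Vec`, chosen to make `phase` invariant under multiplication by `θ`. -/
def cubic (v : Vec) : ZMod 3 := v.1.2 ^ 2 * v.2 + v.1.1 * v.2 ^ 2 + v.1.1 ^ 2 * v.1.2

/-- The exponent of the phases occurring in `quad`. -/
def phase (b c : Vec) : ZMod 3 :=
  (b.2 - c.2) * (b.1.1 * c.1.2 - c.1.1 * b.1.2) + cubic b + cubic c - cubic (b + c)

/-- The coefficients of `quad`. -/
noncomputable def coeff (b c : Vec) : ℂ := (if b = c then 1 else -1 / 2) * χ (phase b c)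

/-- The adjoint map of the Albert algebra in its model on functions on `Vec`. -/
noncomputable def quad (z : Vec → ℂ) (a : Vec) : ℂ := ∑ b, coeff b (a - b) * (z b * z (a - b))

/-- The triple of complex matrices given by a function on `Vec`. -/
noncomputable def triple (z : Vec → ℂ) (l : ZMod 3) : ZMod 3 → ZMod 3 → ℂ :=
  weyl fun a => χ (cubic (a, l)) * z (a, l)

theorem weyl_sub (y y' : ZMod 3 × ZMod 3 → ℂ) (p q : ZMod 3) :
    weyl y p q - weyl y' p q = weyl (fun a => y a - y' a) p q := by
  simp only [weyl, ← Finset.sum_sub_distrib, mul_sub]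

/-- On triples of matrices, `quad` is the adjoint map: the pairs of vectors with third coordinates
`(2 l, 2 l)` give the adjugate at `2 l`, the pairs with third coordinates `2 l + 1` and `2 l + 2`,
in either order, give the product. -/
theorem triple_quad (z : Vec → ℂ) (l p q : ZMod 3) : triple (quad z) l p q =
    triple z (2 * l) (q + 1) (p + 1) * triple z (2 * l) (q + 2) (p + 2) -
      triple z (2 * l) (q + 1) (p + 2) * triple z (2 * l) (q + 2) (p + 1) -
      ∑ r, triple z (2 * l + 1) p r * triple z (2 * l + 2) r q := by
  simp only [triple]
  rw [weyl_adj, weyl_mul_weyl, weyl_sub]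
  congr 1
  funext a
  have h3 : (3 : ZMod 3) = 0 := rfl
  have d1 : (1 : ZMod 3) ≠ 2 := by decide
  have hs : quad z (a, l) = ∑ m, ∑ b, coeff (b, 2 * l + m) (a - b, 2 * l - m) *
      (z (b, 2 * l + m) * z (a - b, 2 * l - m)) := by
    rw [quad, Fintype.sum_prod_type, Finset.sum_comm, ← Equiv.sum_comp (Equiv.addLeft (2 * l))]
    have e : ∀ m, l - (2 * l + m) = 2 * l - m := fun m => by linear_combination (-l) * h3
    simp only [Equiv.coe_addLeft, Prod.mk_sub_mk, e]
  have e1 : 2 * l - 1 = 2 * l + 2 := by linear_combination -h3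
  have e2 : 2 * l - 2 = 2 * l + 1 := by linear_combination -h3
  have h0 : ∀ b, χ (cubic (a, l)) * (coeff (b, 2 * l) (a - b, 2 * l) *
      (z (b, 2 * l) * z (a - b, 2 * l))) = (if b = a - b then 1 else -1 / 2) *
      (χ (cubic (b, 2 * l)) * z (b, 2 * l) * (χ (cubic (a - b, 2 * l)) * z (a - b, 2 * l))) := by
    intro b
    have : χ (cubic (a, l)) * χ (phase (b, 2 * l) (a - b, 2 * l)) =
        χ (cubic (b, 2 * l)) * χ (cubic (a - b, 2 * l)) := by
      rw [← AddChar.map_add_eq_mul, ← AddChar.map_add_eq_mul]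
      congr 1
      have : ((b, 2 * l) + (a - b, 2 * l) : Vec) = (a, l) := by
        refine Prod.ext (add_sub_cancel b a) ?_
        change 2 * l + 2 * l = l
        linear_combination l * h3
      rw [phase, this]
      ring
    simp only [coeff, Prod.mk.injEq, and_true]
    linear_combination (if b = a - b then 1 else -1 / 2) * (z (b, 2 * l) * z (a - b, 2 * l)) * this
  have h1 : ∀ b, χ (cubic (a, l)) * (coeff (b, 2 * l + 1) (a - b, 2 * l + 2) *
      (z (b, 2 * l + 1) * z (a - b, 2 * l + 2))) = -1 / 2 *
      (χ (b.2 * (a - b).1 - b.1 * (a - b).2) * (χ (cubic (b, 2 * l + 1)) * z (b, 2 * l + 1) *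
        (χ (cubic (a - b, 2 * l + 2)) * z (a - b, 2 * l + 2)))) := by
    intro b
    have : χ (cubic (a, l)) * χ (phase (b, 2 * l + 1) (a - b, 2 * l + 2)) =
        χ (b.2 * (a - b).1 - b.1 * (a - b).2) *
          (χ (cubic (b, 2 * l + 1)) * χ (cubic (a - b, 2 * l + 2))) := by
      rw [← AddChar.map_add_eq_mul, ← AddChar.map_add_eq_mul, ← AddChar.map_add_eq_mul]
      congr 1
      have : ((b, 2 * l + 1) + (a - b, 2 * l + 2) : Vec) = (a, l) := by
        refine Prod.ext (add_sub_cancel b a) ?_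
        change 2 * l + 1 + (2 * l + 2) = l
        linear_combination (l + 1) * h3
      rw [phase, this]
      ring
    simp only [coeff, Prod.mk.injEq, add_right_inj, d1, and_false, if_false]
    linear_combination -1 / 2 * (z (b, 2 * l + 1) * z (a - b, 2 * l + 2)) * this
  have hsymm : ∀ b c, coeff b c = coeff c b := fun b c => by
    have : phase b c = phase c b := by rw [phase, phase, add_comm c b]; ring
    rw [coeff, coeff, this]
    simp only [eq_comm]
  have h2 : ∑ b, coeff (b, 2 * l + 2) (a - b, 2 * l + 1) *
      (z (b, 2 * l + 2) * z (a - b, 2 * l + 1)) = ∑ b, coeff (b, 2 * l + 1) (a - b, 2 * l + 2) *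
      (z (b, 2 * l + 1) * z (a - b, 2 * l + 2)) := by
    rw [← Equiv.sum_comp (Equiv.subLeft a)]
    refine Finset.sum_congr rfl fun b _ => ?_
    rw [Equiv.subLeft_apply, sub_sub_cancel, hsymm, mul_comm (z _)]
  rw [hs, sum_zmod_three, e1, e2, add_zero, sub_zero, h2, mul_add, mul_add]
  simp only [Finset.mul_sum, h0, h1]
  rw [← Finset.mul_sum]
  ring

theorem conj_triple (z : Vec → ℂ) (l p q : ZMod 3) :
    conj (triple z l p q) = triple (fun v => conj (z (-v))) (-l) q p := by
  rw [triple, triple, weyl_conj]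
  congr 1
  funext a
  rw [map_mul, conj_χ]
  congr 3
  · simp only [cubic, Prod.fst_neg, Prod.snd_neg]
    ring
  · exact Prod.ext rfl (neg_neg l).symm

theorem triple_injective : Function.Injective triple := fun z z' h => by
  funext v
  obtain ⟨⟨s, j⟩, l⟩ := v
  have h1 := weyl_inversion (fun a => χ (cubic (a, l)) * z (a, l)) s j
  have h2 := weyl_inversion (fun a => χ (cubic (a, l)) * z' (a, l)) s j
  have h3 : weyl (fun a => χ (cubic (a, l)) * z (a, l)) =
    weyl (fun a => χ (cubic (a, l)) * z' (a, l)) := congrFun h l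
  rw [h3, h2] at h1
  have hχ : χ (cubic ((s, j), l)) ≠ 0 := (AddChar.val_isUnit χ _).ne_zero
  exact (mul_left_cancel₀ hχ (mul_left_cancel₀ three_ne_zero h1)).symm

theorem exists_triple_eq (t : ZMod 3 → ZMod 3 → ZMod 3 → ℂ) : ∃ z, triple z = t := by
  choose y hy using fun l => exists_weyl_eq (t l)
  refine ⟨fun v => χ (-cubic v) * y v.2 v.1, funext fun l => ?_⟩
  rw [triple, ← hy]
  congr 1
  funext a
  rw [← mul_assoc, ← AddChar.map_add_eq_mul, add_neg_cancel, AddChar.map_zero_eq_one, one_mul]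

/-- The functions on `Vec` that correspond to self-adjoint triples of matrices. -/
def realFunctions : Submodule ℝ (Vec → ℂ) where
  carrier := {z | ∀ v, conj (z v) = z (-v)}
  zero_mem' v := by simp
  add_mem' hz hw v := by simp [hz v, hw v]
  smul_mem' r z hz v := by simp [hz v]

theorem isSelfAdj_triple {z : Vec → ℂ} (hz : z ∈ realFunctions) : IsSelfAdj (triple z) := by
  intro l p q
  refine (conj_triple z l p q).trans ?_
  have : (fun v => conj (z (-v))) = z := funext fun v => by rw [hz, neg_neg]
  rw [this]
  rfl

theorem mem_realFunctions_of_isSelfAdj {z : Vec → ℂ} (hz : IsSelfAdj (triple z)) :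
    z ∈ realFunctions := by
  have : (fun v => conj (z (-v))) = z := triple_injective <| by
    funext l p q
    have h1 := conj_triple z (-l) q p
    have h2 := hz (-l) q p
    rw [neg_neg] at h1
    rw [← h1]
    exact h2.trans (congrArg (fun m : ZMod 3 => triple z m p q) (neg_neg l))
  intro v
  have h := congrFun this (-v)
  rw [neg_neg] at h
  exact h

theorem triple_quad' (z : Vec → ℂ) : triple (quad z) = sharpTriple (triple z) :=
  funext fun l => funext fun p => funext fun q => triple_quad z l p q

theorem weyl_add (y y' : ZMod 3 × ZMod 3 → ℂ) (p q : ZMod 3) :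
    weyl (fun a => y a + y' a) p q = weyl y p q + weyl y' p q := by
  simp only [weyl, ← Finset.sum_add_distrib, mul_add]

theorem weyl_smul (r : ℝ) (y : ZMod 3 × ZMod 3 → ℂ) (p q : ZMod 3) :
    weyl (fun a => r * y a) p q = r * weyl y p q := by
  simp only [weyl, Finset.mul_sum, mul_left_comm]

/-- The function model of the space of Hermitian octonionic matrices. -/
noncomputable def ofFunction : realFunctions →ₗ[ℝ] Albert where
  toFun z := ofTriple (triple z.1)
  map_add' z w := by
    have h : triple (z + w).1 = fun l p q => triple z.1 l p q + triple w.1 l p q := by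
      funext l p q
      rw [triple, triple, triple, ← weyl_add]
      simp [mul_add]
    rw [h]
    exact ofTriple_add _ _
  map_smul' r z := by
    have h : triple (r • z).1 = fun l p q => r * triple z.1 l p q := by
      funext l p q
      rw [triple, triple, ← weyl_smul]
      simp [mul_left_comm]
    rw [h]
    exact ofTriple_smul _ _

theorem ofFunction_bijective : Function.Bijective ofFunction := by
  refine ⟨fun z w h => Subtype.ext (triple_injective
    (ofTriple_injective (isSelfAdj_triple z.2) (isSelfAdj_triple w.2) h)), fun X => ?_⟩
  obtain ⟨t, ht, rfl⟩ := exists_ofTriple_eq X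
  obtain ⟨z, rfl⟩ := exists_triple_eq t
  exact ⟨⟨z, mem_realFunctions_of_isSelfAdj ht⟩, rfl⟩

theorem quad_mem {z : Vec → ℂ} (hz : z ∈ realFunctions) : quad z ∈ realFunctions := by
  intro a
  rw [quad, quad, map_sum, ← Equiv.sum_comp (Equiv.neg _)]
  refine Finset.sum_congr rfl fun b _ => ?_
  have hp : ∀ b c, phase (-b) (-c) = -phase b c := fun b c => by
    simp only [phase, cubic, Prod.fst_neg, Prod.snd_neg, Prod.fst_add, Prod.snd_add]
    ring
  have hc : ∀ b c, conj (coeff b c) = coeff (-b) (-c) := fun b c => by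
    rw [coeff, coeff, hp, map_mul, conj_χ]
    simp only [neg_inj]
    split_ifs <;> simp [Complex.conj_ofNat]
  rw [map_mul, map_mul, hc, hz, hz, Equiv.neg_apply, neg_neg]
  have : -(a - -b) = -a - b := by abel
  rw [this]

theorem sharp_ofFunction (z : realFunctions) :
    sharp (ofFunction z) = ofFunction ⟨quad z.1, quad_mem z.2⟩ := by
  change sharp (ofTriple (triple z.1)) = ofTriple (triple (quad z.1))
  rw [triple_quad', sharp_ofTriple (isSelfAdj_triple z.2)]

theorem tr_ofFunction (z : realFunctions) : tr (ofFunction z) = 3 * (z.1 0).re := by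
  have h : triple z.1 0 0 0 + triple z.1 0 1 1 + triple z.1 0 2 2 = 3 * z.1 0 := by
    have := weyl_inversion (fun a => χ (cubic (a, 0)) * z.1 (a, 0)) 0 0
    rw [sum_zmod_three] at this
    have h0 : χ (cubic ((0, 0), 0)) = 1 := AddChar.map_zero_eq_one χ
    simp only [h0, mul_zero, AddChar.map_zero_eq_one, add_zero, one_mul] at this
    exact this
  have := congrArg Complex.re h
  rw [Complex.add_re, Complex.add_re] at this
  refine this.trans ?_
  simp

end Albert

/-! ### Multiplication in the field with 27 elements -/

namespace Albert

/-- The Artin-Schreier equation `θ ^ 3 = θ + 1` is solvable in the field with `27` elements. -/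
theorem exists_theta : ∃ θ : GaloisField 3 3, θ ^ 3 = θ + 1 := by
  set F := GaloisField 3 3
  let _ : Fintype F := Fintype.ofFinite _
  have h27 : ∀ x : F, x ^ 27 = x := fun x => by
    have := FiniteField.pow_card x
    rwa [← Nat.card_eq_fintype_card, natCard_field] at this
  -- for `f x = x ^ 3 - x` one has `f (f y) = y ^ 9 + y ^ 3 + y` and `f (f (f y)) = 0`
  obtain ⟨y, hy⟩ : ∃ y : F, y ^ 9 + y ^ 3 + y ≠ 0 := by
    by_contra! h
    let p : Polynomial F := Polynomial.X ^ 9 + Polynomial.X ^ 3 + Polynomial.X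
    have hdeg : p.natDegree = 9 := by
      simp only [p]
      compute_degree!
    have hp : p ≠ 0 := fun h => by rw [h] at hdeg; simp at hdeg
    have := Polynomial.card_le_degree_of_subset_roots (p := p) (Z := Finset.univ) fun x _ =>
      (Polynomial.mem_roots hp).2 (by simp [p, Polynomial.IsRoot, h])
    rw [hdeg, Finset.card_univ, ← Nat.card_eq_fintype_card, natCard_field] at this
    omega
  set w := y ^ 9 + y ^ 3 + y with hw
  have hw3 : w ^ 3 = w := by
    rw [hw, add_pow_char, add_pow_char, ← pow_mul, ← pow_mul, h27]
    ring
  have hw2 : w ^ 2 = 1 := by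
    have : w * (w ^ 2 - 1) = 0 := by linear_combination hw3
    rcases mul_eq_zero.1 this with h | h
    · exact (hy h).elim
    · linear_combination h
  -- `f` is linear over the prime field, which contains `w = f (f y)`
  refine ⟨w * (y ^ 3 - y), ?_⟩
  have h3 : (3 : F) = 0 := CharP.cast_eq_zero F 3
  rw [mul_pow, hw3, sub_pow_char, ← pow_mul]
  linear_combination hw2 - w * hw - w * y ^ 3 * h3

/-- Multiplication by `θ` in the coordinates of `Vec`. -/
def mulTheta (v : Vec) : Vec := ((v.1.2 + v.2, v.1.1), v.1.2)

/-- The choice of `cubic` makes this identity hold modulo `3`. -/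
theorem phase_mulTheta : ∀ b c, phase (mulTheta b) (mulTheta c) = phase b c := by
  rintro ⟨⟨s, j⟩, l⟩ ⟨⟨t, k⟩, n⟩
  have h3 : (3 : ZMod 3) = 0 := rfl
  simp only [phase, mulTheta, cubic, Prod.fst_add, Prod.snd_add]
  linear_combination (-(j * k * s + j * n * s + j * k * t + k * l * t + l * s * k + n * t * j +
    j ^ 2 * k + j * k ^ 2)) * h3

/-- The orbits of `mulTheta` on nonzero vectors are `{θ ^ k}` and `{-θ ^ k}`. -/
theorem exists_mulTheta_iterate :
    ∀ v : Vec, v ≠ 0 → ∃ k < 13, v = mulTheta^[k] (0, 1) ∨ v = - mulTheta^[k] (0, 1) := by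
  decide

/-- A root of the Artin-Schreier polynomial. -/
noncomputable def θ : GaloisField 3 3 := exists_theta.choose

theorem θ_cube : θ ^ 3 = θ + 1 := exists_theta.choose_spec

/-- The identification of `Vec` with the field, as an additive map. -/
noncomputable def toFieldHom : Vec →+ GaloisField 3 3 where
  toFun v := algebraMap (ZMod 3) _ v.1.1 * θ + algebraMap (ZMod 3) _ v.1.2 * θ ^ 2 +
    algebraMap (ZMod 3) _ v.2
  map_zero' := by simp
  map_add' v w := by
    simp only [Prod.fst_add, Prod.snd_add, map_add]
    ring

theorem toFieldHom_mulTheta (v : Vec) : toFieldHom (mulTheta v) = θ * toFieldHom v := by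
  change algebraMap (ZMod 3) (GaloisField 3 3) (v.1.2 + v.2) * θ +
    algebraMap (ZMod 3) _ v.1.1 * θ ^ 2 + algebraMap (ZMod 3) _ v.1.2 =
    θ * (algebraMap (ZMod 3) _ v.1.1 * θ +
    algebraMap (ZMod 3) _ v.1.2 * θ ^ 2 + algebraMap (ZMod 3) _ v.2)
  rw [map_add]
  linear_combination (-algebraMap (ZMod 3) (GaloisField 3 3) v.1.2) * θ_cube

theorem toFieldHom_one : toFieldHom (0, 1) = 1 := by
  change algebraMap (ZMod 3) (GaloisField 3 3) 0 * θ + algebraMap (ZMod 3) _ 0 * θ ^ 2 +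
    algebraMap (ZMod 3) _ 1 = 1
  simp

theorem toFieldHom_iterate (k : ℕ) (v : Vec) :
    toFieldHom (mulTheta^[k] v) = θ ^ k * toFieldHom v := by
  induction k with
  | zero => simp
  | succ k ih => rw [Function.iterate_succ_apply', toFieldHom_mulTheta, ih, pow_succ]; ring

theorem θ_ne_zero : θ ≠ 0 := fun h => by
  have := θ_cube
  rw [h] at this
  simp at this

/-- Every nonzero vector is, up to sign, a power of `θ`; so the map to the field is injective. -/
theorem toFieldHom_injective : Function.Injective toFieldHom := by
  refine (injective_iff_map_eq_zero _).2 fun v hv => ?_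
  by_contra h
  obtain ⟨k, -, rfl | rfl⟩ := exists_mulTheta_iterate v h
  · rw [toFieldHom_iterate, toFieldHom_one, mul_one] at hv
    exact pow_ne_zero k θ_ne_zero hv
  · rw [map_neg, toFieldHom_iterate, toFieldHom_one, mul_one, neg_eq_zero] at hv
    exact pow_ne_zero k θ_ne_zero hv

/-- The identification of `Vec` with the field with `27` elements. -/
noncomputable def toField : Vec ≃+ GaloisField 3 3 :=
  AddEquiv.ofBijective toFieldHom <| (Nat.bijective_iff_injective_and_card _).2
    ⟨toFieldHom_injective, by rw [natCard_field]; simp⟩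

theorem toField_apply (v : Vec) : toField v = toFieldHom v := rfl

/-- Multiplication by a nonzero field element on `Vec`. -/
noncomputable def mulEquiv (a : GaloisField 3 3) (ha : a ≠ 0) : Vec ≃+ Vec :=
  (toField.trans { Equiv.mulLeft₀ a ha with map_add' := mul_add a }).trans toField.symm

theorem toField_mulEquiv {a : GaloisField 3 3} (ha : a ≠ 0) (v : Vec) :
    toField (mulEquiv a ha v) = a * toField v :=
  toField.apply_symm_apply _

/-- Every nonzero square is a power of `θ`. -/
theorem exists_eq_pow {a : GaloisField 3 3} (ha : a ≠ 0) (hs : IsSquare a) :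
    ∃ k : ℕ, a = θ ^ k := by
  obtain ⟨c, rfl⟩ := hs
  obtain ⟨v, rfl⟩ := toField.surjective c
  have hv : v ≠ 0 := fun h => ha (by rw [h, map_zero, zero_mul])
  obtain ⟨k, -, rfl | rfl⟩ := exists_mulTheta_iterate v hv
  · refine ⟨k + k, ?_⟩
    rw [toField_apply, toFieldHom_iterate, toFieldHom_one, mul_one, pow_add]
  · refine ⟨k + k, ?_⟩
    rw [map_neg, toField_apply, toFieldHom_iterate, toFieldHom_one, mul_one, neg_mul_neg, pow_add]

theorem coeff_mulEquiv {a : GaloisField 3 3} (ha : a ≠ 0) (hs : IsSquare a) (b c : Vec) :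
    coeff (mulEquiv a ha b) (mulEquiv a ha c) = coeff b c := by
  obtain ⟨k, hk⟩ := exists_eq_pow ha hs
  have hm : ∀ v, mulEquiv a ha v = mulTheta^[k] v := fun v => by
    apply toField.injective
    rw [toField_mulEquiv, hk]
    exact (toFieldHom_iterate k v).symm
  have hp : ∀ b c, phase (mulTheta^[k] b) (mulTheta^[k] c) = phase b c := by
    intro b c
    clear hm hk
    induction k with
    | zero => rfl
    | succ k ih =>
      rw [Function.iterate_succ_apply', Function.iterate_succ_apply', phase_mulTheta, ih]
  simp only [coeff, EmbeddingLike.apply_eq_iff_eq]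
  rw [hm, hm, hp]

end Albert

/-! ### The action of the group of order 351 -/

namespace G351

variable (σ τ : G351)

/-- The linear part of an affine map. -/
noncomputable def slope : GaloisField 3 3 := σ.1 1 - σ.1 0

theorem exists_slope : slope σ ≠ 0 ∧ IsSquare (slope σ) ∧ ∀ x, σ.1 x = slope σ * x + σ.1 0 := by
  obtain ⟨σ, a, b, ha, hs, h⟩ := σ
  have h0 : σ 0 = b := by rw [h, mul_zero, zero_add]
  have h1 : slope ⟨σ, a, b, ha, hs, h⟩ = a := by
    change σ 1 - σ 0 = a
    rw [h, h]
    ring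
  rw [h1]
  exact ⟨ha, hs, fun x => (h x).trans (by rw [h0])⟩

theorem slope_ne_zero : slope σ ≠ 0 := (exists_slope σ).1
theorem isSquare_slope : IsSquare (slope σ) := (exists_slope σ).2.1
theorem apply_eq (x : GaloisField 3 3) : σ.1 x = slope σ * x + σ.1 0 := (exists_slope σ).2.2 x

theorem mul_apply_zero : (σ * τ).1 0 = slope σ * τ.1 0 + σ.1 0 := apply_eq σ (τ.1 0)

theorem slope_mul : slope (σ * τ) = slope σ * slope τ := by
  change σ.1 (τ.1 1) - σ.1 (τ.1 0) = slope σ * (τ.1 1 - τ.1 0)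
  rw [apply_eq σ (τ.1 1), apply_eq σ (τ.1 0)]
  ring

end G351

namespace Albert

open G351

/-- A nonzero additive functional on the field with `27` elements. -/
noncomputable def functional : GaloisField 3 3 →+ ZMod 3 :=
  (AddMonoidHom.snd (ZMod 3 × ZMod 3) (ZMod 3)).comp toField.symm.toAddMonoidHom

theorem functional_one : functional 1 = 1 := by
  have : toField.symm 1 = (0, 1) := by
    rw [AddEquiv.symm_apply_eq]
    exact toFieldHom_one.symm
  change (toField.symm 1).2 = 1
  rw [this]

theorem eq_zero_of_functional {b : GaloisField 3 3} (h : ∀ x, functional (b * x) = 0) : b = 0 := by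
  by_contra hb
  have := h b⁻¹
  rw [mul_inv_cancel₀ hb, functional_one] at this
  exact one_ne_zero this

/-- The action of affine maps `x ↦ a x + b` on functions: `a` acts by substitution, `b` by
multiplication with a character. -/
noncomputable def actFun (σ : G351) (z : Vec → ℂ) (v : Vec) : ℂ :=
  χ (functional (σ.1 0 * toField v)) * z (mulEquiv (slope σ) (slope_ne_zero σ) v)

theorem quad_actFun (σ : G351) (z : Vec → ℂ) : quad (actFun σ z) = actFun σ (quad z) := by
  funext v
  rw [quad, actFun, quad, Finset.mul_sum]
  refine Eq.trans ?_ (Equiv.sum_comp (mulEquiv (slope σ) (slope_ne_zero σ)).toEquiv _)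
  refine Finset.sum_congr rfl fun b _ => ?_
  simp only [AddEquiv.toEquiv_eq_coe, AddEquiv.coe_toEquiv]
  rw [← map_sub, coeff_mulEquiv _ (isSquare_slope σ), actFun, actFun]
  have : χ (functional (σ.1 0 * toField v)) = χ (functional (σ.1 0 * toField b)) *
      χ (functional (σ.1 0 * toField (v - b))) := by
    rw [← AddChar.map_add_eq_mul, ← map_add, ← mul_add, ← map_add, add_sub_cancel]
  rw [this]
  ring

theorem actFun_mul (σ τ : G351) (z : Vec → ℂ) : actFun (σ * τ) z = actFun σ (actFun τ z) := by
  funext v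
  have h : mulEquiv (slope (σ * τ)) (slope_ne_zero _) v =
      mulEquiv (slope τ) (slope_ne_zero τ) (mulEquiv (slope σ) (slope_ne_zero σ) v) := by
    apply toField.injective
    rw [toField_mulEquiv, toField_mulEquiv, toField_mulEquiv, slope_mul]
    ring
  rw [actFun, actFun, actFun, h, ← mul_assoc, ← AddChar.map_add_eq_mul, ← map_add,
    toField_mulEquiv, mul_apply_zero]
  congr 4
  ring

/-- The action of affine maps on real functions. -/
noncomputable def act (σ : G351) : realFunctions →ₗ[ℝ] realFunctions where
  toFun z := ⟨actFun σ z.1, fun v => by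
    rw [actFun, actFun, map_mul, conj_χ, z.2, map_neg toField, mul_neg, map_neg functional,
      map_neg (mulEquiv _ _)]⟩
  map_add' z w := Subtype.ext (funext fun v => mul_add _ _ _)
  map_smul' r z := Subtype.ext (funext fun v => mul_smul_comm r _ _)

/-- The function model as a linear equivalence. -/
noncomputable def functionEquiv : realFunctions ≃ₗ[ℝ] Albert :=
  LinearEquiv.ofBijective ofFunction ofFunction_bijective

theorem exists_aut_act (σ : G351) :
    ∃ k : autGroup, ∀ z, k.1 (functionEquiv z) = functionEquiv (act σ z) := by
  obtain ⟨k, hk⟩ := exists_aut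
    (functionEquiv.toLinearMap ∘ₗ act σ ∘ₗ functionEquiv.symm.toLinearMap)
    (fun X => by
      obtain ⟨z, rfl⟩ := functionEquiv.surjective X
      simp only [LinearMap.comp_apply, LinearEquiv.coe_coe, LinearEquiv.symm_apply_apply]
      refine (tr_ofFunction _).trans (Eq.trans ?_ (tr_ofFunction z).symm)
      change 3 * (actFun σ z.1 0).re = _
      rw [actFun, map_zero toField, mul_zero, map_zero functional, AddChar.map_zero_eq_one, one_mul,
        map_zero (mulEquiv _ _)])
    (fun X => by
      obtain ⟨z, rfl⟩ := functionEquiv.surjective X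
      have h : ∀ z, sharp (functionEquiv z) = functionEquiv ⟨quad z.1, quad_mem z.2⟩ :=
        sharp_ofFunction
      simp only [h, LinearMap.comp_apply, LinearEquiv.coe_coe, LinearEquiv.symm_apply_apply]
      exact congrArg functionEquiv (Subtype.ext (quad_actFun σ z.1)))
  refine ⟨k, fun z => (hk _).trans ?_⟩
  simp

/-- The action of the group of order `351` on Hermitian octonionic matrices. -/
noncomputable def autHom : G351 →* autGroup :=
  MonoidHom.mk' (fun σ => (exists_aut_act σ).choose) fun σ τ => by
    refine Subtype.ext (LinearEquiv.ext fun X => ?_)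
    obtain ⟨z, rfl⟩ := functionEquiv.surjective X
    change _ = (exists_aut_act σ).choose.1 ((exists_aut_act τ).choose.1 (functionEquiv z))
    rw [(exists_aut_act (σ * τ)).choose_spec, (exists_aut_act τ).choose_spec,
      (exists_aut_act σ).choose_spec]
    exact congrArg functionEquiv (Subtype.ext (actFun_mul σ τ z.1))

theorem autHom_apply (σ : G351) (z : realFunctions) :
    (autHom σ).1 (functionEquiv z) = functionEquiv (act σ z) := (exists_aut_act σ).choose_spec z

theorem autHom_injective : Function.Injective autHom := by
  refine (injective_iff_map_eq_one autHom).2 fun σ hσ => ?_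
  have hact : ∀ z : realFunctions, actFun σ z.1 = z.1 := fun z => by
    have h := autHom_apply σ z
    rw [hσ] at h
    exact congrArg Subtype.val (functionEquiv.injective h).symm
  -- the characters of the field are real functions and determine the affine map
  have key : ∀ c, σ.1 0 + c * slope σ = c := fun c => by
    refine sub_eq_zero.1 (eq_zero_of_functional fun x => ?_)
    have hreal : (fun v => χ (functional (c * toField v))) ∈ realFunctions := fun v => by
      change conj (χ _) = χ (functional (c * toField (-v)))
      rw [conj_χ, map_neg toField, mul_neg, map_neg functional]
    have h := congrFun (hact ⟨_, hreal⟩) (toField.symm x)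
    rw [actFun] at h
    simp only [toField_mulEquiv, AddEquiv.apply_symm_apply, ← AddChar.map_add_eq_mul,
      ← map_add] at h
    have h' := χ_injective h
    rw [sub_mul, map_sub, sub_eq_zero, ← h']
    congr 1
    ring
  have h0 : σ.1 0 = 0 := by simpa using key 0
  have h1 : slope σ = 1 := by simpa [h0] using key 1
  refine Subtype.ext (Equiv.ext fun x => ?_)
  rw [apply_eq, h0, h1, one_mul, add_zero]
  rfl

/-- Isometries of the projective plane extend uniquely to automorphisms. -/
noncomputable def isomEquiv : IsomOP2 ≃* autGroup :=
  MulEquiv.ofBijective ofIsom ⟨ofIsom_injective, fun k => by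
    obtain ⟨f, hf⟩ := exists_isom_of_aut k
    exact ⟨f, aut_ext fun P => by rw [ofIsom_coord, hf]⟩⟩

end Albert

theorem image_fixedPoints_conj (g : IsomOP2) (H : Subgroup IsomOP2) :
    MulAction.fixedPoints (H.map (MulAut.conj g).toMonoidHom) OP2 =
      (fun P : OP2 => g • P) '' MulAction.fixedPoints H OP2 := by
  ext Q
  constructor
  · intro hQ
    refine ⟨g⁻¹ • Q, fun h => ?_, smul_inv_smul g Q⟩
    have := hQ ⟨_, h.1, h.2, rfl⟩
    change (g * h.1 * g⁻¹) • Q = Q at this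
    rw [mul_smul, mul_smul] at this
    rw [eq_inv_smul_iff]
    exact this
  · rintro ⟨P, hP, rfl⟩ ⟨_, h, hh, rfl⟩
    have := hP ⟨h, hh⟩
    change h • P = P at this
    change (g * h * g⁻¹) • g • P = g • P
    rw [mul_smul, mul_smul, inv_smul_smul, this]

/-- The action of `G351` on matrices gives one on the projective plane; a subgroup of order three
fixes a complex projective plane, which a conjugation makes the standard one. -/
theorem exists_fixedPoints_eq : ∃ G H : Subgroup IsomOP2, Nonempty (G ≃* G351) ∧ H ≤ G ∧
    Nat.card H = 3 ∧ MulAction.fixedPoints H OP2 = standardCP2 := by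
  set φ : G351 →* IsomOP2 := isomEquiv.symm.toMonoidHom.comp autHom
  have hφ : Function.Injective φ := isomEquiv.symm.injective.comp autHom_injective
  set t := translations (Multiplicative.ofAdd 1)
  have ht1 : t ≠ 1 := fun h => by
    rw [← map_one translations] at h
    have h1 : Multiplicative.ofAdd (1 : GaloisField 3 3) = 1 := translations_injective h
    have h2 : (1 : GaloisField 3 3) = 0 := congrArg Multiplicative.toAdd h1
    exact one_ne_zero h2
  set H := (Subgroup.zpowers t).map φ
  have : Fact (Nat.Prime 3) := ⟨Nat.prime_three⟩
  have hH : Nat.card H = 3 := by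
    rw [Subgroup.card_map_of_injective hφ, Nat.card_zpowers,
      orderOf_eq_prime (pow_three_of_mem_translations ⟨_, rfl⟩) ht1]
  have hHG : H ≤ φ.range := by
    rintro _ ⟨σ, -, rfl⟩
    exact ⟨σ, rfl⟩
  have e : φ.range ≃* G351 := (MonoidHom.ofInjective hφ).symm
  obtain ⟨g, hg⟩ := exists_image_fixedPoints_eq φ.range H e hHG hH
  have hconj : Function.Injective (MulAut.conj g).toMonoidHom := (MulAut.conj g).injective
  refine ⟨φ.range.map (MulAut.conj g).toMonoidHom, H.map (MulAut.conj g).toMonoidHom,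
    ⟨(φ.range.equivMapOfInjective _ hconj).symm.trans e⟩, Subgroup.map_mono hHG, ?_, ?_⟩
  · rw [Subgroup.card_map_of_injective hconj, hH]
  · rw [image_fixedPoints_conj, hg]

theorem mainTheorem9 :
    (∀ G H : Subgroup IsomOP2, Nonempty (G ≃* G351) → H ≤ G → Nat.card H = 3 →
      ∃ g : IsomOP2, (fun P : OP2 => g • P) '' MulAction.fixedPoints H OP2 = standardCP2) ∧
    (∃ G H : Subgroup IsomOP2, Nonempty (G ≃* G351) ∧ H ≤ G ∧ Nat.card H = 3 ∧
      MulAction.fixedPoints H OP2 = standardCP2) := by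
  exact ⟨fun G H ⟨e⟩ hHG hH => exists_image_fixedPoints_eq G H e hHG hH, exists_fixedPoints_eq⟩
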